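/- Let $K\subset\mathbb R^2$ be a closed simple polygon (straight angles at vertices are allowed) that is star-shaped with respect to a ball, with edge set $\mathcal E(K)$. Let $\mathcal T(K)$ be a finite conforming triangulation of $K$ that introduces no additional nodes on $\partial K$, i.e. the edges of $K$ are edges of $\mathcal T(K)$. Let $\nu>0$ and let $k,m\ge 0$ be integers. $P_s$ denotes the polynomials of degree at most $s$ ($P_s=\{0\}$ for $s<0$), $\boldsymbol P_s$ their vector-valued version, $P_s(\mathcal T(K))$ the piecewise version, and $\mathcal G_s^\perp$ the $L^2(K)$-orthogonal complement of $\nabla P_{s+1}(K)$ in $\boldsymbol P_s(K)$. Let $v_h$ belong to the local virtual element space $$V_h^K=\{v\in H^1(K)^2: v|_{\partial K}\in C^0(\partial K)^2,\ v|_E\in \boldsymbol P_k(E)\ \forall E\in\mathcal E(K),\ -\nu\Delta v+\nabla s\in\mathcal G_{k-2}^\perp\text{ for some }s\in L^2(K),\ \operatorname{div}v\in P_{k-1}(K)\}.$$ Let $\mathrm{RT}_m(\mathcal T(K))$ be the space of all $w\in H(\operatorname{div},K)$ with $w|_T(x)=a(x)+b(x)x$, $a\in\boldsymbol P_m$, $b\in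 P_m$, on every $T\in\mathcal T(K)$. The standard Raviart–Thomas interpolation $\Pi_{\mathrm{RT}_m}v_h\in \mathrm{RT}_m(\mathcal T(K))$ is defined by $$\int_T(\Pi_{\mathrm{RT}_m}v_h-v_h)\cdot q\,dx=0\ \ \forall q\in\boldsymbol P_{m-1}(T),\ T\in\mathcal T(K),\qquad \int_E(\Pi_{\mathrm{RT}_m}v_h-v_h)\cdot n\,q\,ds=0\ \ \forall q\in P_m(E)$$ for all edges $E$ of $\mathcal T(K)$. Let $\Pi^{\nabla,K}_kv_h\in\boldsymbol P_k(K)$ be the energy projection, defined by $\nu\int_K\nabla q:\nabla(v_h-\Pi^{\nabla,K}_kv_h)\,dx=0$ for all $q\in\boldsymbol P_k(K)$ and $\int_K(v_h-\Pi^{\nabla,K}_kv_h)\,dx=0$. Let $W_h(K,v_h,m)$ be the set of all $w_h\in\mathrm{RT}_m(\mathcal T(K))$ such that - $\int_K\operatorname{div}(v_h-w_h)\,q\,dx=0$ for all $q\in P_m(\mathcal T(K))$, - $\int_K(v_h-w_h)\cdot q^\perp\,dx=0$ for all $q^\perp\in\mathcal G_{m-1}^\perp$, - $\int_E(v_h-w_h)\cdot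 n\,q\,ds=0$ for all $E\in\mathcal E(K)$ and $q\in P_m(E)$. Then $\Pi_{\mathrm{RT}_m}v_h$ and $\Pi^{\nabla,K}_kv_h$ exist and are unique, and $\Pi_{\mathrm{RT}_m}v_h\in W_h(K,v_h,m)$. In particular $W_h(K,v_h,m)$ is non-empty, and the minimisation problem defining $$I_{\mathrm{RT}_m}(v_h):=\operatorname*{arg\,min}_{w_h\in W_h(K,v_h,m)}\|\Pi^{\nabla,K}_kv_h-w_h\|_{L^2(K)}$$ has exactly one solution. If moreover $K$ is a triangle and $\mathcal T(K)=\{K\}$, then $W_h(K,v_h,m)=\{\Pi_{\mathrm{RT}_m}v_h\}$. -/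

import Mathlib

open MeasureTheory Filter Topology Set
open scoped ContDiff

noncomputable section

namespace PolyRT

/-- The Euclidean plane. -/
abbrev Plane := EuclideanSpace ℝ (Fin 2)

/-- Bivariate real polynomials. -/
abbrev Poly2 := MvPolynomial (Fin 2) ℝ

/-- The Hilbert space `L²(K; ℝ²)` of vector fields modulo equality almost everywhere. -/
abbrev L2 (K : Set Plane) := Lp Plane 2 (volume.restrict K)

/-! ### Polynomials -/

/-- Polynomials of total degree at most `s`; for negative `s` only the zero polynomial. -/
def polyDeg (s : ℤ) : Submodule ℝ Poly2 where
  carrier := {p | ∀ d ∈ p.support, (d.degree : ℤ) ≤ s}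
  zero_mem' := by simp
  add_mem' := by
    intro p q hp hq d hd
    rcases Finset.mem_union.1 (MvPolynomial.support_add hd) with h | h
    · exact hp d h
    · exact hq d h
  smul_mem' := by
    intro c p hp d hd
    exact hp d (MvPolynomial.support_smul hd)

/-- Vector-valued polynomials with both components of total degree at most `s`. -/
def vecPolyDeg (s : ℤ) : Set (Fin 2 → Poly2) := {p | ∀ i, p i ∈ polyDeg s}

/-- The polynomial function `x ↦ p(x)`. -/
def evalPoly (p : Poly2) (x : Plane) : ℝ := MvPolynomial.eval (fun i => x i) p

/-- The vector-valued polynomial function `x ↦ (p₀(x), p₁(x))`. -/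
def evalVec (p : Fin 2 → Poly2) (x : Plane) : Plane :=
  WithLp.toLp 2 (fun i => evalPoly (p i) x)

/-- The gradient of a polynomial. -/
def gradPoly (r : Poly2) : Fin 2 → Poly2 := fun i => MvPolynomial.pderiv i r

/-- The space `𝒢ₛ(K)^⊥`: vector polynomials of degree at most `s` that are `L²(K)`-orthogonal to
the gradients of all polynomials of degree at most `s + 1`. -/
def gradOrtho (K : Set Plane) (s : ℤ) : Set (Fin 2 → Poly2) :=
  {p | p ∈ vecPolyDeg s ∧ ∀ r ∈ polyDeg (s + 1),
    ∫ x in K, inner ℝ (evalVec p x) (evalVec (gradPoly r) x) = 0}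

/-! ### Weak derivatives and traces -/

/-- Smooth functions with compact support in the interior of `D`. -/
def IsTestFunction {F : Type*} [NormedAddCommGroup F] [NormedSpace ℝ F]
    (D : Set Plane) (φ : Plane → F) : Prop :=
  ContDiff ℝ ∞ φ ∧ HasCompactSupport φ ∧ tsupport φ ⊆ interior D

/-- `G` is the weak derivative (Jacobian) of the vector field `u` in the interior of `D`;
`G x y` is the derivative at `x` in direction `y`. -/
def HasWeakDeriv (D : Set Plane) (u : Plane → Plane) (G : Plane → Plane →L[ℝ] Plane) : Prop :=
  ∀ φ : Plane → ℝ, IsTestFunction D φ → ∀ y : Plane,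
    ∫ x in D, (fderiv ℝ φ x y) • u x = - ∫ x in D, φ x • G x y

/-- `u ∈ H¹(D; ℝ²)` with (square integrable) weak derivative `G`. -/
def MemH1With (D : Set Plane) (u : Plane → Plane) (G : Plane → Plane →L[ℝ] Plane) : Prop :=
  MemLp u 2 (volume.restrict D) ∧ MemLp G 2 (volume.restrict D) ∧ HasWeakDeriv D u G

/-- `d` is the weak divergence of the vector field `u` in the interior of `D`. -/
def HasWeakDiv (D : Set Plane) (u : Plane → Plane) (d : Plane → ℝ) : Prop :=
  ∀ φ : Plane → ℝ, IsTestFunction D φ →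
    ∫ x in D, fderiv ℝ φ x (u x) = - ∫ x in D, φ x * d x

/-- `u ∈ H(div, D)` with (square integrable) weak divergence `d`. -/
def MemHDivWith (D : Set Plane) (u : Plane → Plane) (d : Plane → ℝ) : Prop :=
  MemLp u 2 (volume.restrict D) ∧ MemLp d 2 (volume.restrict D) ∧ HasWeakDiv D u d

/-- The arc length measure on the segment from `a` to `b`. -/
def segMeasure (a b : Plane) : Measure Plane :=
  ENNReal.ofReal (dist a b) •
    (volume.restrict (Icc (0 : ℝ) 1)).map (fun t => AffineMap.lineMap (k := ℝ) a b t)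

/-- `g` is the trace on the segment `[a, b]` of `u ∈ H¹(D; ℝ²)`, that is, the `L²([a, b])`-limit
of the restrictions to `[a, b]` of smooth vector fields that converge to `u` in `H¹(D; ℝ²)`.
Here `[a, b]` is an edge of the polygon `D`. -/
def HasTrace (D : Set Plane) (a b : Plane) (u g : Plane → Plane) : Prop :=
  MemLp g 2 (segMeasure a b) ∧
  ∃ G, MemH1With D u G ∧ ∃ φ : ℕ → Plane → Plane, (∀ j, ContDiff ℝ ∞ (φ j)) ∧
    Tendsto (fun j => eLpNorm (fun x => φ j x - u x) 2 (volume.restrict D)) atTop (𝓝 0) ∧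
    Tendsto (fun j => eLpNorm (fun x => fderiv ℝ (φ j) x - G x) 2 (volume.restrict D))
      atTop (𝓝 0) ∧
    Tendsto (fun j => eLpNorm (fun x => φ j x - g x) 2 (segMeasure a b)) atTop (𝓝 0)

/-- `∫_E u · n q ds = 0` for all `q ∈ P_m(E)` on the edge `E = [a, b]` of `D`, with the trace of
`u` taken from `D`. -/
def NormalMomentsVanish (m : ℕ) (D : Set Plane) (a b : Plane) (u : Plane → Plane) : Prop :=
  ∃ g, HasTrace D a b u g ∧ ∀ n : Plane, ‖n‖ = 1 → inner ℝ n (b - a) = 0 →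
    ∀ q ∈ polyDeg m, ∫ x, inner ℝ (g x) n * evalPoly q x ∂(segMeasure a b) = 0

/-! ### Polygons and subtriangulations -/

/-- The boundary curve of `P` is simple: consecutive edges meet in their common vertex only, and
other edges are disjoint. Straight angles are allowed. -/
def IsSimplePolygon {n : ℕ} (P : Polygon Plane n) : Prop :=
  3 ≤ n ∧ P.HasNondegenerateEdges ∧
  (∀ i, P.edgeSet ℝ i ∩ P.edgeSet ℝ (finRotate n i) = {P (finRotate n i)}) ∧
  ∀ i j, i ≠ j → j ≠ finRotate n i → i ≠ finRotate n j →
    Disjoint (P.edgeSet ℝ i) (P.edgeSet ℝ j)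

/-- `K` is the closed region enclosed by the simple polygon `P`, and it is star-shaped with respect
to a ball. -/
structure IsPolygonalCell {n : ℕ} (P : Polygon Plane n) (K : Set Plane) : Prop where
  simple : IsSimplePolygon P
  compact : IsCompact K
  regular : closure (interior K) = K
  frontier_eq : frontier K = P.boundary ℝ
  star : ∃ c : Plane, ∃ r > 0, ∀ y ∈ Metric.ball c r, StarConvex ℝ y K

/-- The triangles of a simplicial complex, each given by its set of vertices. -/
def triangles (S : Geometry.SimplicialComplex ℝ Plane) : Set (Finset Plane) :=
  {T | T ∈ S.faces ∧ T.card = 3}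

/-- `S` is a finite conforming triangulation of the polygon `K` without additional nodes on the
boundary, that is, the edges of the polygon are edges of the triangulation. Additional nodes in the
interior are allowed. -/
structure IsSubtriangulation {n : ℕ} (P : Polygon Plane n) (K : Set Plane)
    (S : Geometry.SimplicialComplex ℝ Plane) : Prop where
  finite : S.faces.Finite
  space_eq : S.space = K
  pure : ∀ s ∈ S.faces, ∃ T ∈ triangles S, s ⊆ T
  edges : ∀ i, ∃ e ∈ S.faces, (e : Set Plane) = {P i, P (finRotate n i)}

/-- `q ∈ P_m(𝒯(K))`: on each triangle `q` is a polynomial of degree at most `m`. -/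
def IsPiecewisePoly (S : Geometry.SimplicialComplex ℝ Plane) (m : ℕ) (q : Plane → ℝ) : Prop :=
  ∀ T ∈ triangles S, ∃ p ∈ polyDeg m,
    ∀ᵐ x ∂(volume.restrict (convexHull ℝ (T : Set Plane))), q x = evalPoly p x

/-! ### The virtual element space and the energy projection -/

/-- The Frobenius inner product of two Jacobians. -/
def frob (A B : Plane →L[ℝ] Plane) : ℝ :=
  ∑ i : Fin 2, inner ℝ (A (EuclideanSpace.single i 1)) (B (EuclideanSpace.single i 1))

/-- The classical divergence. -/
def divergence (ψ : Plane → Plane) (x : Plane) : ℝ :=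
  ∑ i : Fin 2, (fderiv ℝ ψ x (EuclideanSpace.single i 1)) i

/-- The local virtual element space of order `k`: all `v ∈ H¹(K; ℝ²)` with continuous trace on the
boundary that is a polynomial of degree at most `k` on each edge, with
`-ν Δv + ∇s ∈ 𝒢_{k-2}(K)^⊥` (in the sense of distributions) for some `s ∈ L²(K)`, and with
`div v ∈ P_{k-1}(K)`. -/
def virtualSpace {n : ℕ} (P : Polygon Plane n) (K : Set Plane) (ν : ℝ) (k : ℕ) : Set (L2 K) :=
  {v | ∃ G, MemH1With K v G ∧
    (∃ g : Plane → Plane, ContinuousOn g (frontier K) ∧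
      ∀ i, HasTrace K (P i) (P (finRotate n i)) v g ∧
        ∃ p ∈ vecPolyDeg k, ∀ x ∈ P.edgeSet ℝ i, g x = evalVec p x) ∧
    (∃ s : Plane → ℝ, MemLp s 2 (volume.restrict K) ∧ ∃ f ∈ gradOrtho K ((k : ℤ) - 2),
      ∀ ψ : Plane → Plane, IsTestFunction K ψ →
        ν * (∫ x in K, frob (G x) (fderiv ℝ ψ x)) - ∫ x in K, s x * divergence ψ x
          = ∫ x in K, inner ℝ (evalVec f x) (ψ x)) ∧
    ∃ p ∈ polyDeg ((k : ℤ) - 1), HasWeakDiv K v (evalPoly p)}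

/-- `z = Π^{∇,K}_k v`: `z` is a vector polynomial of degree at most `k` with
`ν ∫_K ∇q : ∇(v - z) dx = 0` for all vector polynomials `q` of degree at most `k`, and `v - z` has
zero mean. -/
def IsEnergyProjection (K : Set Plane) (ν : ℝ) (k : ℕ) (v z : L2 K) : Prop :=
  (∃ p ∈ vecPolyDeg k, ∀ᵐ x ∂(volume.restrict K), z x = evalVec p x) ∧
  (∃ G, MemH1With K (fun x => v x - z x) G ∧ ∀ q ∈ vecPolyDeg k,
    ν * ∫ x in K, frob (fderiv ℝ (evalVec q) x) (G x) = 0) ∧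
  ∫ x in K, (v x - z x) = 0

/-! ### Raviart–Thomas functions -/

/-- The Raviart–Thomas space `RT_m(𝒯(K))`: fields in `H(div, K)` which on each triangle are of the
form `x ↦ a(x) + b(x) x` with polynomials `a`, `b` of degree at most `m`. -/
def raviartThomas (K : Set Plane) (S : Geometry.SimplicialComplex ℝ Plane) (m : ℕ) :
    Set (L2 K) :=
  {w | (∃ d, MemHDivWith K w d) ∧ ∀ T ∈ triangles S, ∃ a ∈ vecPolyDeg m, ∃ b ∈ polyDeg m,
    ∀ᵐ x ∂(volume.restrict (convexHull ℝ (T : Set Plane))),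
      w x = evalVec a x + evalPoly b x • x}

/-- `w` is the standard Raviart–Thomas interpolation of `v` on the subtriangulation: `w - v` has
vanishing moments against `P_{m-1}` on every triangle, and vanishing normal moments against
`P_m` on every edge of every triangle. -/
def IsStandardInterpolation (K : Set Plane) (S : Geometry.SimplicialComplex ℝ Plane) (m : ℕ)
    (v w : L2 K) : Prop :=
  w ∈ raviartThomas K S m ∧ ∀ T ∈ triangles S,
    (∀ p ∈ vecPolyDeg ((m : ℤ) - 1),
      ∫ x in convexHull ℝ (T : Set Plane), inner ℝ (w x - v x) (evalVec p x) = 0) ∧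
    ∀ a ∈ T, ∀ b ∈ T, a ≠ b →
      NormalMomentsVanish m (convexHull ℝ (T : Set Plane)) a b (fun x => w x - v x)

/-- The constraint set `W_h(K, v, m)`. On an edge of the polygon, the trace of the piecewise `H¹`
field `v - w` is taken from the triangle that contains the edge. -/
def constraintSet {n : ℕ} (P : Polygon Plane n) (K : Set Plane)
    (S : Geometry.SimplicialComplex ℝ Plane) (v : L2 K) (m : ℕ) : Set (L2 K) :=
  {w | w ∈ raviartThomas K S m ∧
    (∃ d, MemHDivWith K (fun x => v x - w x) d ∧
      ∀ q, IsPiecewisePoly S m q → ∫ x in K, d x * q x = 0) ∧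
    (∀ p ∈ gradOrtho K ((m : ℤ) - 1), ∫ x in K, inner ℝ (v x - w x) (evalVec p x) = 0) ∧
    ∀ i, ∀ T ∈ triangles S, P i ∈ T → P (finRotate n i) ∈ T →
      NormalMomentsVanish m (convexHull ℝ (T : Set Plane)) (P i) (P (finRotate n i))
        (fun x => v x - w x)}

end PolyRT

end

noncomputable section

namespace PolyRT

/-! ### Polynomials of bounded degree -/

/-! The heart of the matter is unisolvence of the Raviart–Thomas element on one triangle
(`rtPoly_eq_zero`). Suppose that all interior moments against `P_{m-1}` and all normal moments on
the edges of `p` vanish. Green's formula tested with `div p` gives `div p = 0`. By Euler's identity,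
`div (h x) = (m + 2) h` for a homogeneous `h` of degree `m`, so the top-order part of `p` disappears
and `p` has degree at most `m`. The normal component then vanishes on each edge, hence is divisible
by the equation of the line; testing with the quotient times the normal kills this component on the
whole plane, and two edges suffice. A dimension count turns injectivity into surjectivity
(`rtDof_surjective`), so arbitrary moments can be prescribed.

To prescribe the moments of an `H¹` field its traces are needed. Because `K` is star-shaped with
respect to a ball, averaging a function over contractions towards the points of a smaller ball gives
smooth approximations up to the boundary (`exists_smooth_approx`). The trace inequality on triangles
(`eLpNorm_trace_le`) makes one such sequence converge on all edges of the triangulation at once, to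
one common function `g` (`exists_trace`, `exists_traceData`). Two neighbouring triangles therefore
interpolate the same edge data. Their local interpolants have equal normal components on the common
edge and glue to a field in `H(div, K)` (`hasWeakDiv_of_matching`); the edge terms of Green's
formula cancel since the orientations of the triangles at an interior edge add up to zero
(`sum_edgeSign_eq_zero`).

The glued interpolant satisfies the constraints (`TraceData.mem_constraintSet`). For the divergence,
Green's formula in `H¹` reduces the claim to the prescribed moments, because the gradient of a
polynomial of degree `m` has degree `m - 1`. The moments against `𝒢_{m-1}^⊥` are combinations of
interior moments, and the edges of the polygon are edges of triangles.

The constraint set is a translate of a linear space of piecewise polynomials, which is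
finite-dimensional. Orthogonal projection in `L²` then gives the minimiser, and Pythagoras its
uniqueness (`TraceData.existsUnique_minimizer`). The energy projection is a linear system with a
positive definite form, obtained by adding the product of the means to the Dirichlet form
(`energyForm_bijective`).

On a single triangle, a difference of two admissible fields has zero divergence and zero normal
moments. Green's formula shows that it is orthogonal to the gradients of `P_m`, and it is orthogonal
to `𝒢_{m-1}^⊥` by assumption; together these span all vector polynomials of degree `m - 1`, so
unisolvence makes the difference zero (`isHomogeneous_eq_zero`). -/

lemma polyDeg_mono {s t : ℤ} (h : s ≤ t) : polyDeg s ≤ polyDeg t :=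
  fun _ hp d hd => (hp d hd).trans h

lemma mul_mem_polyDeg {s t : ℤ} {p q : Poly2} (hp : p ∈ polyDeg s) (hq : q ∈ polyDeg t) :
    p * q ∈ polyDeg (s + t) := by
  classical
  intro d hd
  obtain ⟨a, ha, b, hb, rfl⟩ := Finset.mem_add.1 (MvPolynomial.support_mul p q hd)
  have h₁ := hp a ha
  have h₂ := hq b hb
  rw [map_add]
  push_cast
  omega

lemma monomial_mem_polyDeg {s : ℤ} {d : Fin 2 →₀ ℕ} (h : (d.degree : ℤ) ≤ s) (c : ℝ) :
    MvPolynomial.monomial d c ∈ polyDeg s := by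
  intro e he
  rw [Finset.mem_singleton.1 (MvPolynomial.support_monomial_subset he)]
  exact h

lemma C_mem_polyDeg {s : ℤ} (hs : 0 ≤ s) (c : ℝ) : (MvPolynomial.C c : Poly2) ∈ polyDeg s :=
  monomial_mem_polyDeg (by simpa using hs) c

lemma X_mem_polyDeg (i : Fin 2) : (MvPolynomial.X i : Poly2) ∈ polyDeg 1 :=
  monomial_mem_polyDeg (by simp) 1

/-- Monomials span. Degree bounds and divisibility statements below are phrased as inclusions of
`polyDeg s` in a submodule, so that only monic monomials have to be checked. -/
lemma polyDeg_induction {s : ℤ} {M : Submodule ℝ Poly2}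
    (h : ∀ d : Fin 2 →₀ ℕ, (d.degree : ℤ) ≤ s → MvPolynomial.monomial d 1 ∈ M) :
    polyDeg s ≤ M := by
  intro p hp
  rw [p.as_sum]
  refine Submodule.sum_mem _ fun d hd => ?_
  have : MvPolynomial.monomial d (p.coeff d) = p.coeff d • MvPolynomial.monomial d (1 : ℝ) := by
    rw [MvPolynomial.smul_monomial, smul_eq_mul, mul_one]
  rw [this]
  exact M.smul_mem _ (h d (hp d hd))

lemma pderiv_mem_polyDeg {s : ℤ} {p : Poly2} (hp : p ∈ polyDeg s) (i : Fin 2) :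
    MvPolynomial.pderiv i p ∈ polyDeg (s - 1) := by
  suffices h : polyDeg s ≤ (polyDeg (s - 1)).comap
      (MvPolynomial.pderiv (R := ℝ) i).toLinearMap from h hp
  refine polyDeg_induction fun d hd => ?_
  rw [Submodule.mem_comap, Derivation.coeFn_coe, MvPolynomial.pderiv_monomial]
  by_cases h : d i = 0
  · simp [h]
  · refine monomial_mem_polyDeg ?_ _
    have h1 : d = (d - Finsupp.single i 1) + Finsupp.single i 1 := by
      ext j
      by_cases hj : j = i
      · subst hj; simp; omega
      · simp [hj]
    have h2 := congrArg Finsupp.degree h1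
    rw [map_add, Finsupp.degree_single] at h2
    omega

lemma gradPoly_mem {s : ℤ} {p : Poly2} (hp : p ∈ polyDeg s) : gradPoly p ∈ vecPolyDeg (s - 1) :=
  fun i => pderiv_mem_polyDeg hp i

instance finiteDimensional_polyDeg (s : ℤ) : FiniteDimensional ℝ (polyDeg s) := by
  have hfin : {d : Fin 2 →₀ ℕ | (d.degree : ℤ) ≤ s}.Finite := by
    refine (Finsupp.finite_of_degree_le (σ := Fin 2) s.toNat).subset fun d hd => ?_
    simp only [mem_ofPred_eq] at hd ⊢
    omega
  have : polyDeg s ≤ Submodule.span ℝ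
      ((fun d => MvPolynomial.monomial d (1 : ℝ)) '' {d : Fin 2 →₀ ℕ | (d.degree : ℤ) ≤ s}) :=
    polyDeg_induction fun d hd => Submodule.subset_span ⟨d, hd, rfl⟩
  have := FiniteDimensional.span_of_finite ℝ
    (hfin.image (fun d => MvPolynomial.monomial d (1 : ℝ)))
  exact Submodule.finiteDimensional_of_le ‹polyDeg s ≤ _›

/-- Vector polynomials of bounded degree as a submodule. -/
def vecPolySub (s : ℤ) : Submodule ℝ (Fin 2 → Poly2) := Submodule.pi univ fun _ => polyDeg s

lemma mem_vecPolySub {s : ℤ} {p : Fin 2 → Poly2} : p ∈ vecPolySub s ↔ p ∈ vecPolyDeg s := by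
  simp [vecPolySub, vecPolyDeg, Submodule.mem_pi]

instance finiteDimensional_vecPolySub (s : ℤ) : FiniteDimensional ℝ (vecPolySub s) := by
  let f : (Fin 2 → polyDeg s) →ₗ[ℝ] (Fin 2 → Poly2) :=
    LinearMap.pi fun i => (polyDeg s).subtype.comp (LinearMap.proj i)
  have : vecPolySub s ≤ LinearMap.range f := by
    intro p hp
    rw [mem_vecPolySub] at hp
    exact ⟨fun i => ⟨p i, hp i⟩, rfl⟩
  exact Submodule.finiteDimensional_of_le this

/-! ### Polynomial functions -/

@[simp] lemma evalPoly_add (p q : Poly2) (x : Plane) :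
    evalPoly (p + q) x = evalPoly p x + evalPoly q x := map_add _ _ _

@[simp] lemma evalPoly_sub (p q : Poly2) (x : Plane) :
    evalPoly (p - q) x = evalPoly p x - evalPoly q x := map_sub _ _ _

@[simp] lemma evalPoly_mul (p q : Poly2) (x : Plane) :
    evalPoly (p * q) x = evalPoly p x * evalPoly q x := map_mul _ _ _

@[simp] lemma evalPoly_pow (p : Poly2) (n : ℕ) (x : Plane) :
    evalPoly (p ^ n) x = evalPoly p x ^ n := map_pow _ _ _

@[simp] lemma evalPoly_smul (c : ℝ) (p : Poly2) (x : Plane) :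
    evalPoly (c • p) x = c * evalPoly p x := MvPolynomial.smul_eval _ _ _

@[simp] lemma evalPoly_C (c : ℝ) (x : Plane) : evalPoly (MvPolynomial.C c) x = c :=
  MvPolynomial.eval_C _

@[simp] lemma evalPoly_X (i : Fin 2) (x : Plane) : evalPoly (MvPolynomial.X i) x = x i :=
  MvPolynomial.eval_X _

@[simp] lemma evalPoly_zero (x : Plane) : evalPoly 0 x = 0 := map_zero _

@[simp] lemma evalPoly_one (x : Plane) : evalPoly 1 x = 1 := map_one _

@[simp] lemma evalVec_apply (p : Fin 2 → Poly2) (x : Plane) (i : Fin 2) :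
    evalVec p x i = evalPoly (p i) x := rfl

lemma evalVec_add (p q : Fin 2 → Poly2) (x : Plane) :
    evalVec (p + q) x = evalVec p x + evalVec q x := by ext i; simp

lemma evalVec_sub (p q : Fin 2 → Poly2) (x : Plane) :
    evalVec (p - q) x = evalVec p x - evalVec q x := by ext i; simp

lemma evalVec_smul (c : ℝ) (p : Fin 2 → Poly2) (x : Plane) :
    evalVec (c • p) x = c • evalVec p x := by ext i; simp

lemma evalVec_zero (x : Plane) : evalVec 0 x = 0 := by ext i; simp

lemma hasFDerivAt_evalPoly (p : Poly2) (x : Plane) :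
    HasFDerivAt (evalPoly p) (innerSL ℝ (evalVec (gradPoly p) x)) x := by
  induction p using MvPolynomial.induction_on with
  | C a =>
    have h1 : evalPoly (MvPolynomial.C a) = fun _ => a := by ext y; simp
    have h2 : evalVec (gradPoly (MvPolynomial.C a)) x = 0 := by ext i; simp [gradPoly]
    rw [h1, h2, map_zero]
    exact hasFDerivAt_const a x
  | add p q hp hq =>
    have h1 : evalPoly (p + q) = fun y => evalPoly p y + evalPoly q y := by ext y; simp
    have h2 : evalVec (gradPoly (p + q)) x = evalVec (gradPoly p) x + evalVec (gradPoly q) x := by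
      ext i; simp [gradPoly]
    rw [h1, h2, map_add]
    exact hp.add hq
  | mul_X p i hp =>
    have h1 : evalPoly (p * MvPolynomial.X i) = fun y => evalPoly p y * y i := by ext y; simp
    have hX : HasFDerivAt (fun y : Plane => y i) (EuclideanSpace.proj i : Plane →L[ℝ] ℝ) x :=
      (EuclideanSpace.proj i : Plane →L[ℝ] ℝ).hasFDerivAt
    rw [h1]
    refine (hp.mul hX).congr_fderiv ?_
    ext y
    simp only [_root_.add_apply, _root_.smul_apply, innerSL_apply_apply,
      PiLp.inner_apply, Fin.sum_univ_two, evalVec_apply, gradPoly, smul_eq_mul,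
      PiLp.proj_apply, Derivation.leibniz, MvPolynomial.pderiv_X, evalPoly_add,
      evalPoly_mul, evalPoly_X, RCLike.inner_apply, conj_trivial]
    fin_cases i <;> simp <;> ring

lemma fderiv_evalPoly (p : Poly2) (x : Plane) :
    fderiv ℝ (evalPoly p) x = innerSL ℝ (evalVec (gradPoly p) x) :=
  (hasFDerivAt_evalPoly p x).fderiv

lemma contDiff_evalPoly (p : Poly2) {n : WithTop ℕ∞} : ContDiff ℝ n (evalPoly p) := by
  induction p using MvPolynomial.induction_on with
  | C a =>
    have h1 : evalPoly (MvPolynomial.C a) = fun _ => a := by ext y; simp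
    rw [h1]; exact contDiff_const
  | add p q hp hq =>
    have h1 : evalPoly (p + q) = fun y => evalPoly p y + evalPoly q y := by ext y; simp
    rw [h1]; exact hp.add hq
  | mul_X p i hp =>
    have h1 : evalPoly (p * MvPolynomial.X i) = fun y => evalPoly p y * y i := by ext y; simp
    rw [h1]
    exact hp.mul (EuclideanSpace.proj i : Plane →L[ℝ] ℝ).contDiff

lemma contDiff_evalVec (p : Fin 2 → Poly2) {n : WithTop ℕ∞} : ContDiff ℝ n (evalVec p) :=
  contDiff_euclidean.2 fun i => contDiff_evalPoly (p i)

lemma continuous_evalPoly (p : Poly2) : Continuous (evalPoly p) :=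
  (contDiff_evalPoly p (n := 0)).continuous

lemma continuous_evalVec (p : Fin 2 → Poly2) : Continuous (evalVec p) :=
  (contDiff_evalVec p (n := 0)).continuous

lemma fderiv_evalVec_apply (p : Fin 2 → Poly2) (x y : Plane) (i : Fin 2) :
    (fderiv ℝ (evalVec p) x y) i = inner ℝ (evalVec (gradPoly (p i)) x) y := by
  have h : HasFDerivAt (evalVec p) (fderiv ℝ (evalVec p) x) x :=
    ((contDiff_evalVec p (n := 1)).differentiable one_ne_zero x).hasFDerivAt
  have h' := (EuclideanSpace.proj i : Plane →L[ℝ] ℝ).hasFDerivAt.comp x h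
  exact DFunLike.congr_fun (h'.unique (hasFDerivAt_evalPoly (p i) x)) y

/-- The divergence of a vector polynomial. -/
def divPoly (p : Fin 2 → Poly2) : Poly2 := ∑ i, MvPolynomial.pderiv i (p i)

lemma divergence_evalVec (p : Fin 2 → Poly2) (x : Plane) :
    divergence (evalVec p) x = evalPoly (divPoly p) x := by
  simp [divergence, divPoly, Fin.sum_univ_two, fderiv_evalVec_apply, gradPoly,
    EuclideanSpace.inner_single_right]

/-- In the sup norm a ball is a product of intervals, and a polynomial that vanishes on a product of
infinite sets is zero. -/
lemma poly_eq_zero_of_eqOn {U : Set Plane} (hU : IsOpen U) (hne : U.Nonempty) {p : Poly2}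
    (h : ∀ x ∈ U, evalPoly p x = 0) : p = 0 := by
  obtain ⟨x, hx⟩ := hne
  have hU' : IsOpen ((WithLp.toLp 2 : (Fin 2 → ℝ) → Plane) ⁻¹' U) :=
    hU.preimage (PiLp.continuous_toLp 2 _)
  obtain ⟨ε, hε, hb⟩ := Metric.isOpen_iff.1 hU' (WithLp.ofLp x) hx
  refine MvPolynomial.funext_set (fun i => Metric.ball (x i) ε) (fun i => ?_) fun y hy => ?_
  · rw [Real.ball_eq_Ioo]
    exact Set.Ioo_infinite (by linarith)
  · rw [map_zero]
    refine h (WithLp.toLp 2 y) (hb ?_)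
    rw [ball_pi _ hε]
    exact hy

lemma poly_eq_zero_of_ae {D : Set Plane} (hne : (interior D).Nonempty) {p : Poly2}
    (h : ∀ᵐ x ∂(volume.restrict D), evalPoly p x = 0) : p = 0 := by
  refine poly_eq_zero_of_eqOn isOpen_interior hne fun x hx => ?_
  have h1 : ∀ᵐ x ∂(volume.restrict (interior D)), evalPoly p x = (fun _ => (0 : ℝ)) x :=
    ae_restrict_of_ae_restrict_of_subset interior_subset h
  exact Measure.eqOn_open_of_ae_eq h1 isOpen_interior (continuous_evalPoly p).continuousOn
    continuousOn_const hx

/-! ### Restriction to a line -/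

/-- The restriction of a polynomial to the line through `a` and `b`, as a univariate polynomial. -/
def linePoly (a b : Plane) : Poly2 →ₐ[ℝ] Polynomial ℝ :=
  MvPolynomial.aeval fun i => Polynomial.C (a i) + Polynomial.C (b i - a i) * Polynomial.X

lemma eval_linePoly (a b : Plane) (p : Poly2) (t : ℝ) :
    (linePoly a b p).eval t = evalPoly p (AffineMap.lineMap a b t) := by
  induction p using MvPolynomial.induction_on with
  | C r =>
    rw [evalPoly_C, linePoly, ← MvPolynomial.algebraMap_eq, AlgHom.commutes]
    simp
  | add p q hp hq => simp [hp, hq]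
  | mul_X p i hp =>
    rw [map_mul, Polynomial.eval_mul, hp, evalPoly_mul, evalPoly_X]
    simp [linePoly, AffineMap.lineMap_apply]
    left; ring

/-- Each coordinate becomes affine in the parameter. This is what leaves only `m + 1` independent
normal moments on an edge. -/
lemma natDegree_linePoly_le (a b : Plane) {m : ℕ} {p : Poly2} (hp : p ∈ polyDeg m) :
    (linePoly a b p).natDegree ≤ m := by
  have h : polyDeg (m : ℤ) ≤
      (Polynomial.degreeLE ℝ m).comap (linePoly a b).toLinearMap := by
    refine polyDeg_induction fun d hd => ?_
    rw [Submodule.mem_comap, Polynomial.mem_degreeLE, ← Polynomial.natDegree_le_iff_degree_le,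
      AlgHom.toLinearMap_apply, linePoly, MvPolynomial.aeval_monomial, map_one, one_mul,
      Finsupp.prod_fintype _ _ (by simp), Fin.prod_univ_two]
    have h1 : ∀ i, (Polynomial.C (a i) + Polynomial.C (b i - a i) * Polynomial.X
        : Polynomial ℝ).natDegree ≤ 1 := fun i => by
      rw [add_comm]; exact Polynomial.natDegree_linear_le
    have h2 : d.degree = d 0 + d 1 := by
      rw [Finsupp.degree_eq_sum, Fin.sum_univ_two]
    refine Polynomial.natDegree_mul_le.trans ?_
    have h3 := Polynomial.natDegree_pow_le_of_le (d 0) (h1 0)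
    have h4 := Polynomial.natDegree_pow_le_of_le (d 1) (h1 1)
    have h5 : d.degree ≤ m := by exact_mod_cast hd
    omega
  have := h hp
  rwa [Submodule.mem_comap, Polynomial.mem_degreeLE, ← Polynomial.natDegree_le_iff_degree_le] at this

/-! ### The divergence theorem on a triangle -/

/-- The two-dimensional cross product. -/
def cross (u w : Plane) : ℝ := u 0 * w 1 - u 1 * w 0

lemma cross_add_left (u u' w : Plane) : cross (u + u') w = cross u w + cross u' w := by
  simp [cross]; ring

lemma cross_sub_left (u u' w : Plane) : cross (u - u') w = cross u w - cross u' w := by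
  simp [cross]; ring

lemma cross_neg_left (u w : Plane) : cross (-u) w = -cross u w := by
  simp [cross]; ring

lemma cross_neg_right (u w : Plane) : cross u (-w) = -cross u w := by
  simp [cross]; ring

lemma cross_smul_left (r : ℝ) (u w : Plane) : cross (r • u) w = r * cross u w := by
  simp [cross]; ring

lemma cross_self (u : Plane) : cross u u = 0 := by
  simp [cross]; ring

/-- The cross product with a fixed vector as a continuous linear functional. -/
def crossL (w : Plane) : Plane →L[ℝ] ℝ :=
  w 1 • (EuclideanSpace.proj 0 : Plane →L[ℝ] ℝ) - w 0 • (EuclideanSpace.proj 1 : Plane →L[ℝ] ℝ)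

lemma crossL_apply (w u : Plane) : crossL w u = cross u w := by
  simp [crossL, cross]; ring

lemma eq_smul_add_smul {e f : Plane} (h : cross e f ≠ 0) (u : Plane) :
    u = (cross u f / cross e f) • e + (cross e u / cross e f) • f := by
  ext i
  simp only [PiLp.add_apply, PiLp.smul_apply, smul_eq_mul]
  field_simp
  unfold cross
  fin_cases i <;> simp <;> ring

/-- The flux of `F` through the segment from `a` to `b`. -/
def edgeFlux (a b : Plane) (F : Plane → Plane) : ℝ :=
  ∫ t in (0 : ℝ)..1, cross (F (AffineMap.lineMap a b t)) (b - a)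

/-- The factor `b - a` in the cross product encodes both the length of the edge and the normal on
its right-hand side. Reversing the edge leaves the parameter integral unchanged and flips that
normal. -/
lemma edgeFlux_swap (a b : Plane) (F : Plane → Plane) : edgeFlux b a F = -edgeFlux a b F := by
  unfold edgeFlux
  have h := intervalIntegral.integral_comp_sub_left
    (a := (0 : ℝ)) (b := 1) (fun t => cross (F (AffineMap.lineMap b a t)) (a - b)) 1
  simp only [sub_self, sub_zero] at h
  rw [← h, ← intervalIntegral.integral_neg]
  congr 1
  ext t
  rw [AffineMap.lineMap_apply_one_sub, ← cross_neg_right, neg_sub]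

/-- The reference triangle. -/
def refTri : Set (ℝ × ℝ) := {p | 0 ≤ p.1 ∧ 0 ≤ p.2 ∧ p.1 + p.2 ≤ 1}

/-- The affine map from the reference triangle to the triangle with vertices `a`, `b`, `c`. -/
def triMap (a b c : Plane) (p : ℝ × ℝ) : Plane := a + (p.1 • (b - a) + p.2 • (c - a))

lemma convexHull_triple (a b c : Plane) :
    convexHull ℝ {a, b, c} = triMap a b c '' refTri := by
  apply Subset.antisymm
  · refine convexHull_min ?_ ?_
    · rintro x (rfl | rfl | rfl)
      · exact ⟨(0, 0), by simp [refTri], by simp [triMap]⟩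
      · exact ⟨(1, 0), by simp [refTri], by simp [triMap]⟩
      · exact ⟨(0, 1), by simp [refTri], by simp [triMap]⟩
    · rintro _ ⟨p, ⟨hp1, hp2, hp3⟩, rfl⟩ _ ⟨q, ⟨hq1, hq2, hq3⟩, rfl⟩ u v hu hv huv
      refine ⟨(u * p.1 + v * q.1, u * p.2 + v * q.2), ⟨by positivity, by positivity, ?_⟩, ?_⟩
      · nlinarith [mul_le_mul_of_nonneg_left hp3 hu, mul_le_mul_of_nonneg_left hq3 hv]
      · obtain rfl : v = 1 - u := by linarith
        simp only [triMap]
        module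
  · rintro _ ⟨⟨s, t⟩, ⟨hs, ht, hst⟩, rfl⟩
    simp only at hs ht hst
    have hconv := convex_convexHull ℝ ({a, b, c} : Set Plane)
    have hsub := subset_convexHull ℝ ({a, b, c} : Set Plane)
    have h := hconv.sum_mem (t := Finset.univ) (w := ![1 - s - t, s, t]) (z := ![a, b, c])
      (by intro i _; fin_cases i <;> simp <;> linarith)
      (by simp [Fin.sum_univ_three]; ring)
      (by intro i _; apply hsub; fin_cases i <;> simp)
    convert! h using 1
    simp only [triMap, Fin.sum_univ_three, Matrix.cons_val_zero, Matrix.cons_val_one,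
      Matrix.cons_val]
    module

/-- Change of variables along the affine map from the reference triangle, whose linear part has
determinant `cross (b - a) (c - a)`. -/
lemma integral_convexHull_triple {a b c : Plane} (h : cross (b - a) (c - a) ≠ 0)
    (f : Plane → ℝ) :
    ∫ x in convexHull ℝ {a, b, c}, f x =
      |cross (b - a) (c - a)| * ∫ p in refTri, f (triMap a b c p) := by
  let L : Plane →L[ℝ] Plane :=
    (EuclideanSpace.proj 0 : Plane →L[ℝ] ℝ).smulRight (b - a) +
      (EuclideanSpace.proj 1 : Plane →L[ℝ] ℝ).smulRight (c - a)
  have hL : ∀ x, L x = x 0 • (b - a) + x 1 • (c - a) := fun x => by simp [L]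
  have hdet : L.det = cross (b - a) (c - a) := by
    rw [ContinuousLinearMap.det,
      ← LinearMap.det_toMatrix (EuclideanSpace.basisFun (Fin 2) ℝ).toBasis, Matrix.det_fin_two]
    simp [LinearMap.toMatrix_apply, hL, cross]
    ring
  -- The change of variables is carried out inside `Plane`; the measure-preserving `e` then moves
  -- the reference triangle to `ℝ × ℝ`, where Fubini is available.
  let e : Plane ≃ᵐ ℝ × ℝ :=
    (MeasurableEquiv.toLp 2 (Fin 2 → ℝ)).symm.trans MeasurableEquiv.finTwoArrow
  have he : MeasurePreserving e volume volume :=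
    (volume_preserving_finTwoArrow ℝ).comp (EuclideanSpace.volume_preserving_symm_measurableEquiv_toLp (Fin 2))
  have he' : ∀ x : Plane, e x = (x 0, x 1) := fun x => rfl
  have hmeas : MeasurableSet refTri := by
    refine IsClosed.measurableSet ?_
    exact (isClosed_le continuous_const continuous_fst).inter
      ((isClosed_le continuous_const continuous_snd).inter
        (isClosed_le (continuous_fst.add continuous_snd) continuous_const))
  have himg : convexHull ℝ {a, b, c} = (fun x => a + L x) '' (e ⁻¹' refTri) := by
    rw [convexHull_triple]
    ext y
    constructor
    · rintro ⟨p, hp, rfl⟩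
      refine ⟨e.symm p, by simpa using hp, ?_⟩
      have h1 : e (e.symm p) = p := e.apply_symm_apply p
      rw [he'] at h1
      simp only [hL, triMap]
      rw [show p.1 = (e.symm p) 0 from congrArg Prod.fst h1.symm,
        show p.2 = (e.symm p) 1 from congrArg Prod.snd h1.symm]
    · rintro ⟨x, hx, rfl⟩
      exact ⟨e x, hx, by simp [triMap, he', hL]⟩
  have hinj : Function.Injective (fun x => a + L x) := by
    have hL' : IsUnit L.det := by rw [hdet]; exact isUnit_iff_ne_zero.2 h
    have := (LinearMap.equivOfDetNeZero (L : Plane →ₗ[ℝ] Plane) hL'.ne_zero).injective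
    intro x y hxy
    exact this (add_left_cancel hxy)
  rw [himg, integral_image_eq_integral_abs_det_fderiv_smul volume (e.measurable hmeas)
    (fun x _ => (L.hasFDerivAt.const_add a).hasFDerivWithinAt) hinj.injOn]
  simp only [hdet, smul_eq_mul]
  rw [integral_const_mul, ← he.setIntegral_preimage_emb e.measurableEmbedding]
  congr 1

lemma isCompact_refTri : IsCompact refTri := by
  refine IsCompact.of_isClosed_subset
    ((isCompact_Icc (a := (0 : ℝ)) (b := 1)).prod (isCompact_Icc (a := (0 : ℝ)) (b := 1))) ?_ ?_
  · exact (isClosed_le continuous_const continuous_fst).inter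
      ((isClosed_le continuous_const continuous_snd).inter
        (isClosed_le (continuous_fst.add continuous_snd) continuous_const))
  · rintro ⟨s, t⟩ ⟨h1, h2, h3⟩
    simp only [mem_prod, mem_Icc] at *
    exact ⟨⟨h1, by linarith⟩, h2, by linarith⟩

lemma integral_refTri {f : ℝ × ℝ → ℝ} (hf : Continuous f) :
    ∫ p in refTri, f p = ∫ t in (0 : ℝ)..1, ∫ s in (0 : ℝ)..(1 - t), f (s, t) := by
  have hmeas : MeasurableSet refTri := isCompact_refTri.isClosed.measurableSet
  rw [← integral_indicator hmeas, Measure.volume_eq_prod, integral_prod_symm,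
    intervalIntegral.integral_of_le zero_le_one, ← integral_Icc_eq_integral_Ioc,
    ← integral_indicator measurableSet_Icc]
  · congr 1
    ext t
    by_cases ht : t ∈ Icc (0 : ℝ) 1
    · rw [indicator_of_mem ht, intervalIntegral.integral_of_le (by linarith [ht.2]),
        ← integral_Icc_eq_integral_Ioc, ← integral_indicator measurableSet_Icc]
      congr 1
      ext s
      exact indicator_eq_indicator (f := f) (g := fun s => f (s, t)) (a := (s, t)) (b := s)
        (s := refTri) (t := Icc 0 (1 - t)) ⟨fun h => ⟨h.1, by linarith [h.2.2]⟩, fun h => ⟨h.1, ht.1, by linarith [h.2]⟩⟩ rfl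
    · rw [indicator_of_notMem ht]
      refine integral_eq_zero_of_ae (Eventually.of_forall fun s => ?_)
      refine indicator_of_notMem (fun h => ht ?_) _
      exact ⟨h.2.1, by linarith [h.1, h.2.2]⟩
  · rw [← Measure.volume_eq_prod]
    exact (hf.continuousOn.integrableOn_compact isCompact_refTri).integrable_indicator hmeas

lemma integral_refTri_swap (f : ℝ × ℝ → ℝ) :
    ∫ p in refTri, f p.swap = ∫ p in refTri, f p := by
  have h : MeasurePreserving (Prod.swap : ℝ × ℝ → ℝ × ℝ) volume volume :=
    Measure.measurePreserving_swap
  have hpre : Prod.swap ⁻¹' refTri = refTri := by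
    ext ⟨s, t⟩
    simp only [refTri, mem_preimage, Prod.swap_prod_mk, mem_ofPred_eq]
    constructor <;> rintro ⟨h1, h2, h3⟩ <;> exact ⟨h2, h1, by linarith⟩
  have := h.setIntegral_preimage_emb MeasurableEquiv.prodComm.measurableEmbedding f refTri
  rwa [hpre] at this

/-- Fubini and the fundamental theorem of calculus on the slices `0 ≤ s ≤ 1 - t`. -/
lemma integral_refTri_fderiv_fst {h : ℝ × ℝ → ℝ} (hh : ContDiff ℝ 1 h) :
    ∫ p in refTri, fderiv ℝ h p (1, 0) = ∫ t in (0 : ℝ)..1, (h (1 - t, t) - h (0, t)) := by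
  have hc : Continuous fun p => fderiv ℝ h p (1, 0) :=
    (hh.continuous_fderiv one_ne_zero).clm_apply continuous_const
  rw [integral_refTri hc]
  congr 1
  ext t
  refine intervalIntegral.integral_eq_sub_of_hasDerivAt (f := fun s => h (s, t)) (fun s _ => ?_)
    ((hc.comp (continuous_id.prodMk continuous_const)).intervalIntegrable _ _)
  have h1 : HasDerivAt (fun s : ℝ => (s, t)) (1, 0) s := (hasDerivAt_id s).prodMk (hasDerivAt_const s t)
  exact (hh.differentiable one_ne_zero (s, t)).hasFDerivAt.comp_hasDerivAt s h1

lemma integral_refTri_fderiv_snd {h : ℝ × ℝ → ℝ} (hh : ContDiff ℝ 1 h) :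
    ∫ p in refTri, fderiv ℝ h p (0, 1) = ∫ s in (0 : ℝ)..1, (h (s, 1 - s) - h (s, 0)) := by
  have hsw : ContDiff ℝ 1 (fun p : ℝ × ℝ => h p.swap) := hh.comp (contDiff_snd.prodMk contDiff_fst)
  have h1 := integral_refTri_fderiv_fst hsw
  rw [← integral_refTri_swap (fun p => fderiv ℝ h p (0, 1))]
  simp only [Prod.swap_prod_mk] at h1
  rw [← h1]
  congr 1
  ext p
  have h2 : HasFDerivAt (Prod.swap : ℝ × ℝ → ℝ × ℝ)
      ((ContinuousLinearMap.snd ℝ ℝ ℝ).prod (ContinuousLinearMap.fst ℝ ℝ ℝ)) p :=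
    hasFDerivAt_snd.prodMk hasFDerivAt_fst
  have h3 := ((hh.differentiable one_ne_zero p.swap).hasFDerivAt.comp p h2).fderiv
  have h4 : (fun p : ℝ × ℝ => h p.swap) = h ∘ Prod.swap := rfl
  rw [h4, h3]
  simp

/-- The cross product is an area form, and a linear map acts on it infinitesimally by its trace.
Applied to a Jacobian, this expresses the divergence through derivatives along two sides of a
triangle. -/
lemma cross_trace (L : Plane →L[ℝ] Plane) (e f : Plane) :
    cross (L e) f + cross e (L f) =
      (∑ i : Fin 2, (L (EuclideanSpace.single i 1)) i) * cross e f := by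
  have h : ∀ u : Plane,
      L u = u 0 • L (EuclideanSpace.single 0 1) + u 1 • L (EuclideanSpace.single 1 1) := fun u => by
    rw [← map_smul, ← map_smul, ← map_add]
    congr 1
    ext i
    fin_cases i <;> simp
  rw [h e, h f, Fin.sum_univ_two]
  simp only [cross, PiLp.add_apply, PiLp.smul_apply, smul_eq_mul]
  ring

lemma abs_mul_sign' (r : ℝ) : |r| * Real.sign r = r := by
  rcases lt_trichotomy r 0 with h | rfl | h
  · rw [Real.sign_of_neg h, abs_of_neg h]; ring
  · simp
  · rw [Real.sign_of_pos h, abs_of_pos h]; ring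

/-- After pulling back to the reference triangle, `cross_trace` writes the Jacobian determinant
times the divergence as `∂ₛ cross F (c - a) - ∂ₜ cross F (b - a)`. Integration leaves two boundary
terms on the legs and two on the hypotenuse; the latter combine to the flux through `[b, c]` because
`(c - a) - (b - a) = c - b`. The sign accounts for triangles that are listed clockwise. -/
lemma integral_divergence_triangle {a b c : Plane} (h : cross (b - a) (c - a) ≠ 0)
    {F : Plane → Plane} (hF : ContDiff ℝ 1 F) :
    Real.sign (cross (b - a) (c - a)) * ∫ x in convexHull ℝ {a, b, c}, divergence F x =
      edgeFlux a b F + edgeFlux b c F + edgeFlux c a F := by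
  have htri : ContDiff ℝ 1 (triMap a b c) := by unfold triMap; fun_prop
  have hd : ∀ p, HasFDerivAt (triMap a b c)
      ((ContinuousLinearMap.fst ℝ ℝ ℝ).smulRight (b - a) +
        (ContinuousLinearMap.snd ℝ ℝ ℝ).smulRight (c - a)) p := fun p =>
    ((hasFDerivAt_fst.smul_const (b - a)).add (hasFDerivAt_snd.smul_const (c - a))).const_add a
  have hcomp : ContDiff ℝ 1 fun p => F (triMap a b c p) := hF.comp htri
  have h1 : ContDiff ℝ 1 fun p => crossL (c - a) (F (triMap a b c p)) :=
    (crossL (c - a)).contDiff.comp hcomp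
  have h2 : ContDiff ℝ 1 fun p => crossL (b - a) (F (triMap a b c p)) :=
    (crossL (b - a)).contDiff.comp hcomp
  have hdF : ∀ p, HasFDerivAt (fun p => F (triMap a b c p)) _ p := fun p =>
    (hF.differentiable one_ne_zero (triMap a b c p)).hasFDerivAt.comp p (hd p)
  have i1 := integral_refTri_fderiv_fst h1
  have i2 := integral_refTri_fderiv_snd h2
  have hint : ∀ p, cross (b - a) (c - a) * divergence F (triMap a b c p) =
      fderiv ℝ (fun p => crossL (c - a) (F (triMap a b c p))) p (1, 0) -
      fderiv ℝ (fun p => crossL (b - a) (F (triMap a b c p))) p (0, 1) := fun p => by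
    have e1 := ((crossL (c - a)).hasFDerivAt.comp p (hdF p)).fderiv
    have e2 := ((crossL (b - a)).hasFDerivAt.comp p (hdF p)).fderiv
    have e1' : (fun p => crossL (c - a) (F (triMap a b c p))) =
      crossL (c - a) ∘ fun p => F (triMap a b c p) := rfl
    have e2' : (fun p => crossL (b - a) (F (triMap a b c p))) =
      crossL (b - a) ∘ fun p => F (triMap a b c p) := rfl
    rw [e1', e2', e1, e2]
    simp only [ContinuousLinearMap.comp_apply, _root_.add_apply,
      ContinuousLinearMap.smulRight_apply, ContinuousLinearMap.coe_fst', ContinuousLinearMap.coe_snd',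
      one_smul, zero_smul, add_zero, zero_add, crossL_apply]
    rw [divergence, mul_comm, ← cross_trace]
    simp only [cross]; ring
  have hc1 : Continuous fun p => fderiv ℝ (fun p => crossL (c - a) (F (triMap a b c p))) p (1, 0) :=
    (h1.continuous_fderiv one_ne_zero).clm_apply continuous_const
  have hc2 : Continuous fun p => fderiv ℝ (fun p => crossL (b - a) (F (triMap a b c p))) p (0, 1) :=
    (h2.continuous_fderiv one_ne_zero).clm_apply continuous_const
  rw [integral_convexHull_triple h, ← mul_assoc, mul_comm (Real.sign _), abs_mul_sign',
    ← integral_const_mul]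
  simp only [hint]
  rw [integral_sub (hc1.continuousOn.integrableOn_compact isCompact_refTri)
    (hc2.continuousOn.integrableOn_compact isCompact_refTri), i1, i2]
  have hct : Continuous (triMap a b c) := htri.continuous
  have hcF : Continuous F := hF.continuous
  have cc : ∀ (w : Plane) (g : ℝ → ℝ × ℝ), Continuous g →
      IntervalIntegrable (fun t => crossL w (F (triMap a b c (g t)))) volume 0 1 := fun w g hg =>
    ((crossL w).continuous.comp (hcF.comp (hct.comp hg))).intervalIntegrable _ _
  have hbc : edgeFlux b c F = (∫ t in (0 : ℝ)..1, crossL (c - a) (F (triMap a b c (1 - t, t)))) -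
      ∫ t in (0 : ℝ)..1, crossL (b - a) (F (triMap a b c (t, 1 - t))) := by
    have h3 := intervalIntegral.integral_comp_sub_left
      (a := (0 : ℝ)) (b := 1) (fun t => crossL (b - a) (F (triMap a b c (t, 1 - t)))) 1
    simp only [sub_self, sub_zero, sub_sub_cancel] at h3
    rw [← h3, ← intervalIntegral.integral_sub (cc _ _ (by fun_prop)) (cc _ _ (by fun_prop))]
    unfold edgeFlux
    congr 1
    ext t
    have : AffineMap.lineMap b c t = triMap a b c (1 - t, t) := by
      simp only [AffineMap.lineMap_apply, triMap, vsub_eq_sub, vadd_eq_add]; module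
    rw [this, crossL_apply, crossL_apply]
    simp only [cross, PiLp.sub_apply]; ring
  have hca : edgeFlux c a F = -∫ t in (0 : ℝ)..1, crossL (c - a) (F (triMap a b c (0, t))) := by
    rw [edgeFlux_swap, edgeFlux]
    congr 2
    ext t
    have : AffineMap.lineMap a c t = triMap a b c (0, t) := by
      simp only [AffineMap.lineMap_apply, triMap, vsub_eq_sub, vadd_eq_add]; module
    rw [this, crossL_apply]
  have hab : edgeFlux a b F = ∫ t in (0 : ℝ)..1, crossL (b - a) (F (triMap a b c (t, 0))) := by
    rw [edgeFlux]
    congr 1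
    ext t
    have : AffineMap.lineMap a b t = triMap a b c (t, 0) := by
      simp only [AffineMap.lineMap_apply, triMap, vsub_eq_sub, vadd_eq_add]; module
    rw [this, crossL_apply]
  rw [hab, hbc, hca, intervalIntegral.integral_sub (cc _ _ (by fun_prop)) (cc _ _ (by fun_prop)),
    intervalIntegral.integral_sub (cc _ _ (by fun_prop)) (cc _ _ (by fun_prop))]
  ring

/-! ### The trace inequality -/

lemma measurable_lineMap (a b : Plane) :
    Measurable fun t : ℝ => AffineMap.lineMap (k := ℝ) a b t :=
  (AffineMap.lineMap_continuous (R := ℝ) (p := a) (q := b)).measurable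

instance isFiniteMeasure_segMeasure (a b : Plane) : IsFiniteMeasure (segMeasure a b) := by
  unfold segMeasure
  have : IsFiniteMeasure ((volume.restrict (Icc (0 : ℝ) 1)).map
    (fun t => AffineMap.lineMap (k := ℝ) a b t)) := inferInstance
  exact Measure.smul_finite _ ENNReal.ofReal_ne_top

lemma integral_segMeasure {E : Type*} [NormedAddCommGroup E] [NormedSpace ℝ E] {a b : Plane}
    (hab : a ≠ b) {f : Plane → E} (hf : AEStronglyMeasurable f (segMeasure a b)) :
    ∫ x, f x ∂(segMeasure a b) = dist a b • ∫ t in (0 : ℝ)..1, f (AffineMap.lineMap a b t) := by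
  have h0 : ENNReal.ofReal (dist a b) ≠ 0 := by simpa using hab
  have hf' : AEStronglyMeasurable f ((volume.restrict (Icc (0 : ℝ) 1)).map
      (fun t => AffineMap.lineMap (k := ℝ) a b t)) :=
    hf.mono_ac (Measure.absolutelyContinuous_smul h0)
  rw [segMeasure, integral_smul_measure, ENNReal.toReal_ofReal dist_nonneg,
    integral_map (measurable_lineMap a b).aemeasurable hf',
    intervalIntegral.integral_of_le zero_le_one, integral_Icc_eq_integral_Ioc]

lemma eLpNorm_two_sq {α E : Type*} [MeasurableSpace α] [NormedAddCommGroup E] (f : α → E)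
    (μ : Measure α) : eLpNorm f 2 μ ^ 2 = ∫⁻ x, ‖f x‖ₑ ^ 2 ∂μ := by
  have := eLpNorm_nnreal_pow_eq_lintegral (f := f) (μ := μ) (p := 2) two_ne_zero
  simpa using this

lemma eLpNorm_two_sq_eq_ofReal {α E : Type*} [MeasurableSpace α] [NormedAddCommGroup E] {f : α → E}
    {μ : Measure α} (h : MemLp f 2 μ) :
    eLpNorm f 2 μ ^ 2 = ENNReal.ofReal (∫ x, ‖f x‖ ^ 2 ∂μ) := by
  rw [eLpNorm_two_sq, ofReal_integral_eq_lintegral_ofReal (h.integrable_norm_pow two_ne_zero)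
    (Eventually.of_forall fun x => by positivity)]
  congr 1
  ext x
  rw [ENNReal.ofReal_pow (norm_nonneg _), ofReal_norm]

lemma isCompact_triangle (a b c : Plane) : IsCompact (convexHull ℝ {a, b, c}) :=
  (Set.toFinite {a, b, c}).isCompact_convexHull (𝕜 := ℝ)

lemma memLp_of_continuous_isCompact {E : Type*} [NormedAddCommGroup E] {f : Plane → E}
    (hf : Continuous f) {D : Set Plane} (hD : IsCompact D) (p : ENNReal) :
    MemLp f p (volume.restrict D) := by
  have : IsFiniteMeasure (volume.restrict D) := ⟨by simpa using hD.measure_lt_top⟩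
  obtain ⟨C, hC⟩ := hD.exists_bound_of_continuousOn hf.continuousOn
  exact MemLp.of_bound hf.aestronglyMeasurable C
    ((ae_restrict_iff' hD.isClosed.measurableSet).2 (Eventually.of_forall hC))

lemma memLp_segMeasure_of_continuous {E : Type*} [NormedAddCommGroup E] {f : Plane → E}
    (hf : Continuous f) (a b : Plane) (p : ENNReal) : MemLp f p (segMeasure a b) := by
  have hb : MemLp f p ((volume.restrict (Icc (0 : ℝ) 1)).map
      (fun t => AffineMap.lineMap (k := ℝ) a b t)) := by
    refine (memLp_map_measure_iff hf.aestronglyMeasurable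
      (measurable_lineMap a b).aemeasurable).2 ?_
    have hc : Continuous (f ∘ fun t : ℝ => AffineMap.lineMap (k := ℝ) a b t) :=
      hf.comp AffineMap.lineMap_continuous
    obtain ⟨C, hC⟩ := (isCompact_Icc (a := (0 : ℝ)) (b := 1)).exists_bound_of_continuousOn
      hc.continuousOn
    exact MemLp.of_bound hc.aestronglyMeasurable C
      ((ae_restrict_iff' measurableSet_Icc).2 (Eventually.of_forall hC))
  exact hb.smul_measure ENNReal.ofReal_ne_top

/-- The divergence theorem is applied to `‖φ‖² (x - c)`. On the two sides through `c` this field is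
tangential, so their fluxes vanish; on `[a, b]` the normal component of `x - c` is constant, so the
flux is a multiple of the integral of `‖φ‖²`. -/
lemma integral_trace_le {a b c : Plane} (h : cross (b - a) (c - a) ≠ 0) :
    ∃ C : ℝ, 0 ≤ C ∧ ∀ φ : Plane → Plane, ContDiff ℝ 1 φ →
      ∫ t in (0 : ℝ)..1, ‖φ (AffineMap.lineMap a b t)‖ ^ 2 ≤
        C * ((∫ x in convexHull ℝ {a, b, c}, ‖φ x‖ ^ 2) +
          ∫ x in convexHull ℝ {a, b, c}, ‖fderiv ℝ φ x‖ ^ 2) := by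
  have hT := isCompact_triangle a b c
  obtain ⟨M, hM⟩ := hT.exists_bound_of_continuousOn (f := fun x => x - c)
    (continuous_id.sub continuous_const).continuousOn
  have hM0 : 0 ≤ M := (norm_nonneg _).trans (hM a (subset_convexHull ℝ _ (by simp)))
  -- The divergence is `2 ⟨φ, Dφ (x - c)⟩ + 2 ‖φ‖²`. With `‖x - c‖ ≤ M` the first term is at most `M
  -- (‖φ‖² + ‖Dφ‖²)`.
  refine ⟨(2 + M) / |cross (b - a) (c - a)|, by positivity, fun φ hφ => ?_⟩
  have hsq : ContDiff ℝ 1 fun x => ‖φ x‖ ^ 2 := hφ.norm_sq ℝ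
  have hF : ContDiff ℝ 1 fun x => ‖φ x‖ ^ 2 • (x - c) := hsq.smul (contDiff_id.sub contDiff_const)
  have hdiv : ∀ x, divergence (fun x => ‖φ x‖ ^ 2 • (x - c)) x =
      2 * inner ℝ (φ x) (fderiv ℝ φ x (x - c)) + 2 * ‖φ x‖ ^ 2 := fun x => by
    have h1 : HasFDerivAt φ (fderiv ℝ φ x) x := (hφ.differentiable one_ne_zero x).hasFDerivAt
    have h2 := h1.norm_sq.smul ((hasFDerivAt_id x).sub_const c)
    have h3 : x - c = (x - c) 0 • EuclideanSpace.single 0 1 + (x - c) 1 • EuclideanSpace.single 1 1 := by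
      ext i; fin_cases i <;> simp
    have h4 : inner ℝ (φ x) (fderiv ℝ φ x (x - c)) =
        (x - c) 0 * inner ℝ (φ x) (fderiv ℝ φ x (EuclideanSpace.single 0 1)) +
        (x - c) 1 * inner ℝ (φ x) (fderiv ℝ φ x (EuclideanSpace.single 1 1)) := by
      conv_lhs => rw [h3]
      rw [map_add, map_smul, map_smul, inner_add_right, inner_smul_right, inner_smul_right]
    have h5 : (fun x => ‖φ x‖ ^ 2 • (x - c)) = (fun x => ‖φ x‖ ^ 2) • fun x => id x - c := rfl
    rw [divergence, h5, h2.fderiv, h4, Fin.sum_univ_two]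
    simp
    ring
  have hc : Continuous fun x => divergence (fun x => ‖φ x‖ ^ 2 • (x - c)) x := by
    have := hφ.continuous
    have h2 := hφ.continuous_fderiv one_ne_zero
    simp only [hdiv]
    fun_prop
  have hflux : Real.sign (cross (b - a) (c - a)) *
      ∫ x in convexHull ℝ {a, b, c}, divergence (fun x => ‖φ x‖ ^ 2 • (x - c)) x =
      cross (b - a) (c - a) * ∫ t in (0 : ℝ)..1, ‖φ (AffineMap.lineMap a b t)‖ ^ 2 := by
    rw [integral_divergence_triangle h hF]
    have h1 : edgeFlux b c (fun x => ‖φ x‖ ^ 2 • (x - c)) = 0 := by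
      unfold edgeFlux
      refine intervalIntegral.integral_zero_ae (Eventually.of_forall fun t _ => ?_)
      have : AffineMap.lineMap b c t - c = (t - 1) • (c - b) := by
        simp only [AffineMap.lineMap_apply, vsub_eq_sub, vadd_eq_add]; module
      simp only [this, cross_smul_left, cross_self, mul_zero, mul_zero]
    have h2 : edgeFlux c a (fun x => ‖φ x‖ ^ 2 • (x - c)) = 0 := by
      unfold edgeFlux
      refine intervalIntegral.integral_zero_ae (Eventually.of_forall fun t _ => ?_)
      have : AffineMap.lineMap c a t - c = t • (a - c) := by
        simp only [AffineMap.lineMap_apply, vsub_eq_sub, vadd_eq_add]; module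
      simp only [this, cross_smul_left, cross_self, mul_zero, mul_zero]
    rw [h1, h2, add_zero, add_zero, edgeFlux, ← intervalIntegral.integral_const_mul]
    congr 1
    ext t
    rw [cross_smul_left, mul_comm]
    congr 1
    simp only [cross, AffineMap.lineMap_apply, vsub_eq_sub, vadd_eq_add, PiLp.sub_apply,
      PiLp.add_apply, PiLp.smul_apply, smul_eq_mul]
    ring
  have habs : |cross (b - a) (c - a)| * ∫ t in (0 : ℝ)..1, ‖φ (AffineMap.lineMap a b t)‖ ^ 2 =
      ∫ x in convexHull ℝ {a, b, c}, divergence (fun x => ‖φ x‖ ^ 2 • (x - c)) x := by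
    rcases lt_or_gt_of_ne h with h' | h'
    · rw [Real.sign_of_neg h'] at hflux
      rw [abs_of_neg h']
      linarith
    · rw [Real.sign_of_pos h'] at hflux
      rw [abs_of_pos h']
      linarith
  have hpos : 0 < |cross (b - a) (c - a)| := abs_pos.2 h
  rw [div_mul_eq_mul_div, le_div_iff₀ hpos, mul_comm, habs]
  have c1 : Continuous fun x => ‖φ x‖ ^ 2 := hsq.continuous
  have c2 : Continuous fun x => ‖fderiv ℝ φ x‖ ^ 2 := (hφ.continuous_fderiv one_ne_zero).norm.pow 2
  have i1 := c1.continuousOn.integrableOn_compact (μ := volume) hT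
  have i2 := c2.continuousOn.integrableOn_compact (μ := volume) hT
  rw [← integral_add i1 i2, ← integral_const_mul]
  refine setIntegral_mono_on (hc.continuousOn.integrableOn_compact hT) ((i1.add i2).const_mul _)
    hT.isClosed.measurableSet fun x hx => ?_
  rw [hdiv]
  have e1 : inner ℝ (φ x) (fderiv ℝ φ x (x - c)) ≤ ‖φ x‖ * (‖fderiv ℝ φ x‖ * M) :=
    (real_inner_le_norm _ _).trans (mul_le_mul_of_nonneg_left
      (((fderiv ℝ φ x).le_opNorm _).trans
        (mul_le_mul_of_nonneg_left (hM x hx) (norm_nonneg _))) (norm_nonneg _))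
  nlinarith [mul_nonneg hM0 (sq_nonneg (‖φ x‖ - ‖fderiv ℝ φ x‖)), sq_nonneg ‖φ x‖,
    sq_nonneg ‖fderiv ℝ φ x‖]

/-- The trace inequality on a triangle. -/
lemma eLpNorm_trace_le {a b c : Plane} (h : cross (b - a) (c - a) ≠ 0) :
    ∃ C : ENNReal, C ≠ ⊤ ∧ ∀ φ : Plane → Plane, ContDiff ℝ 1 φ →
      eLpNorm φ 2 (segMeasure a b) ≤
        C * (eLpNorm φ 2 (volume.restrict (convexHull ℝ {a, b, c})) +
          eLpNorm (fderiv ℝ φ) 2 (volume.restrict (convexHull ℝ {a, b, c}))) := by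
  obtain ⟨C, hC, hle⟩ := integral_trace_le h
  have hab : a ≠ b := by
    rintro rfl
    simp [cross] at h
  -- The norms are compared after squaring; adding one makes the square of the constant dominate
  -- `dist a b * C` without taking roots.
  refine ⟨ENNReal.ofReal (dist a b * C + 1), ENNReal.ofReal_ne_top, fun φ hφ => ?_⟩
  have hT := isCompact_triangle a b c
  have m1 := memLp_of_continuous_isCompact hφ.continuous hT 2
  have m2 := memLp_of_continuous_isCompact (hφ.continuous_fderiv one_ne_zero) hT 2
  have m3 := memLp_segMeasure_of_continuous hφ.continuous a b 2
  rw [← ENNReal.pow_le_pow_left_iff two_ne_zero, mul_pow, eLpNorm_two_sq_eq_ofReal m3,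
    integral_segMeasure (f := fun x => ‖φ x‖ ^ 2) hab
      (hφ.continuous.norm.pow 2).aestronglyMeasurable]
  have i1 : 0 ≤ ∫ x in convexHull ℝ {a, b, c}, ‖φ x‖ ^ 2 := integral_nonneg fun x => by positivity
  have i2 : 0 ≤ ∫ x in convexHull ℝ {a, b, c}, ‖fderiv ℝ φ x‖ ^ 2 :=
    integral_nonneg fun x => by positivity
  have hdC : 0 ≤ dist a b * C := mul_nonneg dist_nonneg hC
  calc ENNReal.ofReal (dist a b • ∫ t in (0 : ℝ)..1, ‖φ (AffineMap.lineMap a b t)‖ ^ 2)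
      ≤ ENNReal.ofReal ((dist a b * C + 1) ^ 2 *
        ((∫ x in convexHull ℝ {a, b, c}, ‖φ x‖ ^ 2) +
          ∫ x in convexHull ℝ {a, b, c}, ‖fderiv ℝ φ x‖ ^ 2)) := by
        refine ENNReal.ofReal_le_ofReal ?_
        refine (mul_le_mul_of_nonneg_left (hle φ hφ) dist_nonneg).trans ?_
        rw [← mul_assoc]
        refine mul_le_mul_of_nonneg_right ?_ (by positivity)
        nlinarith
    _ ≤ _ := by
        rw [ENNReal.ofReal_mul (by positivity), ENNReal.ofReal_pow (by positivity),
          ENNReal.ofReal_add i1 i2, ← eLpNorm_two_sq_eq_ofReal m1, ← eLpNorm_two_sq_eq_ofReal m2]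
        refine mul_le_mul_right ?_ _
        rw [add_sq]
        refine add_le_add_left ?_ _
        exact le_self_add

section

/-! ### Averages of contractions -/

section Average

lemma integrable_contraction {F : Type*} [NormedAddCommGroup F] {f : Plane → F}
    (hf : Integrable f volume) {ε : ℝ} (h0 : ε ≠ 0)
    (x : Plane) {ρ : Measure Plane} {C : ENNReal} (hC : C ≠ ⊤) (hρ : ρ ≤ C • volume) :
    Integrable (fun y => f ((1 - ε) • x + ε • y)) ρ :=
  (((hf.comp_add_left ((1 - ε) • x)).comp_smul h0).smul_measure hC).mono_measure hρ

/-- In dimension two the contraction scales areas by `(1 - ε)²`, and `(1 - ε)⁻² ≤ 4` for `ε ≤ 1 /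
2`. -/
lemma lintegral_contraction_le {ε : ℝ} (h1 : ε ≤ 1 / 2) (y : Plane) {g : Plane → ENNReal}
    (hg : Measurable g) :
    ∫⁻ x, g ((1 - ε) • x + ε • y) ≤ 4 * ∫⁻ x, g x := by
  have h : (1 - ε) ≠ 0 := by linarith
  have hm : Measurable fun x : Plane => g (x + ε • y) := by fun_prop
  have e1 := lintegral_map (μ := volume) hm (measurable_const_smul (1 - ε) (α := Plane))
  rw [Measure.map_addHaar_smul volume h, lintegral_smul_measure] at e1
  rw [← e1, lintegral_add_right_eq_self g (ε • y), smul_eq_mul]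
  gcongr
  rw [← ENNReal.ofReal_ofNat 4]
  refine ENNReal.ofReal_le_ofReal ?_
  rw [finrank_euclideanSpace_fin, abs_of_nonneg (by positivity)]
  rw [inv_le_comm₀ (by nlinarith) (by norm_num)]
  nlinarith

variable {F : Type*} [NormedAddCommGroup F] [NormedSpace ℝ F]


/-- The average of `f` over the contracted copies of the measure `ρ`. -/
def contractionAverage (ρ : Measure Plane) (ε : ℝ) (f : Plane → F) (x : Plane) : F :=
  ∫ y, f ((1 - ε) • x + ε • y) ∂ρ

/-- On a probability space the `L¹` norm is at most the `L²` norm. -/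
lemma enorm_integral_sq_le {ρ : Measure Plane} [IsProbabilityMeasure ρ] {g : Plane → F}
    (hg : AEStronglyMeasurable g ρ) : ‖∫ y, g y ∂ρ‖ₑ ^ 2 ≤ ∫⁻ y, ‖g y‖ₑ ^ 2 ∂ρ := by
  rw [← eLpNorm_two_sq]
  refine pow_le_pow_left' ?_ 2
  calc ‖∫ y, g y ∂ρ‖ₑ ≤ ∫⁻ y, ‖g y‖ₑ ∂ρ := enorm_integral_le_lintegral_enorm _
    _ = eLpNorm g 1 ρ := eLpNorm_one_eq_lintegral_enorm.symm
    _ ≤ eLpNorm g 2 ρ := eLpNorm_le_eLpNorm_of_exponent_le (by norm_num) hg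

/-- Jensen's inequality for the average, Tonelli, and the bound for a single contraction. The
constant does not depend on `ε`, which the density argument for the convergence of the averages
requires. -/
lemma eLpNorm_contractionAverage_le (ρ : Measure Plane) [IsProbabilityMeasure ρ] {ε : ℝ}
    (h1 : ε ≤ 1 / 2) {f : Plane → F} (hf : StronglyMeasurable f) :
    eLpNorm (contractionAverage ρ ε f) 2 volume ≤ 2 * eLpNorm f 2 volume := by
  have hmap : Measurable fun p : Plane × Plane => (1 - ε) • p.1 + ε • p.2 := by fun_prop
  rw [← ENNReal.pow_le_pow_left_iff two_ne_zero, mul_pow, eLpNorm_two_sq, eLpNorm_two_sq]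
  calc ∫⁻ x, ‖contractionAverage ρ ε f x‖ₑ ^ 2
      ≤ ∫⁻ x, ∫⁻ y, ‖f ((1 - ε) • x + ε • y)‖ₑ ^ 2 ∂ρ := by
        refine lintegral_mono fun x => enorm_integral_sq_le ?_
        exact (hf.comp_measurable
          (hmap.comp (measurable_const.prodMk measurable_id))).aestronglyMeasurable
    _ = ∫⁻ y, ∫⁻ x, ‖f ((1 - ε) • x + ε • y)‖ₑ ^ 2 ∂volume ∂ρ := by
        refine lintegral_lintegral_swap ?_
        exact ((hf.comp_measurable hmap).enorm.pow_const 2).aemeasurable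
    _ ≤ ∫⁻ _, (4 * ∫⁻ x, ‖f x‖ₑ ^ 2) ∂ρ := by
        exact lintegral_mono fun y => lintegral_contraction_le h1 y (hf.enorm.pow_const 2)
    _ = 2 ^ 2 * ∫⁻ x, ‖f x‖ₑ ^ 2 := by
        rw [lintegral_const, measure_univ, mul_one]; norm_num

variable [CompleteSpace F]

/-- The contraction moves `x` by `ε (y - x)`, which is uniformly small for `x` in the bounded set
`D` and `y` in the support of `ρ`; a continuous function with compact support is uniformly
continuous. -/
lemma eLpNorm_contractionAverage_sub_le (ρ : Measure Plane) [IsProbabilityMeasure ρ] {g : Plane → F}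
    (hg : Continuous g) (hgs : HasCompactSupport g) {R : ℝ} (hR : ∀ᵐ y ∂ρ, ‖y‖ ≤ R)
    {D : Set Plane} (hD : IsCompact D) {τ : ℝ} (hτ : 0 < τ) :
    ∃ δ > 0, ∀ ε, 0 ≤ ε → ε < δ → ∀ᵐ x ∂(volume.restrict D),
      ‖contractionAverage ρ ε g x - g x‖ ≤ τ := by
  obtain ⟨M, hM⟩ := hD.exists_bound_of_continuousOn (f := id) continuousOn_id
  obtain ⟨δ, hδ, hu⟩ := Metric.uniformContinuous_iff.1
    (hgs.uniformContinuous_of_continuous hg) τ hτ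
  refine ⟨δ / (|R| + |M| + 1), by positivity, fun ε h0 hε => ?_⟩
  refine (ae_restrict_iff' hD.isClosed.measurableSet).2 (Eventually.of_forall fun x hx => ?_)
  have hint : Integrable (fun y => g ((1 - ε) • x + ε • y)) ρ := by
    obtain ⟨B, hB⟩ := hgs.exists_bound_of_continuous hg
    exact Integrable.of_bound
      (hg.comp (continuous_const.add (continuous_id.const_smul ε))).aestronglyMeasurable B
      (Eventually.of_forall fun y => hB _)
  have e : contractionAverage ρ ε g x - g x = ∫ y, (g ((1 - ε) • x + ε • y) - g x) ∂ρ := by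
    rw [integral_sub hint (integrable_const _), integral_const, probReal_univ, one_smul]
    rfl
  rw [e]
  refine (norm_integral_le_of_norm_le_const (C := τ) (hR.mono fun y hy => ?_)).trans
    (by rw [probReal_univ, mul_one])
  rw [← dist_eq_norm]
  refine (hu ?_).le
  rw [dist_eq_norm, show (1 - ε) • x + ε • y - x = ε • (y - x) by module, norm_smul,
    Real.norm_of_nonneg h0]
  rw [lt_div_iff₀ (by positivity)] at hε
  refine lt_of_le_of_lt (mul_le_mul_of_nonneg_left ?_ h0) hε
  have h1 := norm_sub_le y x
  have h2 : ‖x‖ ≤ M := hM x hx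
  linarith [le_abs_self R, le_abs_self M]

/-- The averages are uniformly bounded on `L²` and converge on continuous functions with compact
support, which are dense. -/
lemma tendsto_contractionAverage (ρ : Measure Plane) [IsProbabilityMeasure ρ] {R : ℝ}
    (hR : ∀ᵐ y ∂ρ, ‖y‖ ≤ R) {C : ENNReal} (hC : C ≠ ⊤) (hρ : ρ ≤ C • volume)
    {D : Set Plane} (hD : IsCompact D) {f : Plane → F} (hf : StronglyMeasurable f)
    (hf1 : Integrable f volume) (hf2 : MemLp f 2 volume) {ε : ℕ → ℝ} (hε0 : ∀ j, 0 < ε j)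
    (hε1 : ∀ j, ε j ≤ 1 / 2) (hε : Tendsto ε atTop (𝓝 0)) :
    Tendsto (fun j => eLpNorm (fun x => contractionAverage ρ (ε j) f x - f x) 2 (volume.restrict D))
      atTop (𝓝 0) := by
  rw [ENNReal.tendsto_nhds_zero]
  intro κ hκ
  -- The budget is `2 κ'` for the average of `f - g`, `κ'` for the error of the average of `g`, and
  -- `κ'` for `g - f`.
  obtain ⟨κ', hκ'0, hκ'⟩ : ∃ κ' : ENNReal, κ' ≠ 0 ∧ 4 * κ' ≤ κ :=
    ⟨κ / 4, by simpa using hκ.ne', by rw [ENNReal.mul_div_cancel] <;> norm_num⟩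
  obtain ⟨g, hgs, hfg, hg, hg2⟩ := hf2.exists_hasCompactSupport_eLpNorm_sub_le
    (ENNReal.ofNat_ne_top (n := 2)) hκ'0
  have hg1 : Integrable g volume := hg.integrable_of_hasCompactSupport hgs
  have hvol : volume D ≠ ⊤ := hD.measure_lt_top.ne
  -- A uniform bound `τ` on `D` costs a factor `√(volume D)` in `L²(D)`.
  obtain ⟨τ, hτ0, hτ⟩ : ∃ τ : ℝ, 0 < τ ∧ volume D ^ (2 : ENNReal).toReal⁻¹ * ENNReal.ofReal τ ≤ κ' := by
    set V := volume D ^ (2 : ENNReal).toReal⁻¹ with hV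
    have hVtop : V ≠ ⊤ := ENNReal.rpow_ne_top_of_nonneg (by positivity) hvol
    rcases eq_or_ne κ' ⊤ with h | h
    · exact ⟨1, one_pos, by simp [h]⟩
    refine ⟨κ'.toReal / (V.toReal + 1), div_pos (ENNReal.toReal_pos hκ'0 h) (by positivity), ?_⟩
    rw [← ENNReal.ofReal_toReal hVtop, ← ENNReal.ofReal_mul ENNReal.toReal_nonneg,
      ENNReal.toReal_ofReal ENNReal.toReal_nonneg]
    conv_rhs => rw [← ENNReal.ofReal_toReal h]
    refine ENNReal.ofReal_le_ofReal ?_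
    rw [mul_div_assoc', div_le_iff₀ (by positivity)]
    nlinarith [ENNReal.toReal_nonneg (a := κ'), ENNReal.toReal_nonneg (a := V)]
  obtain ⟨δ, hδ, hle⟩ := eLpNorm_contractionAverage_sub_le ρ hg hgs hR hD hτ0
  filter_upwards [hε.eventually (gt_mem_nhds hδ)] with j hj
  have hsplit : (fun x => contractionAverage ρ (ε j) f x - f x) =
      contractionAverage ρ (ε j) (f - g) + ((fun x => contractionAverage ρ (ε j) g x - g x)
        + (g - f)) := by
    ext1 x
    have : contractionAverage ρ (ε j) (f - g) x =
        contractionAverage ρ (ε j) f x - contractionAverage ρ (ε j) g x :=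
      integral_sub (integrable_contraction hf1 (hε0 j).ne' x hC hρ)
        (integrable_contraction hg1 (hε0 j).ne' x hC hρ)
    simp only [Pi.add_apply, Pi.sub_apply, this]
    abel
  have hmeas : ∀ h : Plane → F, StronglyMeasurable h →
      StronglyMeasurable (contractionAverage ρ (ε j) h) := fun h hh => by
    refine StronglyMeasurable.integral_prod_right (f := fun x y => h ((1 - ε j) • x + ε j • y)) ?_
    exact hh.comp_measurable (g := fun p : Plane × Plane => (1 - ε j) • p.1 + ε j • p.2)
      (by fun_prop)
  have hgm : StronglyMeasurable g := hg.stronglyMeasurable_of_hasCompactSupport hgs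
  have b1 : eLpNorm (contractionAverage ρ (ε j) (f - g)) 2 (volume.restrict D) ≤ 2 * κ' :=
    (eLpNorm_restrict_le _ _ _ _).trans
      ((eLpNorm_contractionAverage_le ρ (hε1 j) (hf.sub hgm)).trans (by gcongr))
  have b2 : eLpNorm (fun x => contractionAverage ρ (ε j) g x - g x) 2 (volume.restrict D) ≤ κ' := by
    refine (eLpNorm_le_of_ae_bound (hle (ε j) (hε0 j).le hj)).trans ?_
    rwa [Measure.restrict_apply_univ]
  have b3 : eLpNorm (g - f) 2 (volume.restrict D) ≤ κ' := by
    rw [eLpNorm_sub_comm]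
    exact (eLpNorm_restrict_le _ _ _ _).trans hfg
  rw [hsplit]
  calc _ ≤ 2 * κ' + (κ' + κ') := by
        refine (eLpNorm_add_le (hmeas _ (hf.sub hgm)).aestronglyMeasurable
          (((hmeas _ hgm).sub hgm).add (hgm.sub hf)).aestronglyMeasurable one_le_two).trans ?_
        refine add_le_add b1 ((eLpNorm_add_le ((hmeas _ hgm).sub hgm).aestronglyMeasurable
          (hgm.sub hf).aestronglyMeasurable one_le_two).trans (add_le_add b2 b3))
    _ = 4 * κ' := by ring
    _ ≤ κ := hκ'

end Average

end

section

/-! ### Density of smooth functions -/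

/-- The rescaled kernel of the averages of contractions. -/
def contractionKernel (e : Plane → ℝ) (ε : ℝ) (t : Plane) : ℝ := (ε ^ 2)⁻¹ * e ((-ε⁻¹) • t)

section Kernel

variable {F : Type*} [NormedAddCommGroup F] [NormedSpace ℝ F]

/-- The substitution `t = -ε y` puts all dependence on `x` into a smooth kernel, so that regularity
and derivatives of the average follow from those of convolutions. -/
lemma contractionAverage_eq_convolution {e : Plane → ℝ} (he : Continuous e) (he0 : ∀ y, 0 ≤ e y)
    {ε : ℝ} (hε : ε ≠ 0) (f : Plane → F) (x : Plane) :
    contractionAverage (volume.withDensity fun y => ENNReal.ofReal (e y)) ε f x =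
      convolution (contractionKernel e ε) f (ContinuousLinearMap.lsmul ℝ ℝ) volume
        ((1 - ε) • x) := by
  rw [contractionAverage, integral_withDensity_eq_integral_toReal_smul
    (f := fun y => ENNReal.ofReal (e y)) he.measurable.ennreal_ofReal (by simp), convolution_def]
  have h := Measure.integral_comp_smul (volume : Measure Plane)
    (fun t => (contractionKernel e ε t) • f ((1 - ε) • x - t)) (-ε)
  rw [finrank_euclideanSpace_fin, abs_of_nonneg (by positivity), neg_sq] at h
  simp only [ContinuousLinearMap.lsmul_apply]
  rw [eq_inv_smul_iff₀ (pow_ne_zero 2 hε)] at h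
  rw [← h, ← integral_smul]
  congr 1
  ext1 y
  rw [contractionKernel, smul_smul, smul_smul, neg_mul_neg, inv_mul_cancel₀ hε, one_smul,
    ← mul_assoc, mul_inv_cancel₀ (pow_ne_zero 2 hε), one_mul, ENNReal.toReal_ofReal (he0 y),
    neg_smul, sub_neg_eq_add]

end Kernel

lemma contDiff_contractionKernel {e : Plane → ℝ} (he : ContDiff ℝ ∞ e) (ε : ℝ) :
    ContDiff ℝ ∞ (contractionKernel e ε) :=
  contDiff_const.mul (he.comp (contDiff_const_smul _))

lemma hasCompactSupport_contractionKernel {e : Plane → ℝ} (he : HasCompactSupport e) {ε : ℝ}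
    (hε : ε ≠ 0) : HasCompactSupport (contractionKernel e ε) :=
  (he.comp_smul (c := -ε⁻¹) (by simpa using hε)).mul_left

/-- This is where star-shapedness with respect to a ball enters. The kernel lives at points `(1 - ε)
x + ε y` with `y` in the smaller ball. Letting `y` range over the open ball gives an open set,
contained in `D` by star-shapedness, so the support lies in the interior even when `x` is a boundary
point. -/
lemma isTestFunction_contractionKernel {D : Set Plane} (hD : IsCompact D) {c : Plane} {r : ℝ}
    (hr : 0 < r) (hstar : ∀ y ∈ Metric.ball c r, StarConvex ℝ y D) {e : Plane → ℝ}
    (he : ContDiff ℝ ∞ e) (hes : tsupport e ⊆ Metric.closedBall c (r / 2)) {ε : ℝ} (h0 : 0 < ε)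
    (h1 : ε ≤ 1) {x : Plane} (hx : x ∈ D) :
    IsTestFunction D fun z => contractionKernel e ε ((1 - ε) • x - z) := by
  have hsub : tsupport (fun z => contractionKernel e ε ((1 - ε) • x - z)) ⊆
      (fun z => ε⁻¹ • (z - (1 - ε) • x)) ⁻¹' Metric.closedBall c (r / 2) := by
    refine closure_minimal (fun z hz => hes (subset_tsupport _ ?_))
      (Metric.isClosed_closedBall.preimage (by fun_prop))
    rw [Function.mem_support] at hz ⊢
    intro h
    apply hz
    rw [contractionKernel, show (-ε⁻¹) • ((1 - ε) • x - z) = ε⁻¹ • (z - (1 - ε) • x) by module, h,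
      mul_zero]
  have hint : tsupport (fun z => contractionKernel e ε ((1 - ε) • x - z)) ⊆ interior D := by
    refine hsub.trans (Subset.trans (preimage_mono
      (Metric.closedBall_subset_ball (half_lt_self hr))) (interior_maximal ?_
        (Metric.isOpen_ball.preimage (by fun_prop))))
    intro z hz
    have h := hstar _ hz hx h0.le (sub_nonneg.2 h1) (by ring)
    rwa [smul_smul, mul_inv_cancel₀ h0.ne', one_smul, sub_add_cancel] at h
  exact ⟨(contDiff_contractionKernel he ε).comp (contDiff_const.sub contDiff_id),
    hD.of_isClosed_subset (isClosed_tsupport _) (hint.trans interior_subset), hint⟩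

/-- The derivative falls on the kernel and is moved to `u` by the definition of the weak derivative;
for `x ∈ D` the kernel is an admissible test function. The factor `1 - ε` is the chain rule for the
contraction. -/
lemma fderiv_contractionAverage {D : Set Plane} (hD : IsCompact D) {c : Plane} {r : ℝ}
    (hr : 0 < r) (hstar : ∀ y ∈ Metric.ball c r, StarConvex ℝ y D) {e : Plane → ℝ}
    (he : ContDiff ℝ ∞ e) (hec : HasCompactSupport e) (he0 : ∀ y, 0 ≤ e y)
    (hes : tsupport e ⊆ Metric.closedBall c (r / 2)) {ε : ℝ} (h0 : 0 < ε)
    (h1 : ε ≤ 1) {u : Plane → Plane} {G : Plane → Plane →L[ℝ] Plane} (hu : Integrable u volume)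
    (hG : Integrable G volume) (hu0 : ∀ x ∉ D, u x = 0) (hG0 : ∀ x ∉ D, G x = 0)
    (hw : HasWeakDeriv D u G) {x : Plane} (hx : x ∈ D) :
    fderiv ℝ (contractionAverage (volume.withDensity fun y => ENNReal.ofReal (e y)) ε u) x =
      (1 - ε) • contractionAverage (volume.withDensity fun y => ENNReal.ofReal (e y)) ε G x := by
  set k := contractionKernel e ε with hk
  have hkc : ContDiff ℝ ∞ k := contDiff_contractionKernel he ε
  have hks : HasCompactSupport k := hasCompactSupport_contractionKernel hec h0.ne'
  have hfun : contractionAverage (volume.withDensity fun y => ENNReal.ofReal (e y)) ε u =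
      fun x => convolution k u (ContinuousLinearMap.lsmul ℝ ℝ) volume ((1 - ε) • x) :=
    funext fun x => contractionAverage_eq_convolution he.continuous he0 h0.ne' u x
  have hd := hks.hasFDerivAt_convolution_left (ContinuousLinearMap.lsmul ℝ ℝ)
    (hkc.of_le (by simp)) hu.locallyIntegrable ((1 - ε) • x)
  have hs : HasFDerivAt (fun x : Plane => (1 - ε) • x) ((1 - ε) • ContinuousLinearMap.id ℝ Plane) x :=
    (hasFDerivAt_id x).const_smul (1 - ε)
  have htest := isTestFunction_contractionKernel hD hr hstar he hes h0 h1 hx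
  have hcomp : HasFDerivAt (fun x => convolution k u (ContinuousLinearMap.lsmul ℝ ℝ) volume
      ((1 - ε) • x)) _ x := hd.comp x hs
  rw [hfun, hcomp.fderiv,
    contractionAverage_eq_convolution he.continuous he0 h0.ne' G x]
  ext1 y
  rw [ContinuousLinearMap.comp_apply, _root_.smul_apply, ContinuousLinearMap.id_apply,
    map_smul, _root_.smul_apply]
  congr 1
  have hex1 := (hks.fderiv (𝕜 := ℝ)).convolutionExists_left
    ((ContinuousLinearMap.lsmul ℝ ℝ).precompL Plane : (Plane →L[ℝ] ℝ) →L[ℝ] Plane →L[ℝ] Plane →L[ℝ] Plane)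
    (hkc.continuous_fderiv (by simp)) hu.locallyIntegrable ((1 - ε) • x)
  have hex2 := hks.convolutionExists_left (ContinuousLinearMap.lsmul ℝ ℝ) hkc.continuous
    hG.locallyIntegrable ((1 - ε) • x)
  rw [convolution_def, convolution_def, ContinuousLinearMap.integral_apply hex1,
    ContinuousLinearMap.integral_apply hex2]
  simp only [ContinuousLinearMap.precompL_apply, ContinuousLinearMap.lsmul_apply,
    _root_.smul_apply]
  have e1 := integral_sub_left_eq_self
    (fun t => (fderiv ℝ k t y) • u ((1 - ε) • x - t)) volume ((1 - ε) • x)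
  have e2 := integral_sub_left_eq_self
    (fun t => k t • G ((1 - ε) • x - t) y) volume ((1 - ε) • x)
  rw [← e1, ← e2]
  simp only [sub_sub_cancel]
  have hw' := hw _ htest y
  have hfd : ∀ z, fderiv ℝ (fun z => k ((1 - ε) • x - z)) z y = -fderiv ℝ k ((1 - ε) • x - z) y :=
    fun z => by
      have h1 : HasFDerivAt (fun z => k ((1 - ε) • x - z)) _ z :=
        (hkc.differentiable (by simp) ((1 - ε) • x - z)).hasFDerivAt.comp z
          ((hasFDerivAt_id z).const_sub ((1 - ε) • x))
      rw [h1.fderiv]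
      simp
  rw [setIntegral_eq_integral_of_forall_compl_eq_zero (fun z hz => by rw [hu0 z hz, smul_zero]),
    setIntegral_eq_integral_of_forall_compl_eq_zero
      (fun z hz => by rw [hG0 z hz, _root_.zero_apply, smul_zero])] at hw'
  simp only [← hk, hfd, neg_smul, integral_neg, neg_inj] at hw'
  exact hw'

lemma contDiff_contractionAverage {e : Plane → ℝ} (he : ContDiff ℝ ∞ e) (hec : HasCompactSupport e)
    (he0 : ∀ y, 0 ≤ e y) {ε : ℝ} (h0 : ε ≠ 0) {u : Plane → Plane} (hu : Integrable u volume) :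
    ContDiff ℝ ∞ (contractionAverage (volume.withDensity fun y => ENNReal.ofReal (e y)) ε u) := by
  have hfun : contractionAverage (volume.withDensity fun y => ENNReal.ofReal (e y)) ε u =
      fun x => convolution (contractionKernel e ε) u (ContinuousLinearMap.lsmul ℝ ℝ) volume
        ((1 - ε) • x) :=
    funext fun x => contractionAverage_eq_convolution he.continuous he0 h0 u x
  rw [hfun]
  exact ((hasCompactSupport_contractionKernel hec h0).contDiff_convolution_left _
    (contDiff_contractionKernel he ε) hu.locallyIntegrable).comp (contDiff_const_smul _)

lemma HasWeakDeriv.congr {D : Set Plane} {u u' : Plane → Plane}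
    {G G' : Plane → Plane →L[ℝ] Plane} (h : HasWeakDeriv D u G)
    (hu : ∀ᵐ x ∂(volume.restrict D), u' x = u x) (hG : ∀ᵐ x ∂(volume.restrict D), G' x = G x) :
    HasWeakDeriv D u' G' := by
  intro φ hφ y
  have e1 : ∫ x in D, fderiv ℝ φ x y • u' x = ∫ x in D, fderiv ℝ φ x y • u x :=
    integral_congr_ae (hu.mono fun x hx => by simp only [hx])
  have e2 : ∫ x in D, φ x • G' x y = ∫ x in D, φ x • G x y :=
    integral_congr_ae (hG.mono fun x hx => by simp only [hx])
  rw [e1, e2]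
  exact h φ hφ y

lemma MemH1With.congr {D : Set Plane} {u u' : Plane → Plane}
    {G G' : Plane → Plane →L[ℝ] Plane} (h : MemH1With D u G)
    (hu : ∀ᵐ x ∂(volume.restrict D), u' x = u x) (hG : ∀ᵐ x ∂(volume.restrict D), G' x = G x) :
    MemH1With D u' G' :=
  ⟨(memLp_congr_ae hu).2 h.1, (memLp_congr_ae hG).2 h.2.1, h.2.2.congr hu hG⟩

/-- Contractions and convolutions act on functions on the whole plane. The weak derivative identity
only sees `D`, so extension by zero does no harm. -/
lemma exists_zero_extension {F : Type*} [NormedAddCommGroup F] {D : Set Plane} (hD : IsCompact D)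
    {f : Plane → F} (hf : MemLp f 2 (volume.restrict D)) :
    ∃ g : Plane → F, StronglyMeasurable g ∧ (∀ x ∉ D, g x = 0) ∧
      (∀ᵐ x ∂(volume.restrict D), g x = f x) ∧ MemLp g 2 volume ∧ Integrable g volume := by
  have hDm := hD.isClosed.measurableSet
  have hfin : IsFiniteMeasure (volume.restrict D) := ⟨by simpa using hD.measure_lt_top⟩
  have hmk : MemLp (hf.1.mk f) 2 (volume.restrict D) := (memLp_congr_ae hf.1.ae_eq_mk).1 hf
  refine ⟨D.indicator (hf.1.mk f), hf.1.stronglyMeasurable_mk.indicator hDm,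
    fun x hx => indicator_of_notMem hx _, ?_, (memLp_indicator_iff_restrict hDm).2 hmk, ?_⟩
  · filter_upwards [hf.1.ae_eq_mk, ae_restrict_mem hDm] with x hx hxD
    rw [indicator_of_mem hxD, hx]
  · exact (integrable_indicator_iff hDm).2 (hmk.integrable one_le_two)

/-- Smooth fields are dense in `H¹(D; ℝ²)` when `D` is star-shaped with respect to a ball. -/
lemma exists_smooth_approx {D : Set Plane} (hD : IsCompact D) {c : Plane} {r : ℝ}
    (hr : 0 < r) (hstar : ∀ y ∈ Metric.ball c r, StarConvex ℝ y D) {u : Plane → Plane}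
    {G : Plane → Plane →L[ℝ] Plane} (h : MemH1With D u G) :
    ∃ φ : ℕ → Plane → Plane, (∀ j, ContDiff ℝ ∞ (φ j)) ∧
      Tendsto (fun j => eLpNorm (fun x => φ j x - u x) 2 (volume.restrict D)) atTop (𝓝 0) ∧
      Tendsto (fun j => eLpNorm (fun x => fderiv ℝ (φ j) x - G x) 2 (volume.restrict D))
        atTop (𝓝 0) := by
  obtain ⟨u', hu'm, hu'0, hu'u, hu'2, hu'1⟩ := exists_zero_extension hD h.1
  obtain ⟨G', hG'm, hG'0, hG'G, hG'2, hG'1⟩ := exists_zero_extension hD h.2.1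
  have hw : HasWeakDeriv D u' G' := h.2.2.congr hu'u hG'G
  -- The outer radius `r / 2` keeps the support strictly inside the ball of star centres.
  let η : ContDiffBump c := ⟨r / 4, r / 2, by positivity, by linarith⟩
  let e : Plane → ℝ := η.normed volume
  have he : ContDiff ℝ ∞ e := η.contDiff_normed
  have hec : HasCompactSupport e := η.hasCompactSupport_normed
  have he0 : ∀ y, 0 ≤ e y := η.nonneg_normed
  have hes : tsupport e ⊆ Metric.closedBall c (r / 2) := η.tsupport_normed_eq.subset
  set ρ : Measure Plane := volume.withDensity fun y => ENNReal.ofReal (e y) with hρ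
  have hprob : IsProbabilityMeasure ρ := by
    constructor
    rw [hρ, withDensity_apply _ MeasurableSet.univ, Measure.restrict_univ,
      ← ofReal_integral_eq_lintegral_ofReal (he.continuous.integrable_of_hasCompactSupport hec)
      (Eventually.of_forall he0), η.integral_normed, ENNReal.ofReal_one]
  obtain ⟨B, hB⟩ := hec.exists_bound_of_continuous he.continuous
  have hρle : ρ ≤ ENNReal.ofReal B • volume := by
    rw [hρ, ← withDensity_const]
    exact withDensity_mono (Eventually.of_forall fun y =>
      ENNReal.ofReal_le_ofReal ((le_abs_self _).trans (hB y)))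
  have hR : ∀ᵐ y ∂ρ, ‖y‖ ≤ ‖c‖ + r / 2 := by
    rw [hρ, ae_withDensity_iff (f := fun y => ENNReal.ofReal (e y))
      he.continuous.measurable.ennreal_ofReal]
    refine Eventually.of_forall fun y hy => ?_
    have hy' : y ∈ tsupport e := subset_tsupport _ fun h0 => hy (by simp [h0])
    have := mem_closedBall_iff_norm.1 (hes hy')
    linarith [norm_le_norm_add_norm_sub' y c]
  let ε : ℕ → ℝ := fun j => 1 / ((j : ℝ) + 2)
  have hε0 : ∀ j, 0 < ε j := fun j => by positivity
  have hε1 : ∀ j, ε j ≤ 1 / 2 := fun j =>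
    one_div_le_one_div_of_le two_pos (by linarith [(Nat.cast_nonneg j : (0 : ℝ) ≤ j)])
  have hε : Tendsto ε atTop (𝓝 0) := by
    refine Tendsto.div_atTop tendsto_const_nhds ?_
    exact tendsto_natCast_atTop_atTop.atTop_add tendsto_const_nhds
  have t1 := tendsto_contractionAverage ρ hR ENNReal.ofReal_ne_top hρle hD hu'm hu'1 hu'2 hε0 hε1 hε
  have t2 := tendsto_contractionAverage ρ hR ENNReal.ofReal_ne_top hρle hD hG'm hG'1 hG'2 hε0 hε1 hε
  refine ⟨fun j => contractionAverage ρ (ε j) u', fun j =>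
    contDiff_contractionAverage he hec he0 (hε0 j).ne' hu'1, ?_, ?_⟩
  · refine t1.congr fun j => eLpNorm_congr_ae (hu'u.mono fun x hx => ?_)
    simp only [hx]
  -- On `D` the derivative is `(1 - ε)` times the average of `G'`, so its error is the error of that
  -- average plus `ε` times a quantity bounded uniformly in `j`.
  · have hb : ∀ j, eLpNorm (fun x => fderiv ℝ (contractionAverage ρ (ε j) u') x - G x) 2
        (volume.restrict D) ≤
        eLpNorm (fun x => contractionAverage ρ (ε j) G' x - G' x) 2 (volume.restrict D) +
          ENNReal.ofReal (ε j) * (2 * eLpNorm G' 2 volume) := fun j => by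
      have hm : StronglyMeasurable (contractionAverage ρ (ε j) G') := by
        refine StronglyMeasurable.integral_prod_right
          (f := fun x y => G' ((1 - ε j) • x + ε j • y)) ?_
        exact hG'm.comp_measurable (g := fun p : Plane × Plane => (1 - ε j) • p.1 + ε j • p.2)
          (by fun_prop)
      have hcongr : (fun x => fderiv ℝ (contractionAverage ρ (ε j) u') x - G x) =ᵐ[volume.restrict D]
          ((fun x => contractionAverage ρ (ε j) G' x - G' x) +
            (-ε j) • contractionAverage ρ (ε j) G') := by
        filter_upwards [hG'G, ae_restrict_mem hD.isClosed.measurableSet] with x hx hxD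
        rw [fderiv_contractionAverage hD hr hstar he hec he0 hes (hε0 j)
          ((hε1 j).trans (by norm_num)) hu'1 hG'1 hu'0 hG'0 hw hxD, ← hx]
        simp only [Pi.add_apply, Pi.smul_apply]
        module
      rw [eLpNorm_congr_ae hcongr]
      refine (eLpNorm_add_le (hm.sub hG'm).aestronglyMeasurable
        (hm.const_smul _).aestronglyMeasurable one_le_two).trans (add_le_add le_rfl ?_)
      have hsm := eLpNorm_const_smul (-ε j) (contractionAverage ρ (ε j) G') 2 (volume.restrict D)
      rw [hsm, enorm_neg, Real.enorm_of_nonneg (hε0 j).le]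
      gcongr
      exact (eLpNorm_restrict_le _ _ _ _).trans (eLpNorm_contractionAverage_le ρ (hε1 j) hG'm)
    refine tendsto_of_tendsto_of_tendsto_of_le_of_le tendsto_const_nhds ?_ (fun _ => zero_le) hb
    have h3 : Tendsto (fun j => ENNReal.ofReal (ε j)) atTop (𝓝 0) := by
      simpa using ENNReal.tendsto_ofReal hε
    have h4 := ENNReal.Tendsto.mul_const (b := 2 * eLpNorm G' 2 volume) h3
      (Or.inr (ENNReal.mul_ne_top (by simp) hG'2.2.ne))
    simpa using t2.add h4

end

/-! ### Weak derivatives -/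

lemma IsTestFunction.mono {F : Type*} [NormedAddCommGroup F] [NormedSpace ℝ F] {D D' : Set Plane}
    (h : D ⊆ D') {φ : Plane → F} (hφ : IsTestFunction D φ) : IsTestFunction D' φ :=
  ⟨hφ.1, hφ.2.1, hφ.2.2.trans (interior_mono h)⟩

lemma IsTestFunction.eq_zero {F : Type*} [NormedAddCommGroup F] [NormedSpace ℝ F] {D : Set Plane}
    {φ : Plane → F} (hφ : IsTestFunction D φ) {x : Plane} (hx : x ∉ D) : φ x = 0 :=
  image_eq_zero_of_notMem_tsupport fun h => hx (interior_subset (hφ.2.2 h))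

lemma IsTestFunction.fderiv_eq_zero {F : Type*} [NormedAddCommGroup F] [NormedSpace ℝ F]
    {D : Set Plane} {φ : Plane → F} (hφ : IsTestFunction D φ) {x : Plane} (hx : x ∉ D) :
    fderiv ℝ φ x = 0 :=
  image_eq_zero_of_notMem_tsupport fun h =>
    hx (interior_subset (hφ.2.2 (tsupport_fderiv_subset ℝ h)))

lemma setIntegral_smul_testFunction {E : Type*} [NormedAddCommGroup E] [NormedSpace ℝ E]
    {D : Set Plane} {φ : Plane → ℝ} (hφ : IsTestFunction D φ) (f : Plane → E) :
    ∫ x in D, φ x • f x = ∫ x, φ x • f x :=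
  setIntegral_eq_integral_of_forall_compl_eq_zero fun x hx => by rw [hφ.eq_zero hx, zero_smul]

lemma setIntegral_fderiv_smul_testFunction {E : Type*} [NormedAddCommGroup E] [NormedSpace ℝ E]
    {D : Set Plane} {φ : Plane → ℝ} (hφ : IsTestFunction D φ) (f : Plane → E) (y : Plane) :
    ∫ x in D, fderiv ℝ φ x y • f x = ∫ x, fderiv ℝ φ x y • f x :=
  setIntegral_eq_integral_of_forall_compl_eq_zero fun x hx => by
    rw [hφ.fderiv_eq_zero hx, _root_.zero_apply, zero_smul]

/-- A test function on the smaller set is one on the larger set, and all integrals equal integrals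
over the plane. -/
lemma HasWeakDeriv.mono {D D' : Set Plane} (h : D ⊆ D') {u : Plane → Plane}
    {G : Plane → Plane →L[ℝ] Plane} (hu : HasWeakDeriv D' u G) : HasWeakDeriv D u G := by
  intro φ hφ y
  have := hu φ (hφ.mono h) y
  rwa [setIntegral_smul_testFunction (hφ.mono h) fun x => G x y,
    setIntegral_fderiv_smul_testFunction (hφ.mono h), ← setIntegral_smul_testFunction hφ,
    ← setIntegral_fderiv_smul_testFunction hφ] at this

lemma MemH1With.mono {D D' : Set Plane} (h : D ⊆ D') {u : Plane → Plane}
    {G : Plane → Plane →L[ℝ] Plane} (hu : MemH1With D' u G) : MemH1With D u G :=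
  ⟨hu.1.mono_measure (Measure.restrict_mono h le_rfl),
    hu.2.1.mono_measure (Measure.restrict_mono h le_rfl), hu.2.2.mono h⟩

lemma integrable_of_memLp_two {E : Type*} [NormedAddCommGroup E] {D : Set Plane} (hD : IsCompact D)
    {f : Plane → E} (hf : MemLp f 2 (volume.restrict D)) : IntegrableOn f D := by
  have hfin : IsFiniteMeasure (volume.restrict D) := ⟨by simpa using hD.measure_lt_top⟩
  exact hf.integrable one_le_two

lemma IntegrableOn.continuous_smul {E : Type*} [NormedAddCommGroup E] [NormedSpace ℝ E]
    {D : Set Plane} (hD : IsCompact D) {f : Plane → E} (hf : IntegrableOn f D) {φ : Plane → ℝ}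
    (hφ : Continuous φ) : IntegrableOn (fun x => φ x • f x) D := by
  obtain ⟨C, hC⟩ := hD.exists_bound_of_continuousOn hφ.continuousOn
  exact Integrable.bdd_smul (C := C) hf hφ.aestronglyMeasurable
    ((ae_restrict_iff' hD.isClosed.measurableSet).2 (Eventually.of_forall hC))

lemma continuous_fderiv_testFunction {F : Type*} [NormedAddCommGroup F] [NormedSpace ℝ F]
    {D : Set Plane} {φ : Plane → F} (hφ : IsTestFunction D φ) : Continuous (fderiv ℝ φ) :=
  hφ.1.continuous_fderiv (by simp)

lemma HasWeakDeriv.sub {D : Set Plane} (hD : IsCompact D) {u u' : Plane → Plane}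
    {G G' : Plane → Plane →L[ℝ] Plane} (h : MemH1With D u G) (h' : MemH1With D u' G') :
    HasWeakDeriv D (fun x => u x - u' x) (fun x => G x - G' x) := by
  intro φ hφ y
  have hc : Continuous fun x => fderiv ℝ φ x y :=
    (continuous_fderiv_testFunction hφ).clm_apply continuous_const
  have iu := integrable_of_memLp_two hD h.1
  have iu' := integrable_of_memLp_two hD h'.1
  have iG := (integrable_of_memLp_two hD h.2.1).apply_continuousLinearMap y
  have iG' := (integrable_of_memLp_two hD h'.2.1).apply_continuousLinearMap y
  simp only [smul_sub, _root_.sub_apply]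
  rw [integral_sub (IntegrableOn.continuous_smul hD iu hc) (IntegrableOn.continuous_smul hD iu' hc),
    integral_sub (IntegrableOn.continuous_smul hD iG hφ.1.continuous)
      (IntegrableOn.continuous_smul hD iG' hφ.1.continuous), h.2.2 φ hφ y, h'.2.2 φ hφ y]
  abel

lemma MemH1With.sub {D : Set Plane} (hD : IsCompact D) {u u' : Plane → Plane}
    {G G' : Plane → Plane →L[ℝ] Plane} (h : MemH1With D u G) (h' : MemH1With D u' G') :
    MemH1With D (fun x => u x - u' x) (fun x => G x - G' x) :=
  ⟨h.1.sub h'.1, h.2.1.sub h'.2.1, HasWeakDeriv.sub hD h h'⟩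

lemma memH1With_of_contDiff {D : Set Plane} (hD : IsCompact D) {u : Plane → Plane}
    (hu : ContDiff ℝ 1 u) : MemH1With D u (fderiv ℝ u) := by
  have hcd := hu.continuous_fderiv one_ne_zero
  refine ⟨memLp_of_continuous_isCompact hu.continuous hD 2,
    memLp_of_continuous_isCompact hcd hD 2, fun φ hφ y => ?_⟩
  rw [setIntegral_smul_testFunction hφ fun x => fderiv ℝ u x y,
    setIntegral_fderiv_smul_testFunction hφ]
  have hφd : Continuous fun x => fderiv ℝ φ x y :=
    (continuous_fderiv_testFunction hφ).clm_apply continuous_const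
  have hs : HasCompactSupport fun x => fderiv ℝ φ x y :=
    (hφ.2.1.fderiv (𝕜 := ℝ)).comp_left (g := fun L : Plane →L[ℝ] ℝ => L y) (by simp)
  rw [integral_smul_fderiv_eq_neg_fderiv_smul_of_integrable, neg_neg]
  · exact (hφd.smul hu.continuous).integrable_of_hasCompactSupport hs.smul_right
  · exact (hφ.1.continuous.smul (hcd.clm_apply continuous_const)).integrable_of_hasCompactSupport
      hφ.2.1.smul_right
  · exact (hφ.1.continuous.smul hu.continuous).integrable_of_hasCompactSupport hφ.2.1.smul_right
  · exact fun x _ => hφ.1.differentiable (by simp) x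
  · exact fun x _ => hu.differentiable one_ne_zero x

/-- The fundamental lemma of the calculus of variations only speaks about the interior; the
remaining boundary points form a null set by assumption. -/
lemma ae_eq_zero_of_testFunctions {E : Type*} [NormedAddCommGroup E] [NormedSpace ℝ E]
    [CompleteSpace E] {D : Set Plane} (hD : volume (D \ interior D) = 0) (hDm : MeasurableSet D)
    {f : Plane → E} (hf : IntegrableOn f D)
    (h : ∀ φ : Plane → ℝ, IsTestFunction D φ → ∫ x in D, φ x • f x = 0) :
    ∀ᵐ x ∂(volume.restrict D), f x = 0 := by
  have h1 := isOpen_interior.ae_eq_zero_of_integral_contDiff_smul_eq_zero (μ := volume)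
    (hf.mono_set interior_subset).locallyIntegrableOn (fun φ h1 h2 h3 => by
      rw [← setIntegral_smul_testFunction ⟨h1, h2, h3⟩]
      exact h φ ⟨h1, h2, h3⟩)
  rw [ae_restrict_iff' hDm]
  have h2 : ∀ᵐ x, x ∉ D \ interior D := measure_eq_zero_iff_ae_notMem.1 hD
  filter_upwards [h1, h2] with x hx1 hx2 hxD
  exact hx1 (by_contra fun hxi => hx2 ⟨hxD, hxi⟩)

lemma plane_eq_sum (x : Plane) :
    x = x 0 • EuclideanSpace.single 0 1 + x 1 • EuclideanSpace.single 1 1 := by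
  ext i; fin_cases i <;> simp

lemma clm_eq_of_basis {A B : Plane →L[ℝ] Plane}
    (h : ∀ i, A (EuclideanSpace.single i 1) = B (EuclideanSpace.single i 1)) : A = B := by
  ext1 x
  rw [plane_eq_sum x]
  simp only [map_add, map_smul, h]

lemma weakDeriv_unique {D : Set Plane} (hD : volume (D \ interior D) = 0) (hDc : IsCompact D)
    {u : Plane → Plane} {G G' : Plane → Plane →L[ℝ] Plane} (h : MemH1With D u G)
    (h' : MemH1With D u G') : ∀ᵐ x ∂(volume.restrict D), G x = G' x := by
  have hs := HasWeakDeriv.sub hDc h h'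
  have key : ∀ y : Plane, ∀ᵐ x ∂(volume.restrict D), G x y - G' x y = 0 := fun y => by
    refine ae_eq_zero_of_testFunctions hD hDc.isClosed.measurableSet ?_ fun φ hφ => ?_
    · exact ((integrable_of_memLp_two hDc h.2.1).apply_continuousLinearMap y).sub
        ((integrable_of_memLp_two hDc h'.2.1).apply_continuousLinearMap y)
    · have := hs φ hφ y
      simp only [sub_self, smul_zero, integral_zero, _root_.sub_apply] at this
      exact neg_eq_zero.1 this.symm
  filter_upwards [ae_all_iff.2 fun i : Fin 2 => key (EuclideanSpace.single i 1)] with x hx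
  exact clm_eq_of_basis fun i => sub_eq_zero.1 (hx i)

lemma weakDiv_unique {D : Set Plane} (hD : volume (D \ interior D) = 0) (hDc : IsCompact D)
    {u : Plane → Plane} {d d' : Plane → ℝ} (h : MemHDivWith D u d)
    (h' : MemHDivWith D u d') : ∀ᵐ x ∂(volume.restrict D), d x = d' x := by
  have i := integrable_of_memLp_two hDc h.2.1
  have i' := integrable_of_memLp_two hDc h'.2.1
  refine (ae_eq_zero_of_testFunctions hD hDc.isClosed.measurableSet (f := fun x => d x - d' x)
    (i.sub i') fun φ hφ => ?_).mono fun x hx => sub_eq_zero.1 hx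
  have e := h.2.2 φ hφ
  rw [h'.2.2 φ hφ, neg_inj] at e
  simp only [smul_sub]
  rw [integral_sub (IntegrableOn.continuous_smul hDc i hφ.1.continuous)
    (IntegrableOn.continuous_smul hDc i' hφ.1.continuous)]
  simp only [smul_eq_mul, e, sub_self]

/-! ### The trace of a Jacobian and weak divergences -/

/-- The trace of a Jacobian. -/
def jacTrace : (Plane →L[ℝ] Plane) →L[ℝ] ℝ :=
  ∑ i : Fin 2, (EuclideanSpace.proj i : Plane →L[ℝ] ℝ).comp
    (ContinuousLinearMap.apply ℝ Plane (EuclideanSpace.single i 1))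

lemma jacTrace_apply (A : Plane →L[ℝ] Plane) :
    jacTrace A = ∑ i : Fin 2, (A (EuclideanSpace.single i 1)) i := by
  simp [jacTrace]

lemma divergence_eq_jacTrace (ψ : Plane → Plane) (x : Plane) :
    divergence ψ x = jacTrace (fderiv ℝ ψ x) := (jacTrace_apply _).symm

/-- The `i`-th component of the weak derivative identity in direction `eᵢ`, summed over `i`. -/
lemma MemH1With.memHDivWith {D : Set Plane} (hD : IsCompact D) {u : Plane → Plane}
    {G : Plane → Plane →L[ℝ] Plane} (h : MemH1With D u G) :
    MemHDivWith D u fun x => jacTrace (G x) := by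
  refine ⟨h.1, jacTrace.comp_memLp' h.2.1, fun φ hφ => ?_⟩
  have iu := integrable_of_memLp_two hD h.1
  have iG := integrable_of_memLp_two hD h.2.1
  have key : ∀ i : Fin 2, ∫ x in D, fderiv ℝ φ x (EuclideanSpace.single i 1) * (u x) i =
      - ∫ x in D, φ x * (G x (EuclideanSpace.single i 1)) i := fun i => by
    have h1 := congrArg (fun z : Plane => z i) (h.2.2 φ hφ (EuclideanSpace.single i 1))
    have hc : Continuous fun x => fderiv ℝ φ x (EuclideanSpace.single i 1) :=
      (continuous_fderiv_testFunction hφ).clm_apply continuous_const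
    have h2 := (EuclideanSpace.proj i : Plane →L[ℝ] ℝ).integral_comp_comm
      (IntegrableOn.continuous_smul hD iu hc)
    have h3 := (EuclideanSpace.proj i : Plane →L[ℝ] ℝ).integral_comp_comm
      (IntegrableOn.continuous_smul hD (iG.apply_continuousLinearMap (EuclideanSpace.single i 1))
        hφ.1.continuous)
    simp only [PiLp.proj_apply, PiLp.smul_apply, smul_eq_mul, PiLp.neg_apply] at h1 h2 h3
    rw [h2, h1, h3]
  have hcomp : ∀ i : Fin 2, IntegrableOn
      (fun x => fderiv ℝ φ x (EuclideanSpace.single i 1) * (u x) i) D := fun i =>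
    IntegrableOn.continuous_smul hD ((EuclideanSpace.proj i : Plane →L[ℝ] ℝ).integrable_comp iu)
      ((continuous_fderiv_testFunction hφ).clm_apply continuous_const)
  have hcomp' : ∀ i : Fin 2, IntegrableOn
      (fun x => φ x * (G x (EuclideanSpace.single i 1)) i) D := fun i =>
    IntegrableOn.continuous_smul hD ((EuclideanSpace.proj i : Plane →L[ℝ] ℝ).integrable_comp
      (iG.apply_continuousLinearMap (EuclideanSpace.single i 1))) hφ.1.continuous
  have e1 : ∀ x, fderiv ℝ φ x (u x) = fderiv ℝ φ x (EuclideanSpace.single 0 1) * (u x) 0 +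
      fderiv ℝ φ x (EuclideanSpace.single 1 1) * (u x) 1 := fun x => by
    conv_lhs => rw [plane_eq_sum (u x)]
    rw [map_add, map_smul, map_smul, smul_eq_mul, smul_eq_mul]
    ring
  simp only [e1, jacTrace_apply, Fin.sum_univ_two, mul_add]
  rw [integral_add (hcomp 0) (hcomp 1), integral_add (hcomp' 0) (hcomp' 1), key, key]
  ring

lemma MemHDivWith.sub {D : Set Plane} (hD : IsCompact D) {u u' : Plane → Plane}
    {d d' : Plane → ℝ} (h : MemHDivWith D u d) (h' : MemHDivWith D u' d') :
    MemHDivWith D (fun x => u x - u' x) (fun x => d x - d' x) := by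
  refine ⟨h.1.sub h'.1, h.2.1.sub h'.2.1, fun φ hφ => ?_⟩
  have hc := continuous_fderiv_testFunction hφ
  have key : ∀ f : Plane → Plane, IntegrableOn f D → IntegrableOn (fun x => fderiv ℝ φ x (f x)) D := by
    intro f hf
    obtain ⟨C, hC⟩ := hD.exists_bound_of_continuousOn hc.continuousOn
    refine Integrable.mono' (g := fun x => C * ‖f x‖) (hf.norm.const_mul C) ?_ ?_
    · exact (ContinuousLinearMap.apply ℝ ℝ).aestronglyMeasurable_comp₂ hf.aestronglyMeasurable
        hc.aestronglyMeasurable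
    · filter_upwards [ae_restrict_mem hD.isClosed.measurableSet] with x hx
      exact (ContinuousLinearMap.le_opNorm _ _).trans
        (mul_le_mul_of_nonneg_right (hC x hx) (norm_nonneg _))
  have iu := key _ (integrable_of_memLp_two hD h.1)
  have iu' := key _ (integrable_of_memLp_two hD h'.1)
  have id := IntegrableOn.continuous_smul hD (integrable_of_memLp_two hD h.2.1) hφ.1.continuous
  have id' := IntegrableOn.continuous_smul hD (integrable_of_memLp_two hD h'.2.1) hφ.1.continuous
  simp only [map_sub, mul_sub]
  simp only [smul_eq_mul] at id id'
  rw [integral_sub iu iu', integral_sub id id', h.2.2 φ hφ, h'.2.2 φ hφ]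
  ring

lemma MemHDivWith.congr {D : Set Plane} {u u' : Plane → Plane} {d d' : Plane → ℝ}
    (h : MemHDivWith D u d) (hu : ∀ᵐ x ∂(volume.restrict D), u' x = u x)
    (hd : ∀ᵐ x ∂(volume.restrict D), d' x = d x) : MemHDivWith D u' d' := by
  refine ⟨(memLp_congr_ae hu).2 h.1, (memLp_congr_ae hd).2 h.2.1, fun φ hφ => ?_⟩
  have e1 : ∫ x in D, fderiv ℝ φ x (u' x) = ∫ x in D, fderiv ℝ φ x (u x) :=
    integral_congr_ae (hu.mono fun x hx => by simp only [hx])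
  have e2 : ∫ x in D, φ x * d' x = ∫ x in D, φ x * d x :=
    integral_congr_ae (hd.mono fun x hx => by simp only [hx])
  rw [e1, e2]
  exact h.2.2 φ hφ

/-! ### Traces -/

/-- `φ` is a sequence of smooth fields that converges in `H¹(D; ℝ²)` to a field with
Jacobian `G`. -/
structure SmoothApprox (D : Set Plane) (u : Plane → Plane) (G : Plane → Plane →L[ℝ] Plane)
    (φ : ℕ → Plane → Plane) : Prop where
  contDiff : ∀ j, ContDiff ℝ ∞ (φ j)
  tendsto : Tendsto (fun j => eLpNorm (fun x => φ j x - u x) 2 (volume.restrict D)) atTop (𝓝 0)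
  tendsto_fderiv : Tendsto (fun j => eLpNorm (fun x => fderiv ℝ (φ j) x - G x) 2
    (volume.restrict D)) atTop (𝓝 0)

lemma SmoothApprox.mono {D D' : Set Plane} (h : D ⊆ D') {u : Plane → Plane}
    {G : Plane → Plane →L[ℝ] Plane} {φ : ℕ → Plane → Plane} (hφ : SmoothApprox D' u G φ) :
    SmoothApprox D u G φ where
  contDiff := hφ.contDiff
  tendsto := tendsto_of_tendsto_of_tendsto_of_le_of_le tendsto_const_nhds hφ.tendsto
    (fun _ => zero_le) fun _ => eLpNorm_mono_measure _ (Measure.restrict_mono h le_rfl)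
  tendsto_fderiv := tendsto_of_tendsto_of_tendsto_of_le_of_le tendsto_const_nhds hφ.tendsto_fderiv
    (fun _ => zero_le) fun _ => eLpNorm_mono_measure _ (Measure.restrict_mono h le_rfl)

lemma tendsto_eLpNorm_sub_sub {ι α E : Type*} [MeasurableSpace α] [NormedAddCommGroup E]
    {l : Filter ι} {μ : Measure α} {f g : ι → α → E} {F F' : α → E}
    (hf : ∀ i, AEStronglyMeasurable (f i) μ) (hg : ∀ i, AEStronglyMeasurable (g i) μ)
    (hF : AEStronglyMeasurable F μ) (hF' : AEStronglyMeasurable F' μ)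
    (h1 : Tendsto (fun i => eLpNorm (fun x => f i x - F x) 2 μ) l (𝓝 0))
    (h2 : Tendsto (fun i => eLpNorm (fun x => g i x - F' x) 2 μ) l (𝓝 0)) :
    Tendsto (fun i => eLpNorm (fun x => (f i x - g i x) - (F x - F' x)) 2 μ) l (𝓝 0) := by
  have h3 := h1.add h2
  rw [add_zero] at h3
  refine tendsto_of_tendsto_of_tendsto_of_le_of_le tendsto_const_nhds h3 (fun _ => zero_le)
    fun i => ?_
  have : (fun x => (f i x - g i x) - (F x - F' x)) =
      (fun x => f i x - F x) - fun x => g i x - F' x := by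
    ext1 x; simp only [Pi.sub_apply]; abel
  simp only [this]
  exact eLpNorm_sub_le ((hf i).sub hF) ((hg i).sub hF') one_le_two

lemma SmoothApprox.sub {D : Set Plane} {u u' : Plane → Plane}
    {G G' : Plane → Plane →L[ℝ] Plane} {φ φ' : ℕ → Plane → Plane} (h : SmoothApprox D u G φ)
    (h' : SmoothApprox D u' G' φ') (hu : MemH1With D u G) (hu' : MemH1With D u' G') :
    SmoothApprox D (fun x => u x - u' x) (fun x => G x - G' x) (fun j x => φ j x - φ' j x) where
  contDiff j := (h.contDiff j).sub (h'.contDiff j)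
  tendsto := tendsto_eLpNorm_sub_sub (fun j => (h.contDiff j).continuous.aestronglyMeasurable)
    (fun j => (h'.contDiff j).continuous.aestronglyMeasurable) hu.1.1 hu'.1.1 h.tendsto h'.tendsto
  tendsto_fderiv := by
    have := tendsto_eLpNorm_sub_sub
      (fun j => ((h.contDiff j).continuous_fderiv (by simp)).aestronglyMeasurable)
      (fun j => ((h'.contDiff j).continuous_fderiv (by simp)).aestronglyMeasurable)
      hu.2.1.1 hu'.2.1.1 h.tendsto_fderiv h'.tendsto_fderiv
    refine this.congr fun j => eLpNorm_congr_ae (Eventually.of_forall fun x => ?_)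
    have h1 := (h.contDiff j).differentiable (by simp) x
    have h2 := (h'.contDiff j).differentiable (by simp) x
    simp only
    rw [fderiv_fun_sub h1 h2]

lemma eLpNorm_sub_self {α E : Type*} [MeasurableSpace α] [NormedAddCommGroup E] (f : α → E)
    (μ : Measure α) : eLpNorm (fun x => f x - f x) 2 μ = 0 := by
  simp

lemma smoothApprox_const {D : Set Plane} {u : Plane → Plane} (hu : ContDiff ℝ ∞ u) :
    SmoothApprox D u (fderiv ℝ u) fun _ => u where
  contDiff _ := hu
  tendsto := by simp
  tendsto_fderiv := by
    simp only [eLpNorm_sub_self]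
    exact tendsto_const_nhds

lemma SmoothApprox.congr {D : Set Plane} {u u' : Plane → Plane}
    {G G' : Plane → Plane →L[ℝ] Plane} {φ : ℕ → Plane → Plane} (h : SmoothApprox D u G φ)
    (hu : ∀ᵐ x ∂(volume.restrict D), u' x = u x) (hG : ∀ᵐ x ∂(volume.restrict D), G' x = G x) :
    SmoothApprox D u' G' φ where
  contDiff := h.contDiff
  tendsto := h.tendsto.congr fun j => eLpNorm_congr_ae (hu.mono fun x hx => by simp only [hx])
  tendsto_fderiv := h.tendsto_fderiv.congr fun j =>
    eLpNorm_congr_ae (hG.mono fun x hx => by simp only [hx])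

lemma volume_triangle_diff_interior (a b c : Plane) :
    volume (convexHull ℝ {a, b, c} \ interior (convexHull ℝ {a, b, c})) = 0 := by
  have h := (convex_convexHull ℝ ({a, b, c} : Set Plane)).addHaar_frontier volume
  rwa [(isCompact_triangle a b c).isClosed.frontier_eq] at h

/-- On an edge of a triangle, two smooth approximations of the same field have the same limit. -/
lemma SmoothApprox.tendsto_edge_sub {a b c : Plane} (hc : cross (b - a) (c - a) ≠ 0)
    {u : Plane → Plane} {G : Plane → Plane →L[ℝ] Plane} {φ ψ : ℕ → Plane → Plane}
    (hu : MemH1With (convexHull ℝ {a, b, c}) u G)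
    (hφ : SmoothApprox (convexHull ℝ {a, b, c}) u G φ)
    (hψ : SmoothApprox (convexHull ℝ {a, b, c}) u G ψ) :
    Tendsto (fun j => eLpNorm (fun x => φ j x - ψ j x) 2 (segMeasure a b)) atTop (𝓝 0) := by
  obtain ⟨C, hC, hle⟩ := eLpNorm_trace_le hc
  have hs := hφ.sub hψ hu hu
  have h1 := hs.tendsto
  have h2 := hs.tendsto_fderiv
  simp only [sub_self, sub_zero] at h1 h2
  have h3 := ENNReal.Tendsto.const_mul (a := C) (h1.add h2) (Or.inr hC)
  rw [add_zero, mul_zero] at h3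
  exact tendsto_of_tendsto_of_tendsto_of_le_of_le tendsto_const_nhds h3 (fun _ => zero_le)
    fun j => hle _ ((hs.contDiff j).of_le (by simp))

/-- The edge `[a, b]` belongs to a nondegenerate triangle contained in `D`. -/
def IsInnerEdge (D : Set Plane) (a b : Plane) : Prop :=
  ∃ c, cross (b - a) (c - a) ≠ 0 ∧ convexHull ℝ {a, b, c} ⊆ D

/-- Convergence in `H¹` and the trace inequality make the smooth fields a Cauchy sequence on the
edges. -/
lemma exists_trace {D : Set Plane} {u : Plane → Plane}
    {G : Plane → Plane →L[ℝ] Plane} {φ : ℕ → Plane → Plane} (hu : MemH1With D u G)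
    (hφ : SmoothApprox D u G φ) (E : Finset (Plane × Plane)) (hE : ∀ e ∈ E, IsInnerEdge D e.1 e.2) :
    ∃ g : Plane → Plane, ∀ e ∈ E, MemLp g 2 (segMeasure e.1 e.2) ∧
      Tendsto (fun j => eLpNorm (fun x => φ j x - g x) 2 (segMeasure e.1 e.2)) atTop (𝓝 0) := by
  classical
  -- Taking the limit in `L²` of the sum of all edge measures yields one function that is the limit
  -- on every edge, without patching limits at common vertices.
  set μ : Measure Plane := ∑ e ∈ E, segMeasure e.1 e.2 with hμ
  have hle : ∀ e ∈ E, segMeasure e.1 e.2 ≤ μ := fun e he =>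
    Finset.single_le_sum (f := fun e : Plane × Plane => segMeasure e.1 e.2)
      (fun _ _ => Measure.zero_le _) he
  have hbound : ∃ C : ENNReal, C ≠ ⊤ ∧ ∀ f : Plane → Plane, ContDiff ℝ 1 f →
      eLpNorm f 2 μ ^ 2 ≤ C * (eLpNorm f 2 (volume.restrict D) +
        eLpNorm (fderiv ℝ f) 2 (volume.restrict D)) ^ 2 := by
    have h1 : ∀ e : Plane × Plane, ∃ C : ENNReal, C ≠ ⊤ ∧ (e ∈ E → ∀ f : Plane → Plane,
        ContDiff ℝ 1 f → eLpNorm f 2 (segMeasure e.1 e.2) ≤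
          C * (eLpNorm f 2 (volume.restrict D) + eLpNorm (fderiv ℝ f) 2 (volume.restrict D))) := by
      intro e
      by_cases he : e ∈ E
      · obtain ⟨c, hc, hsub⟩ := hE e he
        obtain ⟨C, hC, h⟩ := eLpNorm_trace_le hc
        refine ⟨C, hC, fun _ f hf => (h f hf).trans ?_⟩
        gcongr
      · exact ⟨0, by simp, fun h => absurd h he⟩
    choose C hC h using h1
    refine ⟨∑ e ∈ E, C e ^ 2, ENNReal.sum_ne_top.2 fun e _ => ENNReal.pow_ne_top (hC e),
      fun f hf => ?_⟩
    rw [eLpNorm_two_sq, hμ, lintegral_finsetSum_measure, Finset.sum_mul]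
    refine Finset.sum_le_sum fun e he => ?_
    rw [← eLpNorm_two_sq, ← mul_pow]
    exact pow_le_pow_left' (h e he f hf) 2
  obtain ⟨C, hC, hb⟩ := hbound
  have hmem : ∀ j, MemLp (φ j) 2 μ := fun j => by
    refine ⟨(hφ.contDiff j).continuous.aestronglyMeasurable, ?_⟩
    refine ((ENNReal.pow_lt_top_iff (n := 2)).1 ?_).resolve_right two_ne_zero
    rw [eLpNorm_two_sq, hμ, lintegral_finsetSum_measure]
    refine ENNReal.sum_lt_top.2 fun e _ => ?_
    rw [← eLpNorm_two_sq]
    exact ENNReal.pow_lt_top (memLp_segMeasure_of_continuous (hφ.contDiff j).continuous _ _ _).2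
  have hcauchy : CauchySeq fun j => (hmem j).toLp (φ j) := by
    rw [Lp.cauchySeq_Lp_iff_cauchySeq_eLpNorm]
    have h1 : Tendsto (fun p : ℕ × ℕ => eLpNorm (fun x => (φ p.1 x - φ p.2 x) - (u x - u x)) 2
        (volume.restrict D)) atTop (𝓝 0) := by
      rw [← prod_atTop_atTop_eq]
      exact tendsto_eLpNorm_sub_sub
        (fun p => (hφ.contDiff p.1).continuous.aestronglyMeasurable)
        (fun p => (hφ.contDiff p.2).continuous.aestronglyMeasurable) hu.1.1 hu.1.1
        (hφ.tendsto.comp tendsto_fst) (hφ.tendsto.comp tendsto_snd)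
    have h2 : Tendsto (fun p : ℕ × ℕ => eLpNorm
        (fun x => (fderiv ℝ (φ p.1) x - fderiv ℝ (φ p.2) x) - (G x - G x)) 2
        (volume.restrict D)) atTop (𝓝 0) := by
      rw [← prod_atTop_atTop_eq]
      exact tendsto_eLpNorm_sub_sub
        (fun p => ((hφ.contDiff p.1).continuous_fderiv (by simp)).aestronglyMeasurable)
        (fun p => ((hφ.contDiff p.2).continuous_fderiv (by simp)).aestronglyMeasurable)
        hu.2.1.1 hu.2.1.1
        (hφ.tendsto_fderiv.comp tendsto_fst) (hφ.tendsto_fderiv.comp tendsto_snd)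
    simp only [sub_self, sub_zero] at h1 h2
    -- The bound on the squared norm has constant `C`; `C ≤ (C + 1)²` gives a bound on the norm
    -- itself with constant `C + 1`.
    have h3 := ENNReal.Tendsto.const_mul (a := C + 1) (h1.add h2)
      (Or.inr (ENNReal.add_ne_top.2 ⟨hC, ENNReal.one_ne_top⟩))
    rw [add_zero, mul_zero] at h3
    refine tendsto_of_tendsto_of_tendsto_of_le_of_le tendsto_const_nhds h3 (fun _ => zero_le)
      fun p => ?_
    have hd : ContDiff ℝ 1 fun x => φ p.1 x - φ p.2 x :=
      ((hφ.contDiff p.1).sub (hφ.contDiff p.2)).of_le (by simp)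
    have hfd : fderiv ℝ (fun x => φ p.1 x - φ p.2 x) =
        fun x => fderiv ℝ (φ p.1) x - fderiv ℝ (φ p.2) x := by
      ext1 x
      exact fderiv_fun_sub ((hφ.contDiff p.1).differentiable (by simp) x)
        ((hφ.contDiff p.2).differentiable (by simp) x)
    have he : eLpNorm (((hmem p.1).toLp (φ p.1) : Plane → Plane) -
        ((hmem p.2).toLp (φ p.2) : Plane → Plane)) 2 μ =
        eLpNorm (fun x => φ p.1 x - φ p.2 x) 2 μ :=
      eLpNorm_congr_ae ((hmem p.1).coeFn_toLp.sub (hmem p.2).coeFn_toLp)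
    simp only [he]
    rw [← ENNReal.pow_le_pow_left_iff two_ne_zero, mul_pow]
    refine (hb _ hd).trans ?_
    rw [hfd]
    gcongr
    calc C ≤ C + 1 := le_self_add
      _ = (C + 1) * 1 := (mul_one _).symm
      _ ≤ (C + 1) * (C + 1) := by gcongr; exact le_add_self
      _ = (C + 1) ^ 2 := (sq _).symm
  obtain ⟨g, hg⟩ := cauchySeq_tendsto_of_complete hcauchy
  rw [Lp.tendsto_Lp_iff_tendsto_eLpNorm'] at hg
  refine ⟨g, fun e he => ⟨(Lp.memLp g).mono_measure (hle e he), ?_⟩⟩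
  refine tendsto_of_tendsto_of_tendsto_of_le_of_le tendsto_const_nhds hg (fun _ => zero_le)
    fun j => (eLpNorm_mono_measure _ (hle e he)).trans (le_of_eq ?_)
  exact eLpNorm_congr_ae ((hmem j).coeFn_toLp.symm.sub (ae_eq_refl _))

/-- `HasTrace` brings its own Jacobian and its own approximating sequence. The Jacobians agree
almost everywhere by uniqueness of weak derivatives, and then the trace inequality forces both
sequences to the same limit on the edge. -/
lemma HasTrace.ae_eq {a b c : Plane} (hc : cross (b - a) (c - a) ≠ 0)
    {u g h : Plane → Plane} {G : Plane → Plane →L[ℝ] Plane} {φ : ℕ → Plane → Plane}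
    (hu : MemH1With (convexHull ℝ {a, b, c}) u G)
    (hφ : SmoothApprox (convexHull ℝ {a, b, c}) u G φ)
    (hh : MemLp h 2 (segMeasure a b))
    (hφh : Tendsto (fun j => eLpNorm (fun x => φ j x - h x) 2 (segMeasure a b)) atTop (𝓝 0))
    (hg : HasTrace (convexHull ℝ {a, b, c}) a b u g) : g =ᵐ[segMeasure a b] h := by
  obtain ⟨hg2, G', hG', ψ, hψc, hψ1, hψ2, hψg⟩ := hg
  have hGG := weakDeriv_unique (volume_triangle_diff_interior a b c) (isCompact_triangle a b c) hu hG'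
  have hψ : SmoothApprox (convexHull ℝ {a, b, c}) u G ψ :=
    SmoothApprox.congr ⟨hψc, hψ1, hψ2⟩ (Eventually.of_forall fun _ => rfl) hGG
  have h1 := SmoothApprox.tendsto_edge_sub hc hu hφ hψ
  have h2 := tendsto_eLpNorm_sub_sub
    (fun j => (hφ.contDiff j).continuous.aestronglyMeasurable)
    (fun j => (hψ.contDiff j).continuous.aestronglyMeasurable) hh.1 hg2.1 hφh hψg
  have h3 := tendsto_eLpNorm_sub_sub (F := fun _ => (0 : Plane)) (F' := fun x => h x - g x)
    (fun j => ((hφ.contDiff j).continuous.sub (hψ.contDiff j).continuous).aestronglyMeasurable)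
    (fun j => ((hφ.contDiff j).continuous.sub (hψ.contDiff j).continuous).aestronglyMeasurable)
    aestronglyMeasurable_const (hh.1.sub hg2.1) (by simpa using h1) h2
  simp only [sub_self, zero_sub, neg_neg, tendsto_const_nhds_iff] at h3
  have h4 := (eLpNorm_eq_zero_iff (hh.1.sub hg2.1) two_ne_zero).1 h3
  filter_upwards [h4] with x hx
  exact (sub_eq_zero.1 hx).symm

lemma SmoothApprox.hasTrace {D : Set Plane} {a b : Plane} {u g : Plane → Plane}
    {G : Plane → Plane →L[ℝ] Plane} {φ : ℕ → Plane → Plane} (hφ : SmoothApprox D u G φ)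
    (hu : MemH1With D u G) (hg : MemLp g 2 (segMeasure a b))
    (hφg : Tendsto (fun j => eLpNorm (fun x => φ j x - g x) 2 (segMeasure a b)) atTop (𝓝 0)) :
    HasTrace D a b u g :=
  ⟨hg, G, hu, φ, hφ.contDiff, hφ.tendsto, hφ.tendsto_fderiv, hφg⟩

/-! ### Normal moments -/

/-- The normal moments of `g` on the segment `[a, b]` against polynomials of degree at most `m`
vanish. -/
def VanishingMoments (m : ℕ) (a b : Plane) (g : Plane → Plane) : Prop :=
  ∀ q ∈ polyDeg m, edgeFlux a b (fun x => evalPoly q x • g x) = 0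

/-- For a unit normal `n`, a vector differs from its normal part by a multiple of `b - a`, which the
cross product with `b - a` does not see. The factor `cross n (b - a)` absorbs the choice between the
two normals. -/
lemma integral_inner_segMeasure {a b n : Plane} (hab : a ≠ b) (hn : ‖n‖ = 1)
    (hnb : inner ℝ n (b - a) = 0) {g : Plane → Plane} (hg : AEStronglyMeasurable g (segMeasure a b))
    (q : Poly2) :
    cross n (b - a) * ∫ x, inner ℝ (g x) n * evalPoly q x ∂(segMeasure a b) =
      dist a b * edgeFlux a b (fun x => evalPoly q x • g x) := by
  have hm : AEStronglyMeasurable (fun x => inner ℝ (g x) n * evalPoly q x) (segMeasure a b) :=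
    (hg.inner aestronglyMeasurable_const).mul (continuous_evalPoly q).aestronglyMeasurable
  rw [integral_segMeasure hab hm, smul_eq_mul, edgeFlux, mul_left_comm,
    ← intervalIntegral.integral_const_mul]
  congr 2
  ext t
  rw [cross_smul_left]
  set w := g (AffineMap.lineMap a b t)
  have h1 : n 0 * n 0 + n 1 * n 1 = 1 := by
    have := EuclideanSpace.real_norm_sq_eq n
    rw [hn, Fin.sum_univ_two] at this
    nlinarith
  have h2 : n 0 * (b - a) 0 + n 1 * (b - a) 1 = 0 := by
    have : inner ℝ n (b - a) = (b - a) 0 * n 0 + (b - a) 1 * n 1 := by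
      simp [PiLp.inner_apply, Fin.sum_univ_two]
    linarith
  have h3 : inner ℝ w n = n 0 * w 0 + n 1 * w 1 := by
    simp [PiLp.inner_apply, Fin.sum_univ_two]
  have h4 : cross n (b - a) * inner ℝ w n = cross w (b - a) := by
    rw [h3, cross, cross]
    linear_combination (w 0 * (b - a) 1 - w 1 * (b - a) 0) * h1 -
      (n 1 * w 0 - n 0 * w 1) * h2
  rw [← h4]
  ring

/-- Normal moments with arc length measure and both unit normals are replaced by parameter integrals
without any normalisation, which are easier to compute with. -/
lemma normalMoments_iff {a b : Plane} (hab : a ≠ b) (m : ℕ) {g : Plane → Plane}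
    (hg : AEStronglyMeasurable g (segMeasure a b)) :
    (∀ n : Plane, ‖n‖ = 1 → inner ℝ n (b - a) = 0 →
      ∀ q ∈ polyDeg m, ∫ x, inner ℝ (g x) n * evalPoly q x ∂(segMeasure a b) = 0) ↔
    VanishingMoments m a b g := by
  have hd : dist a b ≠ 0 := dist_ne_zero.2 hab
  constructor
  · intro h q hq
    obtain ⟨n, hn, hnb⟩ : ∃ n : Plane, ‖n‖ = 1 ∧ inner ℝ n (b - a) = 0 := by
      -- The edge vector rotated by a right angle.
      let N : Plane := !₂[(b - a) 1, -(b - a) 0]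
      have hN : N ≠ 0 := fun h0 => hab (by
        have e0 := congrArg (fun z : Plane => z 0) h0
        have e1 := congrArg (fun z : Plane => z 1) h0
        simp [N] at e0 e1
        ext i
        fin_cases i <;> simp <;> linarith)
      refine ⟨‖N‖⁻¹ • N, norm_smul_inv_norm hN, ?_⟩
      rw [inner_smul_left, PiLp.inner_apply, Fin.sum_univ_two]
      simp [N]
      right; ring
    have := integral_inner_segMeasure hab hn hnb hg q
    rw [h n hn hnb q hq, mul_zero] at this
    exact (mul_eq_zero.1 this.symm).resolve_left hd
  · intro h n hn hnb q hq
    have := integral_inner_segMeasure hab hn hnb hg q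
    rw [h q hq, mul_zero] at this
    refine (mul_eq_zero.1 this).resolve_left fun h0 => hab ?_
    have h1 : n 0 * n 0 + n 1 * n 1 = 1 := by
      have := EuclideanSpace.real_norm_sq_eq n
      rw [hn, Fin.sum_univ_two] at this
      nlinarith
    have h2 : n 0 * (b - a) 0 + n 1 * (b - a) 1 = 0 := by
      have : inner ℝ n (b - a) = (b - a) 0 * n 0 + (b - a) 1 * n 1 := by
        simp [PiLp.inner_apply, Fin.sum_univ_two]
      linarith
    rw [cross] at h0
    have e0 : (b - a) 0 = 0 := by
      linear_combination (-(b - a) 0) * h1 + n 0 * h2 - n 1 * h0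
    have e1 : (b - a) 1 = 0 := by
      linear_combination (-(b - a) 1) * h1 + n 1 * h2 + n 0 * h0
    simp only [PiLp.sub_apply] at e0 e1
    ext i
    fin_cases i <;> simp <;> linarith

lemma edgeFlux_congr_ae {a b : Plane} (hab : a ≠ b) {g h : Plane → Plane}
    (hg : AEStronglyMeasurable g (segMeasure a b)) (hgh : g =ᵐ[segMeasure a b] h) :
    edgeFlux a b g = edgeFlux a b h := by
  have key : ∀ f : Plane → Plane, AEStronglyMeasurable f (segMeasure a b) →
      dist a b * edgeFlux a b f = ∫ x, crossL (b - a) (f x) ∂(segMeasure a b) := fun f hf => by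
    rw [integral_segMeasure hab ((crossL (b - a)).continuous.comp_aestronglyMeasurable hf)]
    simp only [crossL_apply, smul_eq_mul, edgeFlux]
  have hd : dist a b ≠ 0 := dist_ne_zero.2 hab
  refine mul_left_cancel₀ hd ?_
  rw [key g hg, key h (hg.congr hgh)]
  exact integral_congr_ae (hgh.mono fun x hx => by simp only [hx])

lemma VanishingMoments.congr_ae {m : ℕ} {a b : Plane} (hab : a ≠ b) {g h : Plane → Plane}
    (hg : AEStronglyMeasurable g (segMeasure a b)) (hgh : g =ᵐ[segMeasure a b] h)
    (hv : VanishingMoments m a b g) : VanishingMoments m a b h := fun q hq => by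
  rw [← hv q hq]
  refine (edgeFlux_congr_ae hab ((continuous_evalPoly q).aestronglyMeasurable.smul hg)
    (hgh.mono fun x hx => ?_)).symm
  simp only [Pi.smul_apply', hx]

/-- Since traces are unique almost everywhere, the existential trace in `NormalMomentsVanish` may be
replaced by any edge limit that is already at hand. -/
lemma normalMomentsVanish_iff {a b c : Plane} (hc : cross (b - a) (c - a) ≠ 0) (m : ℕ)
    {u h : Plane → Plane} {G : Plane → Plane →L[ℝ] Plane} {φ : ℕ → Plane → Plane}
    (hu : MemH1With (convexHull ℝ {a, b, c}) u G)
    (hφ : SmoothApprox (convexHull ℝ {a, b, c}) u G φ)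
    (hh : MemLp h 2 (segMeasure a b))
    (hφh : Tendsto (fun j => eLpNorm (fun x => φ j x - h x) 2 (segMeasure a b)) atTop (𝓝 0)) :
    NormalMomentsVanish m (convexHull ℝ {a, b, c}) a b u ↔ VanishingMoments m a b h := by
  have hab : a ≠ b := by
    rintro rfl
    simp [cross] at hc
  constructor
  · rintro ⟨g, hg, hmom⟩
    exact ((normalMoments_iff hab m hg.1.1).1 hmom).congr_ae hab hg.1.1
      (HasTrace.ae_eq hc hu hφ hh hφh hg)
  · intro hv
    exact ⟨h, hφ.hasTrace hu hh hφh, (normalMoments_iff hab m hh.1).2 hv⟩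

/-! ### Green's formula in `H¹` -/

/-- On a finite measure space `L²` convergence implies `L¹` convergence. The pointwise Lipschitz
bound transfers it from the fields to the integrands derived from them. -/
lemma tendsto_integral_of_eLpNorm {α E : Type*} [MeasurableSpace α] [NormedAddCommGroup E]
    {μ : Measure α} [IsFiniteMeasure μ] {f : ℕ → α → E} {F : α → E}
    (hfF : Tendsto (fun j => eLpNorm (fun x => f j x - F x) 2 μ) atTop (𝓝 0))
    (hm : ∀ j, AEStronglyMeasurable (fun x => f j x - F x) μ)
    {h : ℕ → α → ℝ} {H : α → ℝ} (hh : ∀ j, Integrable (h j) μ) (hH : Integrable H μ) {C : ℝ}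
    (hle : ∀ j, ∀ᵐ x ∂μ, ‖h j x - H x‖ ≤ C * ‖f j x - F x‖) :
    Tendsto (fun j => ∫ x, h j x ∂μ) atTop (𝓝 (∫ x, H x ∂μ)) := by
  refine tendsto_integral_of_L1' _ hH.1 (Eventually.of_forall hh) ?_
  have h1 : Tendsto (fun j => ENNReal.ofReal C * (eLpNorm (fun x => f j x - F x) 2 μ *
      μ univ ^ (1 / (1 : ENNReal).toReal - 1 / (2 : ENNReal).toReal))) atTop (𝓝 0) := by
    have h2 := ENNReal.Tendsto.const_mul (a := ENNReal.ofReal C) (ENNReal.Tendsto.mul_const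
      (b := μ univ ^ (1 / (1 : ENNReal).toReal - 1 / (2 : ENNReal).toReal)) hfF
      (Or.inr (ENNReal.rpow_ne_top_of_nonneg (by norm_num) (measure_ne_top _ _))))
      (Or.inr ENNReal.ofReal_ne_top)
    simpa using h2
  refine tendsto_of_tendsto_of_tendsto_of_le_of_le tendsto_const_nhds h1 (fun _ => zero_le)
    fun j => ?_
  calc eLpNorm (h j - H) 1 μ ≤ ENNReal.ofReal C * eLpNorm (fun x => f j x - F x) 1 μ :=
        eLpNorm_le_mul_eLpNorm_of_ae_le_mul (hle j) 1
    _ ≤ _ := by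
        gcongr
        exact eLpNorm_le_eLpNorm_mul_rpow_measure_univ one_le_two (hm j)

lemma tendsto_edgeFlux {a b : Plane} (hab : a ≠ b) {φ : ℕ → Plane → Plane} {g : Plane → Plane}
    (hφ : ∀ j, Continuous (φ j)) (hg : MemLp g 2 (segMeasure a b))
    (hφg : Tendsto (fun j => eLpNorm (fun x => φ j x - g x) 2 (segMeasure a b)) atTop (𝓝 0))
    {ψ : Plane → ℝ} (hψ : Continuous ψ) :
    Tendsto (fun j => edgeFlux a b (fun x => ψ x • φ j x)) atTop
      (𝓝 (edgeFlux a b (fun x => ψ x • g x))) := by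
  have key : ∀ f : Plane → Plane, AEStronglyMeasurable f (segMeasure a b) →
      edgeFlux a b (fun x => ψ x • f x) =
        (dist a b)⁻¹ * ∫ x, crossL (b - a) (ψ x • f x) ∂(segMeasure a b) := fun f hf => by
    have h1 : AEStronglyMeasurable (fun x => crossL (b - a) (ψ x • f x)) (segMeasure a b) :=
      (crossL (b - a)).continuous.comp_aestronglyMeasurable (hψ.aestronglyMeasurable.smul hf)
    have hd : dist a b ≠ 0 := dist_ne_zero.2 hab
    rw [integral_segMeasure hab h1]
    simp only [crossL_apply, smul_eq_mul, edgeFlux]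
    field_simp
  have hψb : ∃ B, 0 ≤ B ∧ ∀ᵐ x ∂(segMeasure a b), |ψ x| ≤ B := by
    have hc : Continuous (ψ ∘ fun t : ℝ => AffineMap.lineMap (k := ℝ) a b t) :=
      hψ.comp AffineMap.lineMap_continuous
    obtain ⟨B, hB⟩ := (isCompact_Icc (a := (0 : ℝ)) (b := 1)).exists_bound_of_continuousOn
      hc.continuousOn
    refine ⟨|B|, abs_nonneg _, ?_⟩
    unfold segMeasure
    refine Measure.ae_smul_measure ?_ _
    rw [ae_map_iff (measurable_lineMap a b).aemeasurable
      (measurableSet_le (hψ.abs.measurable) measurable_const)]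
    exact (ae_restrict_iff' measurableSet_Icc).2 (Eventually.of_forall fun t ht =>
      (hB t ht).trans (le_abs_self B))
  obtain ⟨B, hB0, hB⟩ := hψb
  have hint : ∀ f : Plane → Plane, MemLp f 2 (segMeasure a b) →
      Integrable (fun x => crossL (b - a) (ψ x • f x)) (segMeasure a b) := fun f hf =>
    (crossL (b - a)).integrable_comp (Integrable.bdd_smul (C := B) (hf.integrable one_le_two)
      hψ.aestronglyMeasurable hB)
  simp only [fun j => key (φ j) (hφ j).aestronglyMeasurable, key g hg.1]
  refine Tendsto.const_mul _ (tendsto_integral_of_eLpNorm hφg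
    (fun j => (hφ j).aestronglyMeasurable.sub hg.1)
    (fun j => hint _ (memLp_segMeasure_of_continuous (hφ j) a b 2)) (hint g hg)
    (C := ‖crossL (b - a)‖ * B) fun j => hB.mono fun x hx => ?_)
  rw [← map_sub, ← smul_sub]
  refine ((crossL (b - a)).le_opNorm _).trans ?_
  rw [norm_smul, mul_assoc]
  gcongr
  exact hx

lemma green_smooth {a b c : Plane} (hc : cross (b - a) (c - a) ≠ 0)
    {u : Plane → Plane} (hu : ContDiff ℝ 1 u) {ψ : Plane → ℝ} (hψ : ContDiff ℝ 1 ψ) :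
    Real.sign (cross (b - a) (c - a)) *
      ∫ x in convexHull ℝ {a, b, c}, (ψ x * jacTrace (fderiv ℝ u x) + fderiv ℝ ψ x (u x)) =
      edgeFlux a b (fun x => ψ x • u x) + edgeFlux b c (fun x => ψ x • u x) +
        edgeFlux c a (fun x => ψ x • u x) := by
  rw [← integral_divergence_triangle (F := fun x => ψ x • u x) hc (hψ.smul hu)]
  congr 2
  ext1 x
  have h : HasFDerivAt (fun x => ψ x • u x) _ x := (hψ.differentiable one_ne_zero x).hasFDerivAt.smul
    (hu.differentiable one_ne_zero x).hasFDerivAt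
  rw [divergence, h.fderiv, jacTrace_apply]
  conv_lhs => rw [plane_eq_sum (u x)]
  simp [Fin.sum_univ_two]
  ring

lemma ne_of_cross_ne_zero {a b c : Plane} (hc : cross (b - a) (c - a) ≠ 0) :
    a ≠ b ∧ b ≠ c ∧ c ≠ a := by
  refine ⟨?_, ?_, ?_⟩
  · rintro rfl; simp [cross] at hc
  · rintro rfl; exact hc (cross_self _)
  · rintro rfl; simp [cross] at hc

/-- Green's formula holds for the smooth approximations, and each term passes to the limit: the
volume terms by convergence in `H¹`, the fluxes by convergence on the edges. -/
lemma green_H1 {a b c : Plane} (hc : cross (b - a) (c - a) ≠ 0)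
    {u g : Plane → Plane} {G : Plane → Plane →L[ℝ] Plane} {φ : ℕ → Plane → Plane}
    (hu : MemH1With (convexHull ℝ {a, b, c}) u G)
    (hφ : SmoothApprox (convexHull ℝ {a, b, c}) u G φ)
    (hab : MemLp g 2 (segMeasure a b)) (hbc : MemLp g 2 (segMeasure b c))
    (hca : MemLp g 2 (segMeasure c a))
    (tab : Tendsto (fun j => eLpNorm (fun x => φ j x - g x) 2 (segMeasure a b)) atTop (𝓝 0))
    (tbc : Tendsto (fun j => eLpNorm (fun x => φ j x - g x) 2 (segMeasure b c)) atTop (𝓝 0))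
    (tca : Tendsto (fun j => eLpNorm (fun x => φ j x - g x) 2 (segMeasure c a)) atTop (𝓝 0))
    {ψ : Plane → ℝ} (hψ : ContDiff ℝ 1 ψ) :
    Real.sign (cross (b - a) (c - a)) *
      ∫ x in convexHull ℝ {a, b, c}, (ψ x * jacTrace (G x) + fderiv ℝ ψ x (u x)) =
      edgeFlux a b (fun x => ψ x • g x) + edgeFlux b c (fun x => ψ x • g x) +
        edgeFlux c a (fun x => ψ x • g x) := by
  obtain ⟨nab, nbc, nca⟩ := ne_of_cross_ne_zero hc
  have hT := isCompact_triangle a b c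
  have hfin : IsFiniteMeasure (volume.restrict (convexHull ℝ {a, b, c})) :=
    ⟨by simpa using hT.measure_lt_top⟩
  have hφc : ∀ j, Continuous (φ j) := fun j => (hφ.contDiff j).continuous
  have hφd : ∀ j, Continuous (fderiv ℝ (φ j)) := fun j =>
    (hφ.contDiff j).continuous_fderiv (by simp)
  have hψd : Continuous (fderiv ℝ ψ) := hψ.continuous_fderiv one_ne_zero
  obtain ⟨B, hB⟩ := hT.exists_bound_of_continuousOn hψ.continuous.continuousOn
  obtain ⟨B', hB'⟩ := hT.exists_bound_of_continuousOn hψd.continuousOn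
  have ha : a ∈ convexHull ℝ {a, b, c} := subset_convexHull ℝ _ (by simp)
  have hB0 : 0 ≤ B := (norm_nonneg _).trans (hB a ha)
  have hmem : ∀ᵐ x ∂(volume.restrict (convexHull ℝ {a, b, c})), x ∈ convexHull ℝ {a, b, c} :=
    ae_restrict_mem hT.isClosed.measurableSet
  have i1 : ∀ A : Plane → Plane →L[ℝ] Plane, MemLp A 2 (volume.restrict (convexHull ℝ {a, b, c})) →
      Integrable (fun x => ψ x * jacTrace (A x)) (volume.restrict (convexHull ℝ {a, b, c})) :=
    fun A hA => IntegrableOn.continuous_smul hT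
      (jacTrace.integrable_comp (hA.integrable one_le_two)) hψ.continuous
  have i2 : ∀ f : Plane → Plane, MemLp f 2 (volume.restrict (convexHull ℝ {a, b, c})) →
      Integrable (fun x => fderiv ℝ ψ x (f x)) (volume.restrict (convexHull ℝ {a, b, c})) := by
    intro f hf
    refine Integrable.mono' (g := fun x => B' * ‖f x‖) ((hf.integrable one_le_two).norm.const_mul _)
      ?_ ?_
    · exact (ContinuousLinearMap.apply ℝ ℝ).aestronglyMeasurable_comp₂ hf.1
        hψd.aestronglyMeasurable
    · filter_upwards [hmem] with x hx
      exact (ContinuousLinearMap.le_opNorm _ _).trans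
        (mul_le_mul_of_nonneg_right (hB' x hx) (norm_nonneg _))
  have t1 : Tendsto (fun j => ∫ x in convexHull ℝ {a, b, c}, ψ x * jacTrace (fderiv ℝ (φ j) x))
      atTop (𝓝 (∫ x in convexHull ℝ {a, b, c}, ψ x * jacTrace (G x))) := by
    refine tendsto_integral_of_eLpNorm hφ.tendsto_fderiv
      (fun j => (hφd j).aestronglyMeasurable.sub hu.2.1.1)
      (fun j => i1 _ (memLp_of_continuous_isCompact (hφd j) hT 2)) (i1 _ hu.2.1)
      (C := B * ‖jacTrace‖) fun j => hmem.mono fun x hx => ?_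
    rw [← mul_sub, ← map_sub, norm_mul, mul_assoc]
    exact mul_le_mul (hB x hx) (jacTrace.le_opNorm _) (norm_nonneg _) hB0
  have t2 : Tendsto (fun j => ∫ x in convexHull ℝ {a, b, c}, fderiv ℝ ψ x (φ j x))
      atTop (𝓝 (∫ x in convexHull ℝ {a, b, c}, fderiv ℝ ψ x (u x))) := by
    refine tendsto_integral_of_eLpNorm hφ.tendsto
      (fun j => (hφc j).aestronglyMeasurable.sub hu.1.1)
      (fun j => i2 _ (memLp_of_continuous_isCompact (hφc j) hT 2)) (i2 _ hu.1)
      (C := B') fun j => hmem.mono fun x hx => ?_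
    rw [← map_sub]
    exact (ContinuousLinearMap.le_opNorm _ _).trans
      (mul_le_mul_of_nonneg_right (hB' x hx) (norm_nonneg _))
  have t3 := ((tendsto_edgeFlux nab hφc hab tab hψ.continuous).add
    (tendsto_edgeFlux nbc hφc hbc tbc hψ.continuous)).add
    (tendsto_edgeFlux nca hφc hca tca hψ.continuous)
  have t4 := (t1.add t2).const_mul (Real.sign (cross (b - a) (c - a)))
  rw [← integral_add (i1 _ hu.2.1) (i2 _ hu.1)] at t4
  refine tendsto_nhds_unique (t4.congr fun j => ?_) t3
  rw [← green_smooth hc ((hφ.contDiff j).of_le (by simp)) hψ,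
    integral_add (i1 _ (memLp_of_continuous_isCompact (hφd j) hT 2))
      (i2 _ (memLp_of_continuous_isCompact (hφc j) hT 2))]

/-! ### Homogeneous polynomials and Raviart–Thomas polynomials -/

lemma eq_zero_of_isHomogeneous {n : ℕ} {s : ℤ} {h : Poly2} (hh : h.IsHomogeneous n)
    (hs : h ∈ polyDeg s) (hsn : s < n) : h = 0 := by
  ext d
  rw [MvPolynomial.coeff_zero]
  by_contra hd
  have h1 := hs d (MvPolynomial.mem_support_iff.2 hd)
  have h2 : d.degree = n := by
    by_contra h3
    exact hd (hh.coeff_eq_zero h3)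
  omega

/-- The exponent of `x₀ʲ x₁ᵐ⁻ʲ`. -/
def homExp (m : ℕ) (j : Fin (m + 1)) : Fin 2 →₀ ℕ :=
  Finsupp.single 0 (j : ℕ) + Finsupp.single 1 (m - j)

lemma homExp_degree (m : ℕ) (j : Fin (m + 1)) : (homExp m j).degree = m := by
  rw [homExp, map_add, Finsupp.degree_single, Finsupp.degree_single]
  omega

lemma homExp_injective (m : ℕ) : Function.Injective (homExp m) := fun i j h => by
  have := DFunLike.congr_fun h 0
  simp [homExp] at this
  exact Fin.ext this

/-- The homogeneous polynomial of degree `m` with given coefficients. -/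
def homPoly (m : ℕ) : (Fin (m + 1) → ℝ) →ₗ[ℝ] Poly2 :=
  ∑ j, (MvPolynomial.monomial (homExp m j)).comp (LinearMap.proj j)

lemma homPoly_apply (m : ℕ) (c : Fin (m + 1) → ℝ) :
    homPoly m c = ∑ j, MvPolynomial.monomial (homExp m j) (c j) := by
  simp [homPoly, LinearMap.sum_apply]

lemma homPoly_isHomogeneous (m : ℕ) (c : Fin (m + 1) → ℝ) : (homPoly m c).IsHomogeneous m := by
  rw [homPoly_apply]
  exact MvPolynomial.IsHomogeneous.sum _ _ _ fun j _ =>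
    MvPolynomial.isHomogeneous_monomial _ (homExp_degree m j)

lemma homPoly_mem (m : ℕ) (c : Fin (m + 1) → ℝ) : homPoly m c ∈ polyDeg m := by
  rw [homPoly_apply]
  exact Submodule.sum_mem _ fun j _ => monomial_mem_polyDeg (by rw [homExp_degree]) _

lemma homPoly_injective (m : ℕ) : Function.Injective (homPoly m) := by
  rw [← LinearMap.ker_eq_bot, LinearMap.ker_eq_bot']
  intro c hc
  ext j
  have := congrArg (MvPolynomial.coeff (homExp m j)) hc
  rw [homPoly_apply, MvPolynomial.coeff_sum, MvPolynomial.coeff_zero] at this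
  simpa [MvPolynomial.coeff_monomial, (homExp_injective m).eq_iff] using this

lemma polyDeg_le_sup (m : ℕ) :
    polyDeg m ≤ polyDeg ((m : ℤ) - 1) ⊔ LinearMap.range (homPoly m) := by
  refine polyDeg_induction fun d hd => ?_
  by_cases h : (d.degree : ℤ) ≤ m - 1
  · exact Submodule.mem_sup_left (monomial_mem_polyDeg h 1)
  · refine Submodule.mem_sup_right ?_
    have hdeg : d 0 + d 1 = m := by
      have : d.degree = d 0 + d 1 := by rw [Finsupp.degree_eq_sum, Fin.sum_univ_two]
      omega
    refine ⟨Pi.single ⟨d 0, by omega⟩ 1, ?_⟩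
    have hd' : homExp m ⟨d 0, by omega⟩ = d := by
      ext i
      fin_cases i
      · simp [homExp]
      · simp [homExp]; omega
    rw [homPoly_apply, Finset.sum_eq_single ⟨d 0, by omega⟩]
    · rw [hd', Pi.single_eq_same]
    · intro j _ hj
      rw [Pi.single_eq_of_ne hj, map_zero]
    · simp

/-- Polynomials of degree `m - 1` and the `m + 1` homogeneous monomials of degree `m` are
independent. Only this inequality enters the comparison of dimensions for the Raviart–Thomas
element. -/
lemma finrank_polyDeg_ge (m : ℕ) :
    Module.finrank ℝ (polyDeg ((m : ℤ) - 1)) + (m + 1) ≤ Module.finrank ℝ (polyDeg (m : ℤ)) := by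
  let f : (polyDeg ((m : ℤ) - 1) × (Fin (m + 1) → ℝ)) →ₗ[ℝ] polyDeg (m : ℤ) :=
    LinearMap.coprod (Submodule.inclusion (polyDeg_mono (by omega)))
      ((homPoly m).codRestrict _ (homPoly_mem m))
  have hf : Function.Injective f := by
    rw [← LinearMap.ker_eq_bot, LinearMap.ker_eq_bot']
    rintro ⟨p, c⟩ h
    have h1 : (p : Poly2) + homPoly m c = 0 := congrArg Subtype.val h
    have h2 : homPoly m c ∈ polyDeg ((m : ℤ) - 1) := by
      rw [← neg_eq_of_add_eq_zero_right h1]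
      exact Submodule.neg_mem _ p.2
    have h3 := eq_zero_of_isHomogeneous (homPoly_isHomogeneous m c) h2 (by omega)
    rw [h3, add_zero] at h1
    exact Prod.ext (Subtype.ext h1) (homPoly_injective m (h3.trans (map_zero _).symm))
  have := LinearMap.finrank_le_finrank_of_injective hf
  rwa [Module.finrank_prod, Module.finrank_fin_fun] at this

/-- The Raviart–Thomas polynomials of order `m`. -/
def rtPoly (m : ℕ) : Submodule ℝ (Fin 2 → Poly2) where
  carrier := {p | ∃ a ∈ vecPolyDeg m, ∃ b ∈ polyDeg (m : ℤ), p = fun i => a i + b * MvPolynomial.X i}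
  zero_mem' := ⟨0, fun _ => Submodule.zero_mem _, 0, Submodule.zero_mem _, by ext1; simp⟩
  add_mem' := by
    rintro _ _ ⟨a, ha, b, hb, rfl⟩ ⟨a', ha', b', hb', rfl⟩
    exact ⟨a + a', fun i => Submodule.add_mem _ (ha i) (ha' i), b + b', Submodule.add_mem _ hb hb',
      by ext1; simp only [Pi.add_apply]; ring⟩
  smul_mem' := by
    rintro r _ ⟨a, ha, b, hb, rfl⟩
    exact ⟨r • a, fun i => Submodule.smul_mem _ _ (ha i), r • b, Submodule.smul_mem _ _ hb,
      by ext1; simp only [Pi.smul_apply, smul_add, smul_mul_assoc]⟩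

lemma rtPoly_le (m : ℕ) : rtPoly m ≤ vecPolySub (m + 1) := by
  rintro _ ⟨a, ha, b, hb, rfl⟩
  rw [mem_vecPolySub]
  exact fun i => Submodule.add_mem _ (polyDeg_mono (by omega) (ha i))
    (mul_mem_polyDeg hb (X_mem_polyDeg i))

instance finiteDimensional_rtPoly (m : ℕ) : FiniteDimensional ℝ (rtPoly m) :=
  Submodule.finiteDimensional_of_le (rtPoly_le m)

lemma evalVec_rt (a : Fin 2 → Poly2) (b : Poly2) (x : Plane) :
    evalVec (fun i => a i + b * MvPolynomial.X i) x = evalVec a x + evalPoly b x • x := by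
  ext i; simp

/-- The part of `b` of degree below `m`, multiplied by `x`, has degree at most `m` and is absorbed
into `a`. This removes the redundancy in the representation `a + b x`. -/
lemma exists_homPoly_of_mem_rtPoly {m : ℕ} {p : Fin 2 → Poly2} (hp : p ∈ rtPoly m) :
    ∃ a ∈ vecPolyDeg m, ∃ c, p = fun i => a i + homPoly m c * MvPolynomial.X i := by
  obtain ⟨a, ha, b, hb, rfl⟩ := hp
  obtain ⟨b', hb', _, ⟨c, rfl⟩, rfl⟩ := Submodule.mem_sup.1 (polyDeg_le_sup m hb)
  refine ⟨fun i => a i + b' * MvPolynomial.X i, fun i => Submodule.add_mem _ (ha i) ?_, c,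
    by ext1; ring⟩
  have := mul_mem_polyDeg hb' (X_mem_polyDeg i)
  rwa [sub_add_cancel] at this

/-- The Raviart–Thomas polynomials, parametrized by a vector polynomial and a homogeneous one. -/
def rtParam (m : ℕ) :
    ((polyDeg (m : ℤ) × polyDeg (m : ℤ)) × (Fin (m + 1) → ℝ)) →ₗ[ℝ] (Fin 2 → Poly2) :=
  LinearMap.pi fun i => LinearMap.coprod
    ((polyDeg (m : ℤ)).subtype.comp (if i = 0 then LinearMap.fst ℝ _ _ else LinearMap.snd ℝ _ _))
    ((LinearMap.mulRight ℝ (MvPolynomial.X i)).comp (homPoly m))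

lemma rtParam_mem (m : ℕ) (z) : rtParam m z ∈ rtPoly m := by
  refine ⟨![z.1.1, z.1.2], fun i => ?_, homPoly m z.2, homPoly_mem m _, ?_⟩
  · fin_cases i
    · exact z.1.1.2
    · exact z.1.2.2
  · ext1 i
    fin_cases i <;> rfl

/-- If `p + h x₀ = 0` with `p` of degree at most `m`, then `h x₀` is homogeneous of degree `m + 1`
and of degree at most `m`, hence zero. -/
lemma rtParam_injective (m : ℕ) : Function.Injective (rtParam m) := by
  rw [← LinearMap.ker_eq_bot, LinearMap.ker_eq_bot']
  rintro ⟨⟨p, q⟩, c⟩ h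
  have h0 : (p : Poly2) + homPoly m c * MvPolynomial.X 0 = 0 := congrFun h 0
  have h1 : (q : Poly2) + homPoly m c * MvPolynomial.X 1 = 0 := congrFun h 1
  have h2 : homPoly m c * MvPolynomial.X 0 = 0 := by
    refine eq_zero_of_isHomogeneous (n := m + 1) (s := m)
      ((homPoly_isHomogeneous m c).mul (MvPolynomial.isHomogeneous_X ℝ 0)) ?_ (by push_cast; omega)
    rw [← neg_eq_of_add_eq_zero_right h0]
    exact Submodule.neg_mem _ p.2
  have h3 : homPoly m c = 0 := (mul_eq_zero.1 h2).resolve_right (MvPolynomial.X_ne_zero 0)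
  rw [h3, zero_mul, add_zero] at h0 h1
  have h4 : c = 0 := homPoly_injective m (by rw [h3, map_zero])
  rw [h4]
  ext
  · simp [h0]
  · simp [h1]
  · rfl

/-! ### Division by the equation of a line -/

/-- The polynomial `x ↦ cross (x - a) e`. -/
def lineEq (a e : Plane) : Poly2 :=
  (MvPolynomial.X 0 - MvPolynomial.C (a 0)) * MvPolynomial.C (e 1) -
    (MvPolynomial.X 1 - MvPolynomial.C (a 1)) * MvPolynomial.C (e 0)

lemma evalPoly_lineEq (a e x : Plane) : evalPoly (lineEq a e) x = cross (x - a) e := by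
  simp [lineEq, cross]

/-- The affine coordinate along the line through `a` in direction `e`. -/
def lineCoord (a e : Plane) : Poly2 :=
  MvPolynomial.C (‖e‖ ^ 2)⁻¹ * ((MvPolynomial.X 0 - MvPolynomial.C (a 0)) * MvPolynomial.C (e 0) +
    (MvPolynomial.X 1 - MvPolynomial.C (a 1)) * MvPolynomial.C (e 1))

lemma X_sub_C_mem (i : Fin 2) (r : ℝ) : (MvPolynomial.X i - MvPolynomial.C r : Poly2) ∈ polyDeg 1 :=
  Submodule.sub_mem _ (X_mem_polyDeg i) (C_mem_polyDeg zero_le_one r)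

lemma mul_C_mem {s : ℤ} {p : Poly2} (hp : p ∈ polyDeg s) (r : ℝ) :
    p * MvPolynomial.C r ∈ polyDeg s := by
  have := mul_mem_polyDeg hp (C_mem_polyDeg le_rfl r)
  rwa [add_zero] at this

lemma lineCoord_mem (a e : Plane) : lineCoord a e ∈ polyDeg 1 := by
  rw [lineCoord, mul_comm]
  exact mul_C_mem (Submodule.add_mem _ (mul_C_mem (X_sub_C_mem _ _) _)
    (mul_C_mem (X_sub_C_mem _ _) _)) _

lemma plane_norm_sq (e : Plane) : ‖e‖ ^ 2 = e 0 * e 0 + e 1 * e 1 := by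
  rw [EuclideanSpace.real_norm_sq_eq, Fin.sum_univ_two]; ring

lemma evalPoly_lineCoord_lineMap {a b : Plane} (hab : a ≠ b) (t : ℝ) :
    evalPoly (lineCoord a (b - a)) (AffineMap.lineMap a b t) = t := by
  have h : ‖b - a‖ ^ 2 ≠ 0 := pow_ne_zero 2 (norm_ne_zero_iff.2 (sub_ne_zero.2 hab.symm))
  have h1 := plane_norm_sq (b - a)
  simp only [lineCoord, evalPoly_mul, evalPoly_add, evalPoly_sub, evalPoly_C, evalPoly_X,
    AffineMap.lineMap_apply, vsub_eq_sub, vadd_eq_add, PiLp.add_apply, PiLp.smul_apply,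
    smul_eq_mul, add_sub_cancel_right]
  rw [inv_mul_eq_div, div_eq_iff h, h1]
  ring

/-- The orthogonal projection onto the line through `a` in direction `e`, as polynomials. -/
def lineProj (a e : Plane) (i : Fin 2) : Poly2 :=
  MvPolynomial.C (a i) + lineCoord a e * MvPolynomial.C (e i)

lemma lineProj_mem (a e : Plane) (i : Fin 2) : lineProj a e i ∈ polyDeg 1 :=
  Submodule.add_mem _ (C_mem_polyDeg zero_le_one _) (mul_C_mem (lineCoord_mem a e) _)

/-- The displacement from the orthogonal projection is the normal vector `(e₁, -e₀)`, scaled by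
`cross (x - a) e / ‖e‖²`. -/
lemma X_sub_lineProj {a e : Plane} (he : e ≠ 0) (i : Fin 2) :
    ∃ r : ℝ, MvPolynomial.X i - lineProj a e i = lineEq a e * MvPolynomial.C r := by
  refine ⟨(‖e‖ ^ 2)⁻¹ * ![e 1, -e 0] i, MvPolynomial.funext fun y => ?_⟩
  have h : ‖e‖ ^ 2 ≠ 0 := pow_ne_zero 2 (norm_ne_zero_iff.2 he)
  have h1 := plane_norm_sq e
  simp only [lineProj, lineEq, lineCoord, map_sub, map_mul, map_add, MvPolynomial.eval_X,
    MvPolynomial.eval_C]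
  fin_cases i <;> simp <;> field_simp <;> rw [h1] <;> ring

/-- `f` is congruent to its composition with the projection to a line modulo the equation of the
line, with degree bounds. -/
def LineDivisible (a e : Plane) (s : ℤ) (f : Poly2) : Prop :=
  f ∈ polyDeg s ∧ MvPolynomial.aeval (lineProj a e) f ∈ polyDeg s ∧
    ∃ g ∈ polyDeg (s - 1), f - MvPolynomial.aeval (lineProj a e) f = lineEq a e * g

/-- Writing `f̄` for the composition with the projection, `f g - f̄ ḡ = (f - f̄) g + f̄ (g - ḡ)`.
The degree bound on `f̄` is carried along for the second summand. -/
lemma LineDivisible.mul {a e : Plane} {s t : ℤ} {f g : Poly2} (hf : LineDivisible a e s f)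
    (hg : LineDivisible a e t g) : LineDivisible a e (s + t) (f * g) := by
  obtain ⟨f1, f2, f', hf', hf3⟩ := hf
  obtain ⟨g1, g2, g', hg', hg3⟩ := hg
  rw [LineDivisible, map_mul]
  refine ⟨mul_mem_polyDeg f1 g1, mul_mem_polyDeg f2 g2,
    f' * g + MvPolynomial.aeval (lineProj a e) f * g', Submodule.add_mem _ ?_ ?_, ?_⟩
  · convert! mul_mem_polyDeg hf' g1 using 2; ring
  · convert! mul_mem_polyDeg f2 hg' using 2; ring
  · linear_combination g * hf3 + (MvPolynomial.aeval (lineProj a e) f) * hg3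

lemma LineDivisible.pow {a e : Plane} {s : ℤ} {f : Poly2} (hf : LineDivisible a e s f) (n : ℕ) :
    LineDivisible a e (n * s) (f ^ n) := by
  induction n with
  | zero =>
    have h1 : (1 : Poly2) ∈ polyDeg 0 := C_mem_polyDeg le_rfl 1
    rw [Nat.cast_zero, zero_mul, pow_zero]
    exact ⟨h1, by rwa [map_one], 0, Submodule.zero_mem _, by rw [map_one, sub_self, mul_zero]⟩
  | succ n ih =>
    rw [pow_succ]
    convert ih.mul hf using 1
    push_cast; ring

/-- The property holds for the coordinates and is stable under products, hence holds for monomials.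
The degree bound on the quotient is essential: it makes the quotient an admissible interior test
function. -/
lemma exists_lineDivisible {a e : Plane} (he : e ≠ 0) {s : ℤ} {f : Poly2} (hf : f ∈ polyDeg s) :
    ∃ g ∈ polyDeg (s - 1), f - MvPolynomial.aeval (lineProj a e) f = lineEq a e * g := by
  suffices h : polyDeg s ≤ ((polyDeg (s - 1)).map (LinearMap.mulLeft ℝ (lineEq a e))).comap
      (LinearMap.id - (MvPolynomial.aeval (lineProj a e) : Poly2 →ₐ[ℝ] Poly2).toLinearMap) by
    obtain ⟨g, hg, h1⟩ := h hf
    exact ⟨g, hg, h1.symm⟩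
  refine polyDeg_induction fun d hd => ?_
  have hX : ∀ i, LineDivisible a e 1 (MvPolynomial.X i) := fun i => by
    obtain ⟨r, hr⟩ := X_sub_lineProj (a := a) he i
    refine ⟨X_mem_polyDeg i, ?_, MvPolynomial.C r, C_mem_polyDeg le_rfl r, ?_⟩
    · rw [MvPolynomial.aeval_X]; exact lineProj_mem a e i
    · rw [MvPolynomial.aeval_X]; exact hr
  have h1 := ((hX 0).pow (d 0)).mul ((hX 1).pow (d 1))
  have h2 : MvPolynomial.monomial d (1 : ℝ) =
      MvPolynomial.X 0 ^ d 0 * MvPolynomial.X 1 ^ d 1 := by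
    rw [MvPolynomial.monomial_eq, map_one, one_mul, Finsupp.prod_fintype _ _ (by simp),
      Fin.prod_univ_two]
  have h3 : d.degree = d 0 + d 1 := by rw [Finsupp.degree_eq_sum, Fin.sum_univ_two]
  obtain ⟨_, _, g, hg, h4⟩ := h1
  rw [Submodule.mem_comap, h2]
  exact ⟨g, polyDeg_mono (by omega) hg, h4.symm⟩

/-- A polynomial that vanishes on a line is divisible by the equation of the line. -/
lemma exists_eq_lineEq_mul {a b : Plane} (hab : a ≠ b) {s : ℤ} {f : Poly2} (hf : f ∈ polyDeg s)
    (h : ∀ t : ℝ, evalPoly f (AffineMap.lineMap a b t) = 0) :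
    ∃ g ∈ polyDeg (s - 1), f = lineEq a (b - a) * g := by
  obtain ⟨g, hg, h1⟩ := exists_lineDivisible (a := a) (sub_ne_zero.2 hab.symm) hf
  -- Composition with the projection evaluates `f` only at points of the line.
  have h2 : MvPolynomial.aeval (lineProj a (b - a)) f = 0 := by
    refine MvPolynomial.funext fun y => ?_
    rw [map_zero]
    have h3 := h (MvPolynomial.eval y (lineCoord a (b - a)))
    rw [← h3, evalPoly]
    have h4 : (MvPolynomial.eval y).comp
        (MvPolynomial.aeval (lineProj a (b - a)) : Poly2 →ₐ[ℝ] Poly2).toRingHom =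
        MvPolynomial.eval fun i => (AffineMap.lineMap a b
          (MvPolynomial.eval y (lineCoord a (b - a))) : Plane) i := by
      ext i
      · simp
      · simp [lineProj, AffineMap.lineMap_apply]; ring
    exact congrArg (fun φ => φ f) h4
  rw [h2, sub_zero] at h1
  exact ⟨g, hg, h1⟩

/-! ### Unisolvence of the Raviart–Thomas degrees of freedom -/

/-- A convex set with empty interior is a null set, whereas the area of the triangle is half of
`|cross (b - a) (c - a)|`. -/
lemma interior_triangle_nonempty {a b c : Plane} (hc : cross (b - a) (c - a) ≠ 0) :
    (interior (convexHull ℝ {a, b, c})).Nonempty := by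
  by_contra h
  rw [not_nonempty_iff_eq_empty] at h
  have h0 := volume_triangle_diff_interior a b c
  rw [h, sdiff_empty] at h0
  have h1 := integral_convexHull_triple hc fun _ => 1
  rw [Measure.restrict_eq_zero.2 h0, integral_zero_measure, integral_refTri continuous_const] at h1
  simp only [intervalIntegral.integral_const, smul_eq_mul, mul_one, sub_zero] at h1
  have h2 : ∫ t in (0 : ℝ)..1, (1 - t) = 1 / 2 := by
    rw [intervalIntegral.integral_sub (by simp) (by simp)]
    norm_num [integral_id]
  rw [h2] at h1
  have := abs_pos.2 hc
  linarith

lemma poly_eq_zero_of_integral_eq_zero {D : Set Plane} (hD : IsCompact D)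
    (hne : (interior D).Nonempty) {p : Poly2} (hp : ∀ x ∈ D, 0 ≤ evalPoly p x)
    (h : ∫ x in D, evalPoly p x = 0) : p = 0 := by
  refine poly_eq_zero_of_ae hne ?_
  exact (setIntegral_eq_zero_iff_of_nonneg_ae
    ((ae_restrict_iff' hD.isClosed.measurableSet).2 (Eventually.of_forall hp))
    ((continuous_evalPoly p).continuousOn.integrableOn_compact hD)).1 h

/-- Although `p` may have degree `m + 1`, its normal component on the edge has degree at most `m`,
since `cross x (b - a)` is constant along the line. It can therefore be used as its own test
function, so its square has zero integral. -/
lemma cross_evalVec_eq_zero_of_moments {m : ℕ} {a b : Plane} {p : Fin 2 → Poly2}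
    (hp : p ∈ rtPoly m) (h : VanishingMoments m a b (evalVec p)) (t : ℝ) :
    cross (evalVec p (AffineMap.lineMap a b t)) (b - a) = 0 := by
  obtain ⟨A, hA, B, hB, rfl⟩ := hp
  set q : Poly2 := A 0 * MvPolynomial.C ((b - a) 1) - A 1 * MvPolynomial.C ((b - a) 0) +
    B * MvPolynomial.C (cross a (b - a)) with hq
  have hqm : q ∈ polyDeg m := Submodule.add_mem _ (Submodule.sub_mem _ (mul_C_mem (hA 0) _)
    (mul_C_mem (hA 1) _)) (mul_C_mem hB _)
  have hval : ∀ t : ℝ, cross (evalVec (fun i => A i + B * MvPolynomial.X i)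
      (AffineMap.lineMap a b t)) (b - a) = evalPoly q (AffineMap.lineMap a b t) := fun t => by
    simp only [hq, cross, evalVec_apply, evalPoly_add, evalPoly_sub, evalPoly_mul, evalPoly_C,
      evalPoly_X, AffineMap.lineMap_apply, vsub_eq_sub, vadd_eq_add, PiLp.add_apply,
      PiLp.smul_apply, PiLp.sub_apply, smul_eq_mul]
    ring
  have h1 := h q hqm
  simp only [edgeFlux, cross_smul_left, hval] at h1
  simp only [← eval_linePoly] at h1 hval
  rw [hval]
  set r := linePoly a b q with hr
  have hz : ∀ t ∈ Icc (0 : ℝ) 1, r.eval t = 0 := by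
    have hcont : Continuous fun t : ℝ => r.eval t * r.eval t := r.continuous.mul r.continuous
    by_contra! hne
    obtain ⟨t, ht, hne⟩ := hne
    have := intervalIntegral.integral_pos zero_lt_one hcont.continuousOn
      (fun s _ => mul_self_nonneg _) ⟨t, ht, mul_self_pos.2 hne⟩
    exact this.ne' h1
  have : r = 0 := Polynomial.eq_zero_of_infinite_isRoot r
    ((Icc_infinite (zero_lt_one (α := ℝ))).mono hz)
  rw [this, Polynomial.eval_zero]

lemma divPoly_mem {s : ℤ} {p : Fin 2 → Poly2} (hp : p ∈ vecPolyDeg s) :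
    divPoly p ∈ polyDeg (s - 1) :=
  Submodule.sum_mem _ fun i _ => pderiv_mem_polyDeg (hp i) i

lemma divPoly_mem_of_rt {m : ℕ} {p : Fin 2 → Poly2} (hp : p ∈ rtPoly m) :
    divPoly p ∈ polyDeg m := by
  have := divPoly_mem (mem_vecPolySub.1 (rtPoly_le m hp))
  rwa [add_sub_cancel_right] at this

lemma green_poly {a b c : Plane} (hc : cross (b - a) (c - a) ≠ 0) (p : Fin 2 → Poly2) (q : Poly2) :
    Real.sign (cross (b - a) (c - a)) * ((∫ x in convexHull ℝ {a, b, c},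
      evalPoly (q * divPoly p) x) + ∫ x in convexHull ℝ {a, b, c},
        inner ℝ (evalVec p x) (evalVec (gradPoly q) x)) =
      edgeFlux a b (fun x => evalPoly q x • evalVec p x) +
      edgeFlux b c (fun x => evalPoly q x • evalVec p x) +
        edgeFlux c a (fun x => evalPoly q x • evalVec p x) := by
  have hT := isCompact_triangle a b c
  rw [← green_smooth hc (contDiff_evalVec p) (contDiff_evalPoly q), ← integral_add]
  · congr 2
    ext1 x
    rw [← divergence_eq_jacTrace, divergence_evalVec, fderiv_evalPoly, innerSL_apply_apply,
      evalPoly_mul, real_inner_comm]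
  · exact (continuous_evalPoly _).continuousOn.integrableOn_compact hT
  · exact ((continuous_evalVec _).inner (continuous_evalVec _)).continuousOn.integrableOn_compact hT

lemma sign_ne_zero_of_ne {r : ℝ} (hr : r ≠ 0) : Real.sign r ≠ 0 := by
  rwa [Ne, Real.sign_eq_zero_iff]

/-- Euler's identity contributes `m` and the divergence of `x` contributes `2`. -/
lemma divPoly_rt (m : ℕ) (A : Fin 2 → Poly2) (c : Fin (m + 1) → ℝ) :
    divPoly (fun i => A i + homPoly m c * MvPolynomial.X i) =
      divPoly A + ((m : ℝ) + 2) • homPoly m c := by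
  have hE := (homPoly_isHomogeneous m c).sum_X_mul_pderiv
  rw [Fin.sum_univ_two] at hE
  simp only [divPoly, Fin.sum_univ_two, map_add, Derivation.leibniz, MvPolynomial.pderiv_X_self,
    smul_eq_mul, mul_one]
  have : ((m : ℝ) + 2) • homPoly m c = m • homPoly m c + 2 • homPoly m c := by
    rw [add_smul, ← Nat.cast_smul_eq_nsmul ℝ m, ← Nat.cast_smul_eq_nsmul ℝ 2, Nat.cast_ofNat]
  rw [this, ← hE, two_smul]
  ring

/-- The normal component is `ℓ g` with the line equation `ℓ` and `g` of degree `m - 1`. Testing with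
`g` times the normal direction gives `∫ ℓ g² = 0`, and `ℓ` does not change sign on the triangle. -/
lemma cross_poly_eq_zero {m : ℕ} {a b c : Plane} (hc : cross (b - a) (c - a) ≠ 0)
    {A : Fin 2 → Poly2} (hA : A ∈ vecPolyDeg m)
    (hvol : ∀ q ∈ vecPolyDeg ((m : ℤ) - 1),
      ∫ x in convexHull ℝ {a, b, c}, inner ℝ (evalVec A x) (evalVec q x) = 0)
    (hline : ∀ t : ℝ, cross (evalVec A (AffineMap.lineMap a b t)) (b - a) = 0) (x : Plane) :
    cross (evalVec A x) (b - a) = 0 := by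
  have hT := isCompact_triangle a b c
  set f : Poly2 := A 0 * MvPolynomial.C ((b - a) 1) - A 1 * MvPolynomial.C ((b - a) 0) with hf
  have hfm : f ∈ polyDeg m := Submodule.sub_mem _ (mul_C_mem (hA 0) _) (mul_C_mem (hA 1) _)
  have hval : ∀ x, evalPoly f x = cross (evalVec A x) (b - a) := fun x => by
    simp [hf, cross]
  obtain ⟨g, hg, hfg⟩ := exists_eq_lineEq_mul (ne_of_cross_ne_zero hc).1 hfm fun t => by
    rw [hval, hline]
  have h1 := hvol ![g * MvPolynomial.C ((b - a) 1), -(g * MvPolynomial.C ((b - a) 0))] (by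
    intro i
    fin_cases i
    · exact mul_C_mem hg _
    · exact Submodule.neg_mem _ (mul_C_mem hg _))
  have h2 : ∀ x, inner ℝ (evalVec A x) (evalVec
      ![g * MvPolynomial.C ((b - a) 1), -(g * MvPolynomial.C ((b - a) 0))] x) =
      evalPoly (lineEq a (b - a) * g * g) x := fun x => by
    rw [← hfg, evalPoly_mul, hval]
    have hneg : ∀ p : Poly2, evalPoly (-p) x = -evalPoly p x := fun p => map_neg _ _
    simp only [PiLp.inner_apply, Fin.sum_univ_two, evalVec_apply, RCLike.inner_apply, conj_trivial,
      Matrix.cons_val_zero, Matrix.cons_val_one, evalPoly_mul, evalPoly_C, hneg, cross]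
    ring
  simp only [h2] at h1
  -- The constant is the value of the line equation at `c`; multiplying by it makes the integrand
  -- nonnegative for either orientation of the triangle.
  have h3 : MvPolynomial.C (cross (c - a) (b - a)) * (lineEq a (b - a) * g * g) = 0 := by
    refine poly_eq_zero_of_integral_eq_zero hT (interior_triangle_nonempty hc) (fun x hx => ?_) ?_
    · rw [convexHull_triple] at hx
      obtain ⟨p, hp, rfl⟩ := hx
      have h4 : cross (triMap a b c p - a) (b - a) = p.2 * cross (c - a) (b - a) := by
        rw [triMap, add_sub_cancel_left, cross_add_left, cross_smul_left, cross_smul_left,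
          cross_self, mul_zero, zero_add]
      rw [evalPoly_mul, evalPoly_mul, evalPoly_mul, evalPoly_C, evalPoly_lineEq, h4]
      have := mul_nonneg hp.2.1 (mul_nonneg (mul_self_nonneg (cross (c - a) (b - a)))
        (mul_self_nonneg (evalPoly g (triMap a b c p))))
      linarith
    · simp only [evalPoly_mul _ (lineEq a (b - a) * g * g), evalPoly_C]
      rw [integral_const_mul, h1, mul_zero]
  have hca : cross (c - a) (b - a) ≠ 0 := by
    intro h0
    apply hc
    simp only [cross] at h0 ⊢
    linarith
  rw [← hval, hfg]
  rcases mul_eq_zero.1 h3 with h4 | h4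
  · exact absurd (MvPolynomial.C_eq_zero.1 h4) hca
  · rcases mul_eq_zero.1 h4 with h5 | h5
    · rw [h5, evalPoly_zero]
    · rw [h5, mul_zero, evalPoly_zero]

lemma convexHull_rotate (a b c : Plane) :
    convexHull ℝ {b, c, a} = convexHull ℝ ({a, b, c} : Set Plane) := by
  congr 1
  ext x
  simp only [mem_insert_iff, mem_singleton_iff]
  tauto

lemma cross_rotate (a b c : Plane) : cross (c - b) (a - b) = cross (b - a) (c - a) := by
  simp only [cross, PiLp.sub_apply]; ring

/-- The degrees of freedom of the Raviart–Thomas element determine the polynomial. -/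
lemma rtPoly_eq_zero {m : ℕ} {a b c : Plane} (hc : cross (b - a) (c - a) ≠ 0) {p : Fin 2 → Poly2}
    (hp : p ∈ rtPoly m)
    (hvol : ∀ q ∈ vecPolyDeg ((m : ℤ) - 1),
      ∫ x in convexHull ℝ {a, b, c}, inner ℝ (evalVec p x) (evalVec q x) = 0)
    (hab : VanishingMoments m a b (evalVec p)) (hbc : VanishingMoments m b c (evalVec p))
    (hca : VanishingMoments m c a (evalVec p)) : p = 0 := by
  have hT := isCompact_triangle a b c
  -- Green's formula with the test function `div p`, which has degree at most `m`, while its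
  -- gradient is admissible for the interior moments.
  have hdiv : divPoly p = 0 := by
    have hD := divPoly_mem_of_rt hp
    have h1 := green_poly hc p (divPoly p)
    rw [hab _ hD, hbc _ hD, hca _ hD, hvol _ (gradPoly_mem hD), add_zero, add_zero, add_zero] at h1
    have h2 := (mul_eq_zero.1 h1).resolve_left (sign_ne_zero_of_ne hc)
    have h3 := poly_eq_zero_of_integral_eq_zero hT (interior_triangle_nonempty hc)
      (fun x _ => by rw [evalPoly_mul]; exact mul_self_nonneg _) h2
    exact mul_self_eq_zero.1 h3
  have lab := cross_evalVec_eq_zero_of_moments hp hab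
  have lbc := cross_evalVec_eq_zero_of_moments hp hbc
  obtain ⟨A, hA, C, rfl⟩ := exists_homPoly_of_mem_rtPoly hp
  -- Since `div p = 0`, the polynomial `(m + 2) h` equals `-div A` and has degree at most `m - 1`,
  -- while `h` is homogeneous of degree `m`.
  have hH : homPoly m C = 0 := by
    refine eq_zero_of_isHomogeneous (homPoly_isHomogeneous m C) (s := (m : ℤ) - 1) ?_ (by omega)
    rw [divPoly_rt] at hdiv
    have h1 : ((m : ℝ) + 2) • homPoly m C ∈ polyDeg ((m : ℤ) - 1) := by
      rw [← neg_eq_of_add_eq_zero_right hdiv]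
      exact Submodule.neg_mem _ (divPoly_mem hA)
    exact ((polyDeg ((m : ℤ) - 1)).smul_mem_iff (by positivity)).1 h1
  simp only [hH, zero_mul, add_zero] at *
  have c1 := cross_poly_eq_zero hc hA hvol lab
  have hc' : cross (c - b) (a - b) ≠ 0 := by rwa [cross_rotate]
  have c2 := cross_poly_eq_zero (a := b) (b := c) (c := a) hc' hA
    (by rwa [convexHull_rotate]) lbc
  -- Two edges have independent normals, so two vanishing normal components determine the field.
  have hdet : cross (b - a) (c - b) ≠ 0 := by
    intro h0
    apply hc
    rw [← h0]
    simp only [cross, PiLp.sub_apply]; ring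
  have hA0 : ∀ x, evalVec A x = 0 := fun x => by
    have h1 := c1 x
    have h2 := c2 x
    set u := evalVec A x
    simp only [cross] at h1 h2 hdet
    have h3 : u 0 * ((b - a) 0 * (c - b) 1 - (b - a) 1 * (c - b) 0) = 0 := by
      linear_combination (b - a) 0 * h2 - (c - b) 0 * h1
    have h4 : u 1 * ((b - a) 0 * (c - b) 1 - (b - a) 1 * (c - b) 0) = 0 := by
      linear_combination (b - a) 1 * h2 - (c - b) 1 * h1
    ext i
    fin_cases i
    · exact (mul_eq_zero.1 h3).resolve_right hdet
    · exact (mul_eq_zero.1 h4).resolve_right hdet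
  ext1 i
  exact poly_eq_zero_of_eqOn isOpen_univ univ_nonempty fun x _ =>
    congrArg (fun z : Plane => z i) (hA0 x)

/-! ### The local Raviart–Thomas interpolation -/

lemma intervalIntegrable_edge {a b : Plane} (hab : a ≠ b) {g : Plane → Plane}
    (hg : MemLp g 2 (segMeasure a b)) {ψ : Plane → ℝ} (hψ : Continuous ψ) :
    IntervalIntegrable (fun t : ℝ => cross (ψ (AffineMap.lineMap a b t) •
      g (AffineMap.lineMap a b t)) (b - a)) volume 0 1 := by
  have h0 : ENNReal.ofReal (dist a b) ≠ 0 := by simpa using hab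
  have h1 : Integrable g (segMeasure a b) := hg.integrable one_le_two
  rw [segMeasure, integrable_smul_measure h0 ENNReal.ofReal_ne_top,
    integrable_map_measure _ (measurable_lineMap a b).aemeasurable] at h1
  · have h2 := (crossL (b - a)).integrable_comp h1
    have hc : ContinuousOn (fun t : ℝ => ψ (AffineMap.lineMap a b t)) (Icc 0 1) :=
      (hψ.comp AffineMap.lineMap_continuous).continuousOn
    have h3 := IntegrableOn.continuousOn_mul hc h2 isCompact_Icc
    rw [intervalIntegrable_iff_integrableOn_Icc_of_le zero_le_one]
    refine h3.congr_fun (fun t _ => ?_) measurableSet_Icc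
    simp only [Function.comp_apply, crossL_apply, cross_smul_left]
  · exact h1.aestronglyMeasurable

lemma edgeFlux_smul_sub {a b : Plane} (hab : a ≠ b) {f g : Plane → Plane}
    (hf : MemLp f 2 (segMeasure a b)) (hg : MemLp g 2 (segMeasure a b)) {ψ : Plane → ℝ}
    (hψ : Continuous ψ) :
    edgeFlux a b (fun x => ψ x • (f x - g x)) =
      edgeFlux a b (fun x => ψ x • f x) - edgeFlux a b (fun x => ψ x • g x) := by
  unfold edgeFlux
  rw [← intervalIntegral.integral_sub (intervalIntegrable_edge hab hf hψ)
    (intervalIntegrable_edge hab hg hψ)]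
  simp only [smul_sub, cross_sub_left]

/-- On the edge `lineCoord` is the parameter `t`, and a test polynomial restricts to a combination
of `1, t, …, tᵐ`. -/
lemma vanishingMoments_of_powers {m : ℕ} {a b : Plane} (hab : a ≠ b) {g : Plane → Plane}
    (hg : MemLp g 2 (segMeasure a b))
    (h : ∀ j : Fin (m + 1),
      edgeFlux a b (fun x => evalPoly (lineCoord a (b - a) ^ (j : ℕ)) x • g x) = 0) :
    VanishingMoments m a b g := by
  intro q hq
  have h1 : ∀ t : ℝ, evalPoly q (AffineMap.lineMap a b t) =
      ∑ j : Fin (m + 1), (linePoly a b q).coeff j * t ^ (j : ℕ) := fun t => by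
    rw [← eval_linePoly, Polynomial.eval_eq_sum_range' (Nat.lt_succ_of_le
      (natDegree_linePoly_le a b hq)), Finset.sum_range]
  have h2 : edgeFlux a b (fun x => evalPoly q x • g x) = ∑ j : Fin (m + 1),
      (linePoly a b q).coeff j *
        edgeFlux a b (fun x => evalPoly (lineCoord a (b - a) ^ (j : ℕ)) x • g x) := by
    unfold edgeFlux
    simp only [← intervalIntegral.integral_const_mul]
    rw [← intervalIntegral.integral_finsetSum]
    · congr 1
      ext t
      simp only [cross_smul_left, h1, Finset.sum_mul, evalPoly_pow, evalPoly_lineCoord_lineMap hab,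
        mul_assoc]
    · intro j _
      exact (intervalIntegrable_edge hab hg (continuous_evalPoly _)).const_mul _
  rw [h2]
  exact Finset.sum_eq_zero fun j _ => by rw [h j, mul_zero]

/-- The moments of a vector polynomial on an edge. -/
def edgeMoments (m : ℕ) (a b : Plane) : (Fin 2 → Poly2) →ₗ[ℝ] (Fin (m + 1) → ℝ) where
  toFun p j := edgeFlux a b (fun x => evalPoly (lineCoord a (b - a) ^ (j : ℕ)) x • evalVec p x)
  map_add' p q := by
    ext j
    simp only [Pi.add_apply, edgeFlux]
    rw [← intervalIntegral.integral_add]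
    · simp only [evalVec_add, smul_add, cross_add_left]
    all_goals
      refine Continuous.intervalIntegrable ?_ _ _
      simp only [← crossL_apply]
      exact (crossL _).continuous.comp (((continuous_evalPoly _).smul (continuous_evalVec _)).comp
        AffineMap.lineMap_continuous)
  map_smul' r p := by
    ext j
    simp only [Pi.smul_apply, edgeFlux, smul_eq_mul, RingHom.id_apply]
    rw [← intervalIntegral.integral_const_mul]
    simp only [evalVec_smul, cross_smul_left]
    congr 1
    ext t
    ring

/-- The moments of a vector polynomial on a compact set. -/
def volumeMoments (m : ℕ) {D : Set Plane} (hD : IsCompact D) :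
    (Fin 2 → Poly2) →ₗ[ℝ] Module.Dual ℝ
      (polyDeg ((m : ℤ) - 1) × polyDeg ((m : ℤ) - 1)) :=
  LinearMap.mk₂ ℝ (fun p q => ∫ x in D, inner ℝ (evalVec p x)
      (evalVec ![(q.1 : Poly2), (q.2 : Poly2)] x))
    (fun p p' q => by
      rw [← integral_add]
      · simp only [evalVec_add, inner_add_left]
      all_goals exact ((continuous_evalVec _).inner
        (continuous_evalVec _)).continuousOn.integrableOn_compact hD)
    (fun r p q => by
      rw [smul_eq_mul, ← integral_const_mul]
      simp only [evalVec_smul, real_inner_smul_left])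
    (fun p q q' => by
      rw [← integral_add]
      · congr 1
        ext x
        rw [← inner_add_right, ← evalVec_add]
        simp
      all_goals exact ((continuous_evalVec _).inner
        (continuous_evalVec _)).continuousOn.integrableOn_compact hD)
    (fun r p q => by
      rw [smul_eq_mul, ← integral_const_mul]
      congr 1
      ext x
      rw [← real_inner_smul_right, ← evalVec_smul]
      simp)

lemma vecPolyDeg_eq_pair {s : ℤ} {q : Fin 2 → Poly2} (hq : q ∈ vecPolyDeg s) :
    q = ![((⟨q 0, hq 0⟩ : polyDeg s) : Poly2), ((⟨q 1, hq 1⟩ : polyDeg s) : Poly2)] := by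
  ext1 i; fin_cases i <;> rfl

/-- The space of values of the degrees of freedom. -/
abbrev DofSpace (m : ℕ) : Type :=
  (Module.Dual ℝ (polyDeg ((m : ℤ) - 1) × polyDeg ((m : ℤ) - 1)) × (Fin (m + 1) → ℝ)) ×
    ((Fin (m + 1) → ℝ) × (Fin (m + 1) → ℝ))

/-- The claim is `2 dim P_{m-1} + 3 (m + 1) ≤ 2 dim P_m + (m + 1)`, twice the inequality
`finrank_polyDeg_ge`. -/
lemma finrank_dofSpace_le (m : ℕ) : Module.finrank ℝ (DofSpace m) ≤
    Module.finrank ℝ ((polyDeg (m : ℤ) × polyDeg (m : ℤ)) × (Fin (m + 1) → ℝ)) := by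
  have hge := finrank_polyDeg_ge m
  rw [Module.finrank_prod, Module.finrank_prod, Module.finrank_prod, Module.finrank_prod,
    Module.finrank_prod, Subspace.dual_finrank_eq, Module.finrank_prod, Module.finrank_fin_fun]
  omega

lemma surjective_of_injective_of_finrank_le {V W : Type*} [AddCommGroup V] [AddCommGroup W]
    [Module ℝ V] [Module ℝ W] [FiniteDimensional ℝ V] [FiniteDimensional ℝ W] {f : V →ₗ[ℝ] W}
    (hf : Function.Injective f) (h : Module.finrank ℝ W ≤ Module.finrank ℝ V) :
    Function.Surjective f :=
  (LinearMap.injective_iff_surjective_of_finrank_eq_finrank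
    (le_antisymm (LinearMap.finrank_le_finrank_of_injective hf) h)).1 hf

/-- The degrees of freedom of the Raviart–Thomas element. -/
def rtDof (m : ℕ) (a b c : Plane) : (Fin 2 → Poly2) →ₗ[ℝ] DofSpace m :=
  ((volumeMoments m (isCompact_triangle a b c)).prod (edgeMoments m a b)).prod
    ((edgeMoments m b c).prod (edgeMoments m c a))

lemma rtDof_eq {m : ℕ} {a b c : Plane} {p : Fin 2 → Poly2} {d₁ d₂ d₃ d₄}
    (h : rtDof m a b c p = ((d₁, d₂), (d₃, d₄))) :
    volumeMoments m (isCompact_triangle a b c) p = d₁ ∧ edgeMoments m a b p = d₂ ∧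
      edgeMoments m b c p = d₃ ∧ edgeMoments m c a p = d₄ := by
  simp only [rtDof, LinearMap.prod_apply, Function.prod_apply, Prod.mk.injEq] at h
  exact ⟨h.1.1, h.1.2, h.2.1, h.2.2⟩

lemma volumeMoments_apply (m : ℕ) {D : Set Plane} (hD : IsCompact D) (p : Fin 2 → Poly2)
    (q : polyDeg ((m : ℤ) - 1) × polyDeg ((m : ℤ) - 1)) :
    volumeMoments m hD p q =
      ∫ x in D, inner ℝ (evalVec p x) (evalVec ![(q.1 : Poly2), (q.2 : Poly2)] x) := rfl

lemma edgeMoments_apply (m : ℕ) (a b : Plane) (p : Fin 2 → Poly2) (j : Fin (m + 1)) :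
    edgeMoments m a b p j =
      edgeFlux a b (fun x => evalPoly (lineCoord a (b - a) ^ (j : ℕ)) x • evalVec p x) := rfl

/-- Unisolvence gives injectivity, and the target is not larger than the source. -/
lemma rtDof_surjective (m : ℕ) {a b c : Plane} (hc : cross (b - a) (c - a) ≠ 0) :
    Function.Surjective ((rtDof m a b c).comp (rtParam m)) := by
  obtain ⟨nab, nbc, nca⟩ := ne_of_cross_ne_zero hc
  have mem : ∀ p e f, MemLp (evalVec p) 2 (segMeasure e f) := fun p e f =>
    memLp_segMeasure_of_continuous (continuous_evalVec p) e f 2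
  refine surjective_of_injective_of_finrank_le ?_ (finrank_dofSpace_le m)
  rw [← LinearMap.ker_eq_bot, LinearMap.ker_eq_bot']
  intro z hz
  rw [LinearMap.comp_apply] at hz
  obtain ⟨h1, h2, h3, h4⟩ := rtDof_eq (d₁ := 0) (d₂ := 0) (d₃ := 0) (d₄ := 0) hz
  have hpow : ∀ e f, edgeMoments m e f (rtParam m z) = 0 → ∀ j : Fin (m + 1), edgeFlux e f
      (fun x => evalPoly (lineCoord e (f - e) ^ (j : ℕ)) x • evalVec (rtParam m z) x) = 0 :=
    fun e f h j => by rw [← edgeMoments_apply, h, Pi.zero_apply]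
  refine rtParam_injective m ?_
  rw [map_zero]
  refine rtPoly_eq_zero hc (rtParam_mem m z) (fun q hq => ?_)
    (vanishingMoments_of_powers nab (mem _ _ _) (hpow _ _ h2))
    (vanishingMoments_of_powers nbc (mem _ _ _) (hpow _ _ h3))
    (vanishingMoments_of_powers nca (mem _ _ _) (hpow _ _ h4))
  rw [vecPolyDeg_eq_pair hq]
  have h5 := volumeMoments_apply m (isCompact_triangle a b c) (rtParam m z)
    (⟨q 0, hq 0⟩, ⟨q 1, hq 1⟩)
  rw [h1, LinearMap.zero_apply] at h5
  exact h5.symm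

lemma exists_rt_interpolant {m : ℕ} {a b c : Plane} (hc : cross (b - a) (c - a) ≠ 0)
    {u g : Plane → Plane} (hu : MemLp u 2 (volume.restrict (convexHull ℝ {a, b, c})))
    (gab : MemLp g 2 (segMeasure a b)) (gbc : MemLp g 2 (segMeasure b c))
    (gca : MemLp g 2 (segMeasure c a)) :
    ∃ p ∈ rtPoly m, (∀ q ∈ vecPolyDeg ((m : ℤ) - 1),
        ∫ x in convexHull ℝ {a, b, c}, inner ℝ (evalVec p x - u x) (evalVec q x) = 0) ∧
      VanishingMoments m a b (fun x => evalVec p x - g x) ∧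
      VanishingMoments m b c (fun x => evalVec p x - g x) ∧
      VanishingMoments m c a (fun x => evalVec p x - g x) := by
  obtain ⟨nab, nbc, nca⟩ := ne_of_cross_ne_zero hc
  have hT := isCompact_triangle a b c
  have mem : ∀ p e f, MemLp (evalVec p) 2 (segMeasure e f) := fun p e f =>
    memLp_segMeasure_of_continuous (continuous_evalVec p) e f 2
  have hui : IntegrableOn u (convexHull ℝ {a, b, c}) := integrable_of_memLp_two hT hu
  have hinner : ∀ q, IntegrableOn (fun x => inner ℝ (u x) (evalVec q x)) (convexHull ℝ {a, b, c}) :=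
    fun q => by
      simp only [PiLp.inner_apply, RCLike.inner_apply, conj_trivial, evalVec_apply]
      refine integrable_finsetSum _ fun i _ => ?_
      exact IntegrableOn.continuous_smul hT
        ((EuclideanSpace.proj i : Plane →L[ℝ] ℝ).integrable_comp hui) (continuous_evalPoly (q i))
  let L : Module.Dual ℝ (polyDeg ((m : ℤ) - 1) × polyDeg ((m : ℤ) - 1)) :=
    { toFun := fun q => ∫ x in convexHull ℝ {a, b, c},
        inner ℝ (u x) (evalVec ![(q.1 : Poly2), (q.2 : Poly2)] x)
      map_add' := fun q q' => by
        rw [← integral_add (hinner _) (hinner _)]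
        congr 1
        ext x
        rw [← inner_add_right, ← evalVec_add]
        simp
      map_smul' := fun r q => by
        rw [RingHom.id_apply, smul_eq_mul, ← integral_const_mul]
        congr 1
        ext x
        rw [← real_inner_smul_right, ← evalVec_smul]
        simp }
  let M : Plane → Plane → Fin (m + 1) → ℝ := fun e f j =>
    edgeFlux e f (fun x => evalPoly (lineCoord e (f - e) ^ (j : ℕ)) x • g x)
  obtain ⟨z, hz⟩ := rtDof_surjective m hc ((L, M a b), (M b c, M c a))
  rw [LinearMap.comp_apply] at hz
  obtain ⟨h1, h2, h3, h4⟩ := rtDof_eq hz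
  have hedge : ∀ e f, e ≠ f → MemLp g 2 (segMeasure e f) →
      edgeMoments m e f (rtParam m z) = M e f →
      VanishingMoments m e f (fun x => evalVec (rtParam m z) x - g x) := fun e f hef hg h => by
    refine vanishingMoments_of_powers hef ((mem _ _ _).sub hg) fun j => ?_
    rw [edgeFlux_smul_sub hef (mem _ _ _) hg (continuous_evalPoly _), sub_eq_zero, ← edgeMoments_apply, h]
  refine ⟨rtParam m z, rtParam_mem m z, fun q hq => ?_, hedge a b nab gab h2,
    hedge b c nbc gbc h3, hedge c a nca gca h4⟩
  simp only [inner_sub_left]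
  rw [integral_sub _ (hinner q), sub_eq_zero, vecPolyDeg_eq_pair hq]
  · have h5 := volumeMoments_apply m hT (rtParam m z) (⟨q 0, hq 0⟩, ⟨q 1, hq 1⟩)
    rw [h1] at h5
    exact h5.symm
  · exact ((continuous_evalVec _).inner (continuous_evalVec _)).continuousOn.integrableOn_compact hT

section

/-! ### Triangulations -/

lemma exists_smul_eq_of_cross_eq_zero {u w : Plane} (hu : u ≠ 0) (h : cross u w = 0) :
    ∃ t : ℝ, w = t • u := by
  have h' : u 0 * w 1 = u 1 * w 0 := by simpa [cross, sub_eq_zero] using h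
  by_cases h0 : u 0 = 0
  · have h1 : u 1 ≠ 0 := fun h1 => hu (by ext i; fin_cases i <;> simp [h0, h1])
    refine ⟨w 1 / u 1, ?_⟩
    ext i
    fin_cases i
    · have : w 0 = 0 := by simpa [h0, h1] using h'
      simp [h0, this]
    · simp [h1]
  · refine ⟨w 0 / u 0, ?_⟩
    ext i
    fin_cases i
    · simp [h0]
    · simp only [Fin.mk_one, PiLp.smul_apply, smul_eq_mul]
      field_simp
      linarith

variable {S : Geometry.SimplicialComplex ℝ Plane} {T T' : Finset Plane}

/-- The vertices of a face are affinely independent; a vanishing cross product would put `c` on the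
line through `a` and `b`. Any ordered edge can thus be taken as the first edge of its triangle. -/
lemma exists_third_vertex (hT : T ∈ triangles S) {a b : Plane} (ha : a ∈ T) (hb : b ∈ T)
    (hab : a ≠ b) : ∃ c, T = {a, b, c} ∧ cross (b - a) (c - a) ≠ 0 := by
  obtain ⟨hf, hcard⟩ := hT
  have hsub : ({a, b} : Finset Plane) ⊆ T := by
    intro x hx
    simp only [Finset.mem_insert, Finset.mem_singleton] at hx
    rcases hx with rfl | rfl <;> assumption
  have h1 : (T \ {a, b}).card = 1 := by
    rw [Finset.card_sdiff_of_subset hsub, hcard, Finset.card_pair hab]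
  obtain ⟨c, hc⟩ := Finset.card_eq_one.1 h1
  have hcT : c ∈ T \ {a, b} := by rw [hc]; exact Finset.mem_singleton_self c
  have hT : T = {a, b, c} := by
    ext x
    have : x ∈ T \ {a, b} ↔ x = c := by rw [hc, Finset.mem_singleton]
    simp only [Finset.mem_sdiff, Finset.mem_insert, Finset.mem_singleton, not_or] at this
    simp only [Finset.mem_insert, Finset.mem_singleton]
    constructor
    · intro hx
      by_cases h1 : x = a
      · exact Or.inl h1
      by_cases h2 : x = b
      · exact Or.inr (Or.inl h2)
      exact Or.inr (Or.inr (this.1 ⟨hx, h1, h2⟩))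
    · rintro (rfl | rfl | h)
      exacts [ha, hb, (this.2 h).1]
  refine ⟨c, hT, fun h0 => ?_⟩
  simp only [Finset.mem_sdiff, Finset.mem_insert, Finset.mem_singleton, not_or] at hcT
  obtain ⟨t, ht⟩ := exists_smul_eq_of_cross_eq_zero (sub_ne_zero.2 hab.symm) h0
  have h2 := (S.indep hf).notMem_affineSpan_sdiff ⟨c, hcT.1⟩ {⟨a, ha⟩, ⟨b, hb⟩}
  have h3 : (Subtype.val '' (({⟨a, ha⟩, ⟨b, hb⟩} : Set T) \ {⟨c, hcT.1⟩})) = {a, b} := by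
    ext x
    simp only [mem_image, Set.mem_sdiff, mem_insert_iff, mem_singleton_iff, Subtype.exists,
      Subtype.mk.injEq, exists_and_right, exists_eq_right]
    constructor
    · exact fun h => h.1.2
    · rintro (rfl | rfl)
      · exact ⟨⟨ha, Or.inl rfl⟩, fun h => hcT.2.1 h.symm⟩
      · exact ⟨⟨hb, Or.inr rfl⟩, fun h => hcT.2.2 h.symm⟩
  rw [h3] at h2
  refine h2 ?_
  have : c = AffineMap.lineMap a b t := by
    rw [AffineMap.lineMap_apply_module', ← ht, sub_add_cancel]
  change c ∈ _
  rw [this]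
  exact AffineMap.lineMap_mem_affineSpan_pair t a b

lemma exists_vertices (hT : T ∈ triangles S) :
    ∃ a b c, T = {a, b, c} ∧ cross (b - a) (c - a) ≠ 0 := by
  obtain ⟨a, ha, b, hb, hab⟩ := Finset.one_lt_card.1 (by rw [hT.2]; norm_num : 1 < T.card)
  exact ⟨a, b, exists_third_vertex hT ha hb hab⟩

lemma coe_triple (a b c : Plane) : ((({a, b, c} : Finset Plane)) : Set Plane) = {a, b, c} := by
  simp

lemma isCompact_convexHull_triangle (T : Finset Plane) :
    IsCompact (convexHull ℝ (T : Set Plane)) := T.finite_toSet.isCompact_convexHull ℝ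

lemma measurableSet_convexHull_triangle (T : Finset Plane) :
    MeasurableSet (convexHull ℝ (T : Set Plane)) :=
  (isCompact_convexHull_triangle T).isClosed.measurableSet

lemma volume_convexHull_diff_interior (T : Finset Plane) :
    volume (convexHull ℝ (T : Set Plane) \ interior (convexHull ℝ (T : Set Plane))) = 0 := by
  have h := (convex_convexHull ℝ (T : Set Plane)).addHaar_frontier volume
  rwa [(isCompact_convexHull_triangle T).isClosed.frontier_eq] at h

lemma volume_convexHull_pair {a b c : Plane} (hc : cross (b - a) (c - a) ≠ 0) :
    volume (convexHull ℝ {a, b}) = 0 := by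
  have h : affineSpan ℝ ({a, b} : Set Plane) ≠ ⊤ := fun h => by
    have h1 : c ∈ affineSpan ℝ ({a, b} : Set Plane) := h ▸ AffineSubspace.mem_top ℝ Plane c
    have h2 := vsub_mem_vectorSpan_of_mem_affineSpan_of_mem_affineSpan h1
      (left_mem_affineSpan_pair ℝ a b)
    obtain ⟨t, ht⟩ := mem_vectorSpan_pair_rev.1 h2
    rw [vsub_eq_sub, vsub_eq_sub] at ht
    exact hc (by rw [← ht]; simp [cross]; ring)
  exact measure_mono_null (convexHull_subset_affineSpan _) (Measure.addHaar_affineSubspace _ _ h)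

/-- Two triangles of the complex intersect inside the convex hull of their common vertices. Some
vertex of `T` is not in `T'`, so this hull lies in the opposite edge of `T`. -/
lemma volume_inter_triangles (hT : T ∈ triangles S) (hT' : T' ∈ triangles S) (h : T ≠ T') :
    volume (convexHull ℝ (T : Set Plane) ∩ convexHull ℝ (T' : Set Plane)) = 0 := by
  obtain ⟨c, hcT, hcT'⟩ : ∃ c ∈ T, c ∉ T' := by
    by_contra! h'
    exact h (Finset.eq_of_subset_of_card_le h' (by rw [hT.2, hT'.2]))
  obtain ⟨a, ha, hac⟩ := Finset.exists_mem_ne (by rw [hT.2]; norm_num : 1 < T.card) c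
  obtain ⟨b, rfl, hcr⟩ := exists_third_vertex hT hcT ha hac.symm
  refine measure_mono_null ((S.inter_subset_convexHull hT.1 hT'.1).trans ?_)
    (volume_convexHull_pair (a := a) (b := b) (c := c) ?_)
  · refine convexHull_mono fun x hx => ?_
    have : x ≠ c := fun hxc => hcT' (hxc ▸ hx.2)
    simpa [this] using hx.1
  · intro h0
    apply hcr
    simp only [cross, PiLp.sub_apply] at h0 ⊢
    linarith

variable {n : ℕ} {P : Polygon Plane n} {K : Set Plane}

/-- The triangles of a finite triangulation. -/
def IsSubtriangulation.tri (hS : IsSubtriangulation P K S) : Finset (Finset Plane) :=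
  (hS.finite.subset (fun _ h => h.1 : triangles S ⊆ S.faces)).toFinset

lemma IsSubtriangulation.mem_tri (hS : IsSubtriangulation P K S) :
    T ∈ hS.tri ↔ T ∈ triangles S := Set.Finite.mem_toFinset _

lemma IsSubtriangulation.eq_biUnion (hS : IsSubtriangulation P K S) :
    K = ⋃ T ∈ hS.tri, convexHull ℝ (T : Set Plane) := by
  ext x
  simp only [mem_iUnion, exists_prop, hS.mem_tri]
  rw [← hS.space_eq, Geometry.SimplicialComplex.mem_space_iff]
  constructor
  · rintro ⟨s, hs, hx⟩
    obtain ⟨T, hT, hsT⟩ := hS.pure s hs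
    exact ⟨T, hT, convexHull_mono (by exact_mod_cast hsT) hx⟩
  · rintro ⟨T, hT, hx⟩
    exact ⟨T, hT.1, hx⟩

lemma IsSubtriangulation.convexHull_subset (hS : IsSubtriangulation P K S)
    (hT : T ∈ triangles S) : convexHull ℝ (T : Set Plane) ⊆ K := by
  rw [← hS.space_eq]
  exact Geometry.SimplicialComplex.convexHull_subset_space hT.1

lemma IsSubtriangulation.ae_iff (hS : IsSubtriangulation P K S) {p : Plane → Prop} :
    (∀ᵐ x ∂(volume.restrict K), p x) ↔
      ∀ T ∈ triangles S, ∀ᵐ x ∂(volume.restrict (convexHull ℝ (T : Set Plane))), p x := by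
  conv_lhs => rw [hS.eq_biUnion, ae_restrict_biUnion_finset_eq]
  simp only [← hS.mem_tri, Filter.eventually_iSup]

lemma IsSubtriangulation.integrableOn (hS : IsSubtriangulation P K S) {E : Type*}
    [NormedAddCommGroup E] {f : Plane → E}
    (hf : ∀ T ∈ triangles S, IntegrableOn f (convexHull ℝ (T : Set Plane))) :
    IntegrableOn f K := by
  rw [hS.eq_biUnion, integrableOn_finset_iUnion]
  exact fun T hT => hf T (hS.mem_tri.1 hT)

lemma IsSubtriangulation.setIntegral_eq_sum (hS : IsSubtriangulation P K S) {E : Type*}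
    [NormedAddCommGroup E] [NormedSpace ℝ E] {f : Plane → E}
    (hf : ∀ T ∈ triangles S, IntegrableOn f (convexHull ℝ (T : Set Plane))) :
    ∫ x in K, f x = ∑ T ∈ hS.tri, ∫ x in convexHull ℝ (T : Set Plane), f x := by
  have hint := hS.integrableOn hf
  have h := hS.eq_biUnion
  rw [← Finset.set_biUnion_coe, biUnion_eq_iUnion] at h
  rw [h] at hint
  conv_lhs => rw [h]
  rw [integral_iUnion_ae (fun i => (measurableSet_convexHull_triangle _).nullMeasurableSet)
    (fun i j hij => ?_) hint, tsum_fintype]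
  · exact Finset.sum_coe_sort hS.tri (fun T => ∫ x in convexHull ℝ (T : Set Plane), f x)
  · exact volume_inter_triangles (hS.mem_tri.1 i.2) (hS.mem_tri.1 j.2)
      fun h => hij (Subtype.ext h)

lemma IsSubtriangulation.volume_diff_interior (hS : IsSubtriangulation P K S) :
    volume (K \ interior K) = 0 := by
  refine measure_mono_null (t := ⋃ T ∈ hS.tri,
    convexHull ℝ (T : Set Plane) \ interior (convexHull ℝ (T : Set Plane))) ?_ ?_
  · rintro x ⟨hx, hx'⟩
    rw [hS.eq_biUnion] at hx
    simp only [mem_iUnion, exists_prop] at hx ⊢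
    obtain ⟨T, hT, hxT⟩ := hx
    exact ⟨T, hT, hxT, fun h => hx' (interior_mono (hS.convexHull_subset (hS.mem_tri.1 hT)) h)⟩
  · exact (measure_biUnion_null_iff hS.tri.countable_toSet).2
      fun T _ => volume_convexHull_diff_interior T

end

section

/-! ### Weak divergence of piecewise polynomial fields -/

/-- The sum of the orientations of the triangles `e, f, c` with `c ∈ T`; for an edge of a
triangle `T` this is the orientation of the edge with respect to `T`. -/
def edgeSign (T : Finset Plane) (e f : Plane) : ℝ :=
  ∑ c ∈ T, Real.sign (cross (f - e) (c - e))

lemma edgeSign_swap (T : Finset Plane) (e f : Plane) : edgeSign T f e = -edgeSign T e f := by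
  unfold edgeSign
  rw [← Finset.sum_neg_distrib]
  refine Finset.sum_congr rfl fun c _ => ?_
  rw [← Real.sign_neg]
  congr 1
  simp only [cross, PiLp.sub_apply]
  ring

lemma edgeFlux_self (a : Plane) (F : Plane → Plane) : edgeFlux a a F = 0 := by
  simp [edgeFlux, cross]

/-- Twice the outward flux through the boundary of a triangle, as a sum over all ordered edges. -/
def triangleFlux (T : Finset Plane) (F : Plane → Plane) : ℝ :=
  ∑ z ∈ T ×ˢ T, edgeSign T z.1 z.2 * edgeFlux z.1 z.2 F

/-- Reversing an edge changes the sign of both its orientation and its flux, so each edge is counted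
twice with the same value. Summing over ordered pairs makes the definition independent of the order
of the vertices. -/
lemma triangleFlux_eq {a b c : Plane} (hc : cross (b - a) (c - a) ≠ 0) (F : Plane → Plane) :
    triangleFlux {a, b, c} F = 2 * (Real.sign (cross (b - a) (c - a)) *
      (edgeFlux a b F + edgeFlux b c F + edgeFlux c a F)) := by
  obtain ⟨nab, nbc, nca⟩ := ne_of_cross_ne_zero hc
  have hs : ∀ f : Plane → ℝ, ∑ x ∈ ({a, b, c} : Finset Plane), f x = f a + f b + f c := fun f => by
    rw [Finset.sum_insert (by simp [nab, nca.symm]), Finset.sum_pair nbc, add_assoc]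
  have h1 : edgeSign {a, b, c} a b = Real.sign (cross (b - a) (c - a)) := by
    simp [edgeSign, hs, cross_self]
    simp [cross]
  have h2 : edgeSign {a, b, c} b c = Real.sign (cross (b - a) (c - a)) := by
    have : cross (c - b) (a - b) = cross (b - a) (c - a) := by simp [cross]; ring
    simp [edgeSign, hs, cross_self, this]
    simp [cross]
  have h3 : edgeSign {a, b, c} c a = Real.sign (cross (b - a) (c - a)) := by
    have : cross (a - c) (b - c) = cross (b - a) (c - a) := by simp [cross]; ring
    simp [edgeSign, hs, cross_self, this]
    simp [cross]
  rw [triangleFlux, Finset.sum_product, hs]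
  simp only [hs, edgeFlux_self, mul_zero]
  rw [edgeSign_swap _ a b, edgeSign_swap _ b c, edgeSign_swap _ c a, edgeFlux_swap a b,
    edgeFlux_swap b c, edgeFlux_swap c a, h1, h2, h3]
  ring

variable {S : Geometry.SimplicialComplex ℝ Plane} {T T' : Finset Plane}

lemma sign_mul_sign {x : ℝ} (hx : x ≠ 0) : Real.sign x * Real.sign x = 1 := by
  rcases hx.lt_or_gt with h | h
  · rw [Real.sign_of_neg h]; norm_num
  · rw [Real.sign_of_pos h]; norm_num

/-- Green's formula on a triangle of the triangulation. -/
lemma green_triangle (hT : T ∈ triangles S) {u : Plane → Plane} (hu : ContDiff ℝ 1 u)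
    {ψ : Plane → ℝ} (hψ : ContDiff ℝ 1 ψ) :
    2 * ∫ x in convexHull ℝ (T : Set Plane),
      (ψ x * jacTrace (fderiv ℝ u x) + fderiv ℝ ψ x (u x)) =
      triangleFlux T (fun x => ψ x • u x) := by
  obtain ⟨a, b, c, rfl, hc⟩ := exists_vertices hT
  rw [triangleFlux_eq hc, ← green_smooth hc hu hψ, ← mul_assoc (Real.sign _), sign_mul_sign hc,
    one_mul, coe_triple]

variable {n : ℕ} {P : Polygon Plane n} {K : Set Plane}

/-- Exchanging the sums collects the contributions of all triangles at each ordered edge. -/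
lemma sum_triangleFlux (hS : IsSubtriangulation P K S) (F : Finset Plane → Plane → Plane) :
    ∑ T ∈ hS.tri, triangleFlux T (F T) = ∑ z ∈ hS.tri.biUnion id ×ˢ hS.tri.biUnion id,
      ∑ T ∈ hS.tri with z.1 ∈ T ∧ z.2 ∈ T, edgeSign T z.1 z.2 * edgeFlux z.1 z.2 (F T) := by
  unfold triangleFlux
  refine Finset.sum_comm' fun T z => ?_
  simp only [Finset.mem_product, Finset.mem_filter, Finset.mem_biUnion, id]
  constructor
  · rintro ⟨h1, h2, h3⟩
    exact ⟨⟨h1, h2, h3⟩, ⟨T, h1, h2⟩, ⟨T, h1, h3⟩⟩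
  · rintro ⟨⟨h1, h2, h3⟩, -⟩
    exact ⟨h1, h2, h3⟩

lemma exists_cross_eq_one {u : Plane} (hu : u ≠ 0) : ∃ w : Plane, cross w u = 1 := by
  have h : u 0 ^ 2 + u 1 ^ 2 ≠ 0 := by
    rw [sq, sq, ← plane_norm_sq]
    simpa using hu
  refine ⟨!₂[u 1 / (u 0 ^ 2 + u 1 ^ 2), -u 0 / (u 0 ^ 2 + u 1 ^ 2)], ?_⟩
  simp only [cross, Matrix.cons_val_zero, Matrix.cons_val_one]
  field_simp
  ring

lemma edgeFlux_eq_zero {e f : Plane} {F : Plane → Plane}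
    (h : ∀ x ∈ segment ℝ e f, F x = 0) : edgeFlux e f F = 0 := by
  have h0 : EqOn (fun t : ℝ => cross (F (AffineMap.lineMap e f t)) (f - e)) (fun _ => 0)
      (uIcc 0 1) := fun t ht => by
    rw [uIcc_of_le zero_le_one] at ht
    simp only
    rw [h _ (by rw [segment_eq_image_lineMap]; exact ⟨t, ht, rfl⟩)]
    simp [cross]
  rw [edgeFlux, intervalIntegral.integral_congr h0, intervalIntegral.integral_zero]

lemma mem_faces_pair (hT : T ∈ triangles S) {e f : Plane} (he : e ∈ T) (hf : f ∈ T) :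
    ({e, f} : Finset Plane) ∈ S.faces := by
  refine S.down_closed hT.1 ?_ ⟨e, by simp⟩
  intro x hx
  simp only [Finset.mem_insert, Finset.mem_singleton] at hx
  rcases hx with rfl | rfl <;> assumption

/-- A point in the relative interior of an edge does not lie on other edges. -/
lemma notMem_segment_of_mem_openSegment {e f e' f' x : Plane} (hef : e ≠ f)
    (h : ({e, f} : Finset Plane) ∈ S.faces) (h' : ({e', f'} : Finset Plane) ∈ S.faces)
    (hx : x ∈ openSegment ℝ e f) (hne : ¬(e' = e ∧ f' = f)) (hne' : ¬(e' = f ∧ f' = e)) :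
    x ∉ segment ℝ e' f' := by
  intro hx'
  have h1 : x ∈ convexHull ℝ (({e, f} : Finset Plane) : Set Plane) ∩
      convexHull ℝ (({e', f'} : Finset Plane) : Set Plane) := by
    simp only [Finset.coe_insert, Finset.coe_singleton, convexHull_pair]
    exact ⟨openSegment_subset_segment _ _ _ hx, hx'⟩
  have h2 := S.inter_subset_convexHull h h' h1
  simp only [Finset.coe_insert, Finset.coe_singleton] at h2
  have hxe : x ≠ e := by
    rintro rfl
    exact hef (left_mem_openSegment_iff.1 hx)
  have hxf : x ≠ f := by
    rintro rfl
    exact hef (right_mem_openSegment_iff.1 hx)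
  -- Distinct edges share at most one vertex, and their intersection lies in the hull of the common
  -- vertices; the point `x` would have to be that vertex.
  have h3 : ({e, f} ∩ {e', f'} : Set Plane) ⊆ {e} ∨ ({e, f} ∩ {e', f'} : Set Plane) ⊆ {f} := by
    by_cases he : e ∈ ({e', f'} : Set Plane)
    · by_cases hf : f ∈ ({e', f'} : Set Plane)
      · exfalso
        simp only [mem_insert_iff, mem_singleton_iff] at he hf
        rcases he with rfl | rfl <;> rcases hf with rfl | rfl <;> simp_all
      · left
        rintro y ⟨rfl | rfl, hy⟩
        exacts [rfl, absurd hy hf]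
    · right
      rintro y ⟨rfl | rfl, hy⟩
      exacts [absurd hy he, rfl]
  rcases h3 with h3 | h3
  · exact hxe (by simpa using convexHull_mono h3 h2)
  · exact hxf (by simpa using convexHull_mono h3 h2)

/-- The triangles on both sides of an interior edge have opposite orientations. -/
lemma sum_edgeSign_eq_zero (hS : IsSubtriangulation P K S) (hKc : IsCompact K) {e f x : Plane}
    (hef : e ≠ f) (hx : x ∈ openSegment ℝ e f) (hxK : x ∈ interior K) :
    ∑ T ∈ hS.tri with e ∈ T ∧ f ∈ T, edgeSign T e f = 0 := by
  classical
  rcases (hS.tri.filter (fun T => e ∈ T ∧ f ∈ T)).eq_empty_or_nonempty with h0 | ⟨T₀, hT₀⟩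
  · rw [h0, Finset.sum_empty]
  rw [Finset.mem_filter, hS.mem_tri] at hT₀
  have hface := mem_faces_pair hT₀.1 hT₀.2.1 hT₀.2.2
  set V := hS.tri.biUnion id with hV
  -- the union of the other edges
  set Z := (V ×ˢ V).filter (fun z : Plane × Plane => ¬(z.1 = e ∧ z.2 = f) ∧ ¬(z.1 = f ∧ z.2 = e) ∧
    ({z.1, z.2} : Finset Plane) ∈ S.faces) with hZ
  have hZc : IsClosed (⋃ z ∈ Z, segment ℝ z.1 z.2) := by
    refine isClosed_biUnion_finset fun z _ => ?_
    rw [← convexHull_pair]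
    exact ((Set.toFinite _).isCompact_convexHull ℝ).isClosed
  have hxZ : x ∉ ⋃ z ∈ Z, segment ℝ z.1 z.2 := by
    simp only [mem_iUnion, exists_prop, not_exists, not_and]
    intro z hz
    rw [hZ, Finset.mem_filter] at hz
    exact notMem_segment_of_mem_openSegment hef hface hz.2.2.2 hx hz.2.1 hz.2.2.1
  have hnhds : interior K ∩ (⋃ z ∈ Z, segment ℝ z.1 z.2)ᶜ ∈ 𝓝 x :=
    (isOpen_interior.inter hZc.isOpen_compl).mem_nhds ⟨hxK, hxZ⟩
  obtain ⟨r, hr, hball⟩ := Metric.nhds_basis_closedBall.mem_iff.1 hnhds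
  let B : ContDiffBump x := ⟨r / 2, r, by positivity, by linarith⟩
  have hB1 : ContDiff ℝ ∞ B := B.contDiff
  have hBt : IsTestFunction K B := by
    refine ⟨hB1, B.hasCompactSupport, ?_⟩
    rw [B.tsupport_eq]
    exact hball.trans inter_subset_left
  have hB0 : ∀ y, y ∉ Metric.closedBall x r → B y = 0 := fun y hy => by
    rw [← B.tsupport_eq] at hy
    exact image_eq_zero_of_notMem_tsupport hy
  -- a constant field that is not tangential
  obtain ⟨w, hw⟩ : ∃ w : Plane, cross w (f - e) = 1 :=
    exists_cross_eq_one (sub_ne_zero.2 hef.symm)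
  have hflux : ∀ T ∈ triangles S, IntegrableOn (fun x => fderiv ℝ B x w)
      (convexHull ℝ (T : Set Plane)) := fun T hT =>
    ((hB1.continuous_fderiv (by simp)).clm_apply continuous_const).continuousOn.integrableOn_compact
      (isCompact_convexHull_triangle T)
  -- The total is twice the integral over `K` of a directional derivative of the bump, hence zero.
  -- As the bump avoids all other edges, only the edge from `e` to `f` contributes, with nonzero
  -- flux, so its orientations must cancel. No count of the triangles at the edge is needed.
  have hsum : ∑ T ∈ hS.tri, triangleFlux T (fun x => B x • w) = 0 := by
    have h1 : ∀ T ∈ hS.tri, triangleFlux T (fun x => B x • w) =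
        2 * ∫ x in convexHull ℝ (T : Set Plane), fderiv ℝ B x w := fun T hT => by
      rw [← green_triangle (hS.mem_tri.1 hT) contDiff_const (hB1.of_le (by simp))]
      simp
    rw [Finset.sum_congr rfl h1, ← Finset.mul_sum, ← hS.setIntegral_eq_sum hflux]
    have h2 := (MemH1With.memHDivWith hKc
      (memH1With_of_contDiff hKc (contDiff_const (c := w)))).2.2 B hBt
    rw [h2]
    simp
  rw [sum_triangleFlux] at hsum
  simp only [← Finset.sum_mul] at hsum
  set J := edgeFlux e f (fun x => B x • w) with hJ
  have hJpos : 0 < J := by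
    rw [hJ, edgeFlux]
    simp only [cross_smul_left, hw, mul_one]
    rw [openSegment_eq_image_lineMap] at hx
    obtain ⟨t, ht, rfl⟩ := hx
    refine intervalIntegral.integral_pos zero_lt_one ?_ (fun s _ => B.nonneg)
      ⟨t, Ioo_subset_Icc_self ht, ?_⟩
    · exact (B.continuous.comp AffineMap.lineMap_continuous).continuousOn
    · rw [B.one_of_mem_closedBall (Metric.mem_closedBall_self (by positivity))]
      exact one_pos
  have hmem : ∀ y : Plane, y ∈ T₀ → y ∈ V := fun y hy =>
    Finset.mem_biUnion.2 ⟨T₀, hS.mem_tri.2 hT₀.1, hy⟩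
  -- The edge occurs in both orders, with equal contributions.
  rw [Finset.sum_eq_add_of_mem (e, f) (f, e)
    (Finset.mk_mem_product (hmem _ hT₀.2.1) (hmem _ hT₀.2.2))
    (Finset.mk_mem_product (hmem _ hT₀.2.2) (hmem _ hT₀.2.1))
    (fun h => hef (congrArg Prod.fst h))] at hsum
  · simp only [edgeSign_swap _ e f, edgeFlux_swap e f, Finset.sum_neg_distrib] at hsum
    rw [← hJ] at hsum
    have h3 : ∀ T : Finset Plane, (f ∈ T ∧ e ∈ T) = (e ∈ T ∧ f ∈ T) := fun T => propext and_comm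
    simp only [h3] at hsum
    have h4 : (∑ T ∈ hS.tri with e ∈ T ∧ f ∈ T, edgeSign T e f) * J = 0 := by linarith
    exact (mul_eq_zero.1 h4).resolve_right hJpos.ne'
  · rintro ⟨e', f'⟩ hz ⟨hz1, hz2⟩
    rw [Ne, Prod.mk.injEq] at hz1 hz2
    by_cases hface' : ({e', f'} : Finset Plane) ∈ S.faces
    · rw [edgeFlux_eq_zero, mul_zero]
      intro y hy
      rw [hB0 y, zero_smul]
      intro hyB
      refine (hball hyB).2 ?_
      simp only [mem_iUnion, exists_prop]
      exact ⟨(e', f'), Finset.mem_filter.2 ⟨hz, hz1, hz2, hface'⟩, hy⟩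
    · rw [Finset.sum_eq_zero, zero_mul]
      intro T hT
      rw [Finset.mem_filter, hS.mem_tri] at hT
      exact absurd (mem_faces_pair hT.1 hT.2.1 hT.2.2) hface'

end

/-! ### Gluing piecewise polynomials with matching normal components -/

section

variable {S : Geometry.SimplicialComplex ℝ Plane} {T T' : Finset Plane}
variable {n : ℕ} {P : Polygon Plane n} {K : Set Plane}

lemma jacTrace_fderiv_evalVec (p : Fin 2 → Poly2) (x : Plane) :
    jacTrace (fderiv ℝ (evalVec p) x) = evalPoly (divPoly p) x := by
  rw [← divergence_eq_jacTrace, divergence_evalVec]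

/-- A piecewise polynomial field with matching normal components has a weak divergence, which is
the piecewise divergence. -/
lemma hasWeakDiv_of_matching (hS : IsSubtriangulation P K S)
    {p : Finset Plane → Fin 2 → Poly2} {u : Plane → Plane} {d : Plane → ℝ}
    (hu : ∀ T ∈ triangles S, ∀ᵐ x ∂(volume.restrict (convexHull ℝ (T : Set Plane))),
      u x = evalVec (p T) x)
    (hd : ∀ T ∈ triangles S, ∀ᵐ x ∂(volume.restrict (convexHull ℝ (T : Set Plane))),
      d x = evalPoly (divPoly (p T)) x)
    (hmatch : ∀ T ∈ triangles S, ∀ T' ∈ triangles S, ∀ e f, e ∈ T → f ∈ T → e ∈ T' → f ∈ T' →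
      ∀ t : ℝ, cross (evalVec (p T) (AffineMap.lineMap e f t)) (f - e) =
        cross (evalVec (p T') (AffineMap.lineMap e f t)) (f - e)) (hKc : IsCompact K) :
    HasWeakDiv K u d := by
  intro φ hφ
  have hT : ∀ T : Finset Plane, IsCompact (convexHull ℝ (T : Set Plane)) :=
    isCompact_convexHull_triangle
  have hφd : Continuous (fderiv ℝ φ) := continuous_fderiv_testFunction hφ
  have hc1 : ∀ T, Continuous (fun x => fderiv ℝ φ x (evalVec (p T) x)) := fun T =>
    hφd.clm_apply (continuous_evalVec _)
  have hc2 : ∀ T, Continuous (fun x => φ x * evalPoly (divPoly (p T)) x) := fun T =>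
    hφ.1.continuous.mul (continuous_evalPoly _)
  have e1 : ∀ T ∈ triangles S, (fun x => fderiv ℝ φ x (u x)) =ᵐ[volume.restrict
      (convexHull ℝ (T : Set Plane))] (fun x => fderiv ℝ φ x (evalVec (p T) x)) := fun T h => by
    filter_upwards [hu T h] with x hx
    rw [hx]
  have e2 : ∀ T ∈ triangles S, (fun x => φ x * d x) =ᵐ[volume.restrict
      (convexHull ℝ (T : Set Plane))] (fun x => φ x * evalPoly (divPoly (p T)) x) := fun T h => by
    filter_upwards [hd T h] with x hx
    rw [hx]
  rw [eq_neg_iff_add_eq_zero,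
    hS.setIntegral_eq_sum fun T h => ((hc1 T).continuousOn.integrableOn_compact (hT T)).congr
      (e1 T h).symm,
    hS.setIntegral_eq_sum fun T h => ((hc2 T).continuousOn.integrableOn_compact (hT T)).congr
      (e2 T h).symm, ← Finset.sum_add_distrib]
  have h1 : ∀ T ∈ hS.tri, (∫ x in convexHull ℝ (T : Set Plane), fderiv ℝ φ x (u x)) +
      ∫ x in convexHull ℝ (T : Set Plane), φ x * d x =
      1 / 2 * triangleFlux T (fun x => φ x • evalVec (p T) x) := fun T h => by
    rw [hS.mem_tri] at h
    rw [integral_congr_ae (e1 T h), integral_congr_ae (e2 T h), add_comm,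
      ← integral_add ((hc2 T).continuousOn.integrableOn_compact (hT T))
        ((hc1 T).continuousOn.integrableOn_compact (hT T)),
      ← green_triangle h (contDiff_evalVec (p T)) (hφ.1.of_le (by simp))]
    simp only [jacTrace_fderiv_evalVec]
    ring
  rw [Finset.sum_congr rfl h1, ← Finset.mul_sum,
    sum_triangleFlux hS (fun T x => φ x • evalVec (p T) x), Finset.sum_eq_zero, mul_zero]
  rintro ⟨e, f⟩ -
  simp only
  by_cases hef : e = f
  · subst hef
    simp [edgeFlux_self]
  rcases (hS.tri.filter (fun T => e ∈ T ∧ f ∈ T)).eq_empty_or_nonempty with h0 | ⟨T₀, hT₀⟩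
  · rw [h0, Finset.sum_empty]
  rw [Finset.mem_filter, hS.mem_tri] at hT₀
  -- By the matching condition all triangles at this edge see the same flux, which can be computed
  -- from `T₀` and factored out.
  have h2 : ∀ T ∈ hS.tri.filter (fun T => e ∈ T ∧ f ∈ T),
      edgeSign T e f * edgeFlux e f (fun x => φ x • evalVec (p T) x) =
      edgeSign T e f * edgeFlux e f (fun x => φ x • evalVec (p T₀) x) := fun T h => by
    rw [Finset.mem_filter, hS.mem_tri] at h
    congr 1
    unfold edgeFlux
    simp only [cross_smul_left]
    congr 1
    ext t
    rw [hmatch T h.1 T₀ hT₀.1 e f h.2.1 h.2.2 hT₀.2.1 hT₀.2.2 t]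
  rw [Finset.sum_congr rfl h2, ← Finset.sum_mul]
  -- At an interior edge the orientations cancel. Otherwise the open edge misses the interior of
  -- `K`, where the test function is supported, so the flux itself vanishes.
  by_cases hx : ∃ x ∈ openSegment ℝ e f, x ∈ interior K
  · obtain ⟨x, hx, hxK⟩ := hx
    rw [sum_edgeSign_eq_zero hS hKc hef hx hxK, zero_mul]
  · push Not at hx
    rw [edgeFlux_eq_zero, mul_zero]
    intro x hx'
    have h3 : φ x = 0 := by
      have h4 : IsClosed {y | φ y = 0} := isClosed_eq hφ.1.continuous continuous_const
      have h5 : openSegment ℝ e f ⊆ {y | φ y = 0} := fun y hy =>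
        image_eq_zero_of_notMem_tsupport fun h => hx y hy (hφ.2.2 h)
      have h6 := closure_minimal h5 h4
      rw [closure_openSegment] at h6
      exact h6 hx'
    rw [h3, zero_smul]

end

/-! ### The energy projection -/

lemma integrableOn_evalPoly {K : Set Plane} (hK : IsCompact K) (p : Poly2) :
    IntegrableOn (evalPoly p) K := (continuous_evalPoly p).continuousOn.integrableOn_compact hK

/-- The integral of a polynomial over a compact set. -/
def polyIntegral {K : Set Plane} (hK : IsCompact K) : Poly2 →ₗ[ℝ] ℝ where
  toFun p := ∫ x in K, evalPoly p x
  map_add' p q := by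
    rw [← integral_add (integrableOn_evalPoly hK p) (integrableOn_evalPoly hK q)]
    simp only [evalPoly_add]
  map_smul' c p := by
    rw [RingHom.id_apply, smul_eq_mul, ← integral_const_mul]
    simp only [evalPoly_smul]

lemma polyIntegral_apply {K : Set Plane} (hK : IsCompact K) (p : Poly2) :
    polyIntegral hK p = ∫ x in K, evalPoly p x := rfl

lemma setIntegral_apply_coord {K : Set Plane} {u : Plane → Plane} (hu : IntegrableOn u K)
    (i : Fin 2) : (∫ x in K, u x) i = ∫ x in K, u x i :=
  ((EuclideanSpace.proj i : Plane →L[ℝ] ℝ).integral_comp_comm hu).symm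

lemma frob_fderiv_evalVec (q : Fin 2 → Poly2) (x : Plane) (A : Plane →L[ℝ] Plane) :
    frob (fderiv ℝ (evalVec q) x) A = ∑ i : Fin 2, ∑ j : Fin 2,
      evalPoly (MvPolynomial.pderiv i (q j)) x * (A (EuclideanSpace.single i 1)) j := by
  unfold frob
  refine Finset.sum_congr rfl fun i _ => ?_
  rw [PiLp.inner_apply]
  refine Finset.sum_congr rfl fun j _ => ?_
  rw [fderiv_evalVec_apply, EuclideanSpace.inner_single_right]
  simp [gradPoly, mul_comm]

/-- The Frobenius inner product of the Jacobians of two vector polynomials. -/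
def frobPoly (q p : Fin 2 → Poly2) : Poly2 :=
  ∑ i : Fin 2, ∑ j : Fin 2, MvPolynomial.pderiv i (q j) * MvPolynomial.pderiv i (p j)

lemma frob_fderiv_fderiv (q p : Fin 2 → Poly2) (x : Plane) :
    frob (fderiv ℝ (evalVec q) x) (fderiv ℝ (evalVec p) x) = evalPoly (frobPoly q p) x := by
  rw [frob_fderiv_evalVec]
  simp only [fderiv_evalVec_apply, EuclideanSpace.inner_single_right, frobPoly,
    Fin.sum_univ_two, evalPoly_add, evalPoly_mul]
  simp [gradPoly]

lemma integrableOn_frob {K : Set Plane} (hK : IsCompact K) {G : Plane → Plane →L[ℝ] Plane}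
    (hG : IntegrableOn G K) (q : Fin 2 → Poly2) :
    IntegrableOn (fun x => frob (fderiv ℝ (evalVec q) x) (G x)) K := by
  simp only [frob_fderiv_evalVec]
  refine integrable_finsetSum _ fun i _ => integrable_finsetSum _ fun j _ => ?_
  exact IntegrableOn.continuous_smul hK ((EuclideanSpace.proj j : Plane →L[ℝ] ℝ).integrable_comp
    (hG.apply_continuousLinearMap (EuclideanSpace.single i 1))) (continuous_evalPoly _)

lemma frob_sub_right (A B C : Plane →L[ℝ] Plane) : frob A (B - C) = frob A B - frob A C := by
  simp [frob, inner_sub_right, Finset.sum_sub_distrib]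

/-- The bilinear form of the energy projection. -/
def energyForm {K : Set Plane} (hK : IsCompact K) (k : ℕ) :
    vecPolySub k →ₗ[ℝ] Module.Dual ℝ (vecPolySub k) :=
  LinearMap.mk₂ ℝ (fun p q => polyIntegral hK (frobPoly q.1 p.1) +
      ∑ i : Fin 2, polyIntegral hK (q.1 i) * polyIntegral hK (p.1 i))
    (fun p p' q => by
      simp only [frobPoly, Fin.sum_univ_two, Submodule.coe_add, Pi.add_apply, map_add, mul_add]
      ring)
    (fun c p q => by
      simp only [frobPoly, Fin.sum_univ_two, Submodule.coe_smul, Pi.smul_apply, Derivation.map_smul, map_smul, map_add,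
        mul_smul_comm, smul_eq_mul]
      ring)
    (fun p q q' => by
      simp only [frobPoly, Fin.sum_univ_two, Submodule.coe_add, Pi.add_apply, map_add, add_mul]
      ring)
    (fun c p q => by
      simp only [frobPoly, Fin.sum_univ_two, Submodule.coe_smul, Pi.smul_apply, Derivation.map_smul, map_smul, map_add,
        smul_mul_assoc, smul_eq_mul]
      ring)

lemma energyForm_apply {K : Set Plane} (hK : IsCompact K) (k : ℕ) (p q : vecPolySub k) :
    energyForm hK k p q = polyIntegral hK (frobPoly q.1 p.1) +
      ∑ i : Fin 2, polyIntegral hK (q.1 i) * polyIntegral hK (p.1 i) := rfl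

/-- The right-hand side of the energy projection. -/
def energyRhs {K : Set Plane} (hK : IsCompact K) (k : ℕ) {G : Plane → Plane →L[ℝ] Plane}
    (hG : IntegrableOn G K) (r : Plane) : Module.Dual ℝ (vecPolySub k) where
  toFun q := (∫ x in K, frob (fderiv ℝ (evalVec q.1) x) (G x)) +
    ∑ i : Fin 2, polyIntegral hK (q.1 i) * r i
  map_add' q q' := by
    have : ∀ x, frob (fderiv ℝ (evalVec (q + q').1) x) (G x) =
        frob (fderiv ℝ (evalVec q.1) x) (G x) + frob (fderiv ℝ (evalVec q'.1) x) (G x) := fun x => by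
      simp only [frob_fderiv_evalVec, Fin.sum_univ_two, Submodule.coe_add, Pi.add_apply, map_add,
        evalPoly_add]
      ring
    simp only [this]
    rw [integral_add (integrableOn_frob hK hG _) (integrableOn_frob hK hG _)]
    simp only [Fin.sum_univ_two, Submodule.coe_add, Pi.add_apply, map_add]
    ring
  map_smul' c q := by
    have : ∀ x, frob (fderiv ℝ (evalVec (c • q).1) x) (G x) =
        c * frob (fderiv ℝ (evalVec q.1) x) (G x) := fun x => by
      simp only [frob_fderiv_evalVec, Fin.sum_univ_two, Submodule.coe_smul, Pi.smul_apply,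
        Derivation.map_smul, evalPoly_smul]
      ring
    simp only [this]
    rw [integral_const_mul]
    simp only [Fin.sum_univ_two, Submodule.coe_smul, Pi.smul_apply, map_smul, RingHom.id_apply,
      smul_eq_mul]
    ring

lemma energyRhs_apply {K : Set Plane} (hK : IsCompact K) (k : ℕ) {G : Plane → Plane →L[ℝ] Plane}
    (hG : IntegrableOn G K) (r : Plane) (q : vecPolySub k) :
    energyRhs hK k hG r q = (∫ x in K, frob (fderiv ℝ (evalVec q.1) x) (G x)) +
      ∑ i : Fin 2, polyIntegral hK (q.1 i) * r i := rfl

lemma eq_C_of_pderiv_eq_zero {p : Poly2} (h : ∀ i, MvPolynomial.pderiv i p = 0) :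
    ∃ c, p = MvPolynomial.C c := by
  have h1 : ∀ x, fderiv ℝ (evalPoly p) x = 0 := fun x => by
    rw [fderiv_evalPoly]
    ext y
    have : evalVec (gradPoly p) x = 0 := by ext i; simp [gradPoly, h]
    simp [this]
  have hdiff : Differentiable ℝ (evalPoly p) := (contDiff_evalPoly p (n := 1)).differentiable one_ne_zero
  refine ⟨evalPoly p 0, sub_eq_zero.1 (poly_eq_zero_of_eqOn isOpen_univ univ_nonempty fun x _ => ?_)⟩
  rw [evalPoly_sub, evalPoly_C, is_const_of_fderiv_eq_zero hdiff h1 x 0, sub_self]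

/-- The form of `p` with itself is a sum of squares. The Dirichlet part forces `p` to be constant,
and the product of means, added for this purpose, forces the constant to be zero. -/
lemma energyForm_injective {K : Set Plane} (hK : IsCompact K) (hne : (interior K).Nonempty)
    (k : ℕ) : Function.Injective (energyForm hK k) := by
  rw [← LinearMap.ker_eq_bot, LinearMap.ker_eq_bot']
  intro p hp
  have h0 := energyForm_apply hK k p p
  rw [hp, LinearMap.zero_apply] at h0
  have hsq : ∀ x, evalPoly (frobPoly p.1 p.1) x =
      ∑ i : Fin 2, ∑ j : Fin 2, evalPoly (MvPolynomial.pderiv i (p.1 j)) x ^ 2 := fun x => by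
    simp only [frobPoly, Fin.sum_univ_two, evalPoly_add, evalPoly_mul, sq]
  have hnn : ∀ x, 0 ≤ evalPoly (frobPoly p.1 p.1) x := fun x => by
    rw [hsq]; positivity
  have h1 : 0 ≤ polyIntegral hK (frobPoly p.1 p.1) := integral_nonneg hnn
  rw [Fin.sum_univ_two] at h0
  have h2 : polyIntegral hK (frobPoly p.1 p.1) = 0 := by
    nlinarith [mul_self_nonneg (polyIntegral hK (p.1 0)), mul_self_nonneg (polyIntegral hK (p.1 1))]
  have h3 : ∀ i, polyIntegral hK (p.1 i) = 0 := by
    rw [h2] at h0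
    have ha := mul_self_nonneg (polyIntegral hK (p.1 0))
    have hb := mul_self_nonneg (polyIntegral hK (p.1 1))
    intro i
    fin_cases i
    · exact mul_self_eq_zero.1 (by simp only [Fin.zero_eta]; linarith)
    · exact mul_self_eq_zero.1 (by simp only [Fin.mk_one]; linarith)
  have h4 := poly_eq_zero_of_integral_eq_zero hK hne (fun x _ => hnn x) h2
  have h5 : ∀ i j, MvPolynomial.pderiv i (p.1 j) = 0 := fun i j => by
    refine poly_eq_zero_of_eqOn isOpen_univ univ_nonempty fun x _ => ?_
    have h6 := hsq x
    rw [h4, evalPoly_zero, Fin.sum_univ_two, Fin.sum_univ_two, Fin.sum_univ_two] at h6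
    have h7 : evalPoly (MvPolynomial.pderiv i (p.1 j)) x ^ 2 = 0 := by
      fin_cases i <;> fin_cases j <;> simp only [Fin.zero_eta, Fin.mk_one] <;>
        refine le_antisymm ?_ (sq_nonneg _) <;>
        linarith [sq_nonneg (evalPoly (MvPolynomial.pderiv 0 (p.1 0)) x),
          sq_nonneg (evalPoly (MvPolynomial.pderiv 0 (p.1 1)) x),
          sq_nonneg (evalPoly (MvPolynomial.pderiv 1 (p.1 0)) x),
          sq_nonneg (evalPoly (MvPolynomial.pderiv 1 (p.1 1)) x)]
    exact pow_eq_zero_iff two_ne_zero |>.1 h7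
  have hvol : volume.real K ≠ 0 := by
    have : 0 < volume K := lt_of_lt_of_le (isOpen_interior.measure_pos _ hne)
      (measure_mono interior_subset)
    exact (ENNReal.toReal_pos this.ne' hK.measure_lt_top.ne).ne'
  ext1
  ext1 j
  obtain ⟨c, hc⟩ := eq_C_of_pderiv_eq_zero fun i => h5 i j
  have h8 := h3 j
  rw [hc, polyIntegral_apply] at h8
  simp only [evalPoly_C, setIntegral_const, smul_eq_mul, mul_eq_zero, hvol, false_or] at h8
  rw [hc, h8]
  simp

lemma energyForm_bijective {K : Set Plane} (hK : IsCompact K) (hne : (interior K).Nonempty)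
    (k : ℕ) : Function.Bijective (energyForm hK k) :=
  ⟨energyForm_injective hK hne k, surjective_of_injective_of_finrank_le
    (energyForm_injective hK hne k) Subspace.dual_finrank_eq.le⟩

lemma C_mem_vecPolyDeg (k : ℕ) (j : Fin 2) :
    (fun i => if i = j then (1 : Poly2) else 0) ∈ vecPolySub k := by
  rw [mem_vecPolySub]
  intro i
  by_cases h : i = j
  · simp only [h, if_true]
    exact MvPolynomial.C_1 (R := ℝ) (σ := Fin 2) ▸ C_mem_polyDeg (by positivity) 1
  · simp only [h, if_false]
    exact Submodule.zero_mem _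

/-- A vector polynomial represents the energy projection if and only if it solves the variational
problem. -/
lemma energyForm_eq_iff {K : Set Plane} (hK : IsCompact K) (hne : (interior K).Nonempty) (k : ℕ)
    {G : Plane → Plane →L[ℝ] Plane} (hG : IntegrableOn G K) (r : Plane) (p : vecPolySub k) :
    energyForm hK k p = energyRhs hK k hG r ↔
      (∀ q ∈ vecPolyDeg k, ∫ x in K, frob (fderiv ℝ (evalVec q) x)
        (G x - fderiv ℝ (evalVec p.1) x) = 0) ∧ ∀ i, polyIntegral hK (p.1 i) = r i := by
  have hsub : ∀ q : Fin 2 → Poly2, ∫ x in K, frob (fderiv ℝ (evalVec q) x)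
      (G x - fderiv ℝ (evalVec p.1) x) = (∫ x in K, frob (fderiv ℝ (evalVec q) x) (G x)) -
        polyIntegral hK (frobPoly q p.1) := fun q => by
    simp only [frob_sub_right, frob_fderiv_fderiv]
    rw [integral_sub (integrableOn_frob hK hG q) (integrableOn_evalPoly hK _), polyIntegral_apply]
  have hvol : volume.real K ≠ 0 := by
    have : 0 < volume K := lt_of_lt_of_le (isOpen_interior.measure_pos _ hne)
      (measure_mono interior_subset)
    exact (ENNReal.toReal_pos this.ne' hK.measure_lt_top.ne).ne'
  constructor
  · intro h
    -- Constant test fields have zero gradient, so they isolate the mean condition, multiplied by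
    -- the nonzero area of `K`.
    have h1 : ∀ i, polyIntegral hK (p.1 i) = r i := fun j => by
      have h2 := LinearMap.congr_fun h ⟨_, C_mem_vecPolyDeg k j⟩
      rw [energyForm_apply, energyRhs_apply] at h2
      simp only [frob_fderiv_evalVec, frobPoly, apply_ite, map_zero, MvPolynomial.pderiv_one,
        ite_self, evalPoly_zero, zero_mul, Finset.sum_const_zero, integral_zero, zero_add,
        ite_mul, Finset.sum_ite_eq', Finset.mem_univ, if_true] at h2
      refine mul_left_cancel₀ ?_ h2
      rw [polyIntegral_apply]
      simpa using hvol
    refine ⟨fun q hq => ?_, h1⟩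
    have h2 := LinearMap.congr_fun h ⟨q, mem_vecPolySub.2 hq⟩
    rw [energyForm_apply, energyRhs_apply] at h2
    simp only [h1] at h2
    rw [hsub]
    linarith
  · rintro ⟨h1, h2⟩
    refine LinearMap.ext fun q => ?_
    rw [energyForm_apply, energyRhs_apply]
    have h3 := h1 q.1 (mem_vecPolySub.1 q.2)
    rw [hsub] at h3
    simp only [h2]
    linarith

/-- Once a polynomial representative is fixed, the weak Jacobian in `IsEnergyProjection` is
determined almost everywhere, and after division by `ν` the conditions become the linear system for
the bijective form. -/
lemma exists_energyProjection {K : Set Plane} (hK : IsCompact K) (hne : (interior K).Nonempty)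
    (hnull : volume (K \ interior K) = 0) {ν : ℝ} (hν : 0 < ν) (k : ℕ) (v : L2 K)
    {G : Plane → Plane →L[ℝ] Plane} (hv : MemH1With K v G) :
    ∃ z : L2 K, ∀ w, IsEnergyProjection K ν k v w ↔ w = z := by
  have hG := integrable_of_memLp_two hK hv.2.1
  have hvi := integrable_of_memLp_two hK hv.1
  obtain ⟨p, hp⟩ := (energyForm_bijective hK hne k).2 (energyRhs hK k hG (∫ x in K, v x))
  have hL : ∀ q, MemLp (evalVec q) 2 (volume.restrict K) := fun q =>
    memLp_of_continuous_isCompact (continuous_evalVec q) hK 2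
  have hmean : ∀ (q : Fin 2 → Poly2), (∫ x in K, (v x - evalVec q x) = 0) ↔
      ∀ i, polyIntegral hK (q i) = (∫ x in K, v x) i := fun q => by
    have hqi := integrable_of_memLp_two hK (hL q)
    rw [integral_sub hvi hqi, sub_eq_zero, eq_comm]
    constructor
    · intro h i
      rw [← h, setIntegral_apply_coord hqi]
      rfl
    · intro h
      ext i
      rw [← h i, setIntegral_apply_coord hqi]
      rfl
  have hiff : ∀ (q : Fin 2 → Poly2) (w : L2 K), (∀ᵐ x ∂(volume.restrict K), w x = evalVec q x) →
      q ∈ vecPolyDeg k → (IsEnergyProjection K ν k v w ↔ q = p.1) := fun q w hw hq => by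
    have hH : MemH1With K (fun x => v x - w x) (fun x => G x - fderiv ℝ (evalVec q) x) :=
      (MemH1With.sub hK hv (memH1With_of_contDiff hK (contDiff_evalVec q))).congr
        (hw.mono fun x hx => by rw [hx]) (Eventually.of_forall fun _ => rfl)
    have hmw : ∫ x in K, (v x - w x) = ∫ x in K, (v x - evalVec q x) :=
      integral_congr_ae (hw.mono fun x hx => by simp only [hx])
    have key := energyForm_eq_iff hK hne k hG (∫ x in K, v x) ⟨q, mem_vecPolySub.2 hq⟩
    rw [← hp, (energyForm_bijective hK hne k).1.eq_iff, Subtype.ext_iff] at key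
    rw [key, ← hmean, ← hmw]
    constructor
    · rintro ⟨-, ⟨G', hG', h1⟩, h2⟩
      refine ⟨fun r hr => ?_, h2⟩
      have h3 := weakDeriv_unique hnull hK hH hG'
      have h4 := (mul_eq_zero.1 (h1 r hr)).resolve_left hν.ne'
      rw [← h4]
      exact integral_congr_ae (h3.mono fun x hx => by simp only [hx])
    · rintro ⟨h1, h2⟩
      exact ⟨⟨q, hq, hw⟩, ⟨_, hH, fun r hr => by rw [h1 r hr, mul_zero]⟩, h2⟩
  refine ⟨(hL p.1).toLp _, fun w => ⟨fun h => ?_, ?_⟩⟩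
  · obtain ⟨q, hq, hw⟩ := h.1
    have h1 := (hiff q w hw hq).1 h
    refine Lp.ext ?_
    filter_upwards [hw, (hL p.1).coeFn_toLp] with x hx hx'
    rw [hx, hx', h1]
  · rintro rfl
    exact (hiff p.1 _ (hL p.1).coeFn_toLp (mem_vecPolySub.1 p.2)).2 rfl

section

variable {S : Geometry.SimplicialComplex ℝ Plane} {T T' : Finset Plane}
variable {n : ℕ} {P : Polygon Plane n} {K : Set Plane}

/-! ### Local interpolation on the triangles of a triangulation -/

lemma VanishingMoments.swap {m : ℕ} {a b : Plane} {g : Plane → Plane}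
    (h : VanishingMoments m a b g) : VanishingMoments m b a g := fun q hq => by
  rw [edgeFlux_swap, h q hq, neg_zero]

lemma VanishingMoments.sub_comm {m : ℕ} {a b : Plane} {f g : Plane → Plane}
    (h : VanishingMoments m a b fun x => f x - g x) :
    VanishingMoments m a b fun x => g x - f x := fun q hq => by
  have h1 := h q hq
  have h2 : edgeFlux a b (fun x => evalPoly q x • (g x - f x)) =
      -edgeFlux a b (fun x => evalPoly q x • (f x - g x)) := by
    unfold edgeFlux
    rw [← intervalIntegral.integral_neg]
    congr 1
    ext t
    rw [← cross_neg_left, ← smul_neg, neg_sub]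
  rw [h2, h1, neg_zero]

lemma integrable_inner_of_memLp {α : Type*} [MeasurableSpace α] {μ : Measure α}
    {f g : α → Plane} (hf : MemLp f 2 μ) (hg : MemLp g 2 μ) :
    Integrable (fun x => (inner ℝ (f x) (g x) : ℝ)) μ := by
  refine (L2.integrable_inner (𝕜 := ℝ) (hf.toLp f) (hg.toLp g)).congr ?_
  filter_upwards [hf.coeFn_toLp, hg.coeFn_toLp] with x h1 h2
  rw [h1, h2]

lemma IsSubtriangulation.memLp_two (hS : IsSubtriangulation P K S) {E : Type*}
    [NormedAddCommGroup E] {f : Plane → E}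
    (hf : ∀ T ∈ triangles S, MemLp f 2 (volume.restrict (convexHull ℝ (T : Set Plane)))) :
    MemLp f 2 (volume.restrict K) := by
  have h1 : IntegrableOn f K := hS.integrableOn fun T hT =>
    integrable_of_memLp_two (isCompact_convexHull_triangle T) (hf T hT)
  rw [memLp_two_iff_integrable_sq_norm h1.aestronglyMeasurable]
  exact hS.integrableOn fun T hT =>
    (memLp_two_iff_integrable_sq_norm (hf T hT).1).1 (hf T hT)

/-- At each point some triangle containing it is chosen. Almost every point of a triangle lies in no
other triangle, so the choice on common edges is irrelevant. -/
lemma IsSubtriangulation.exists_glue (hS : IsSubtriangulation P K S) {E : Type*}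
    [Nonempty E] (f : Finset Plane → Plane → E) :
    ∃ u : Plane → E, ∀ T ∈ triangles S,
      ∀ᵐ x ∂(volume.restrict (convexHull ℝ (T : Set Plane))), u x = f T x := by
  have h : ∀ x, ∃ y : E, (∃ T ∈ hS.tri, x ∈ convexHull ℝ (T : Set Plane)) →
      ∃ T ∈ hS.tri, x ∈ convexHull ℝ (T : Set Plane) ∧ y = f T x := fun x => by
    by_cases hx : ∃ T ∈ hS.tri, x ∈ convexHull ℝ (T : Set Plane)
    · obtain ⟨T, hT, hxT⟩ := hx
      exact ⟨f T x, fun _ => ⟨T, hT, hxT, rfl⟩⟩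
    · exact ⟨Classical.arbitrary E, fun h => absurd h hx⟩
  choose u hu using h
  refine ⟨u, fun T hT => ?_⟩
  have h1 : ∀ᵐ x ∂(volume.restrict (convexHull ℝ (T : Set Plane))), ∀ T' ∈ hS.tri, T' ≠ T →
      x ∉ convexHull ℝ (T' : Set Plane) := by
    rw [eventually_all_finset]
    intro T' hT'
    by_cases hne : T' = T
    · exact Eventually.of_forall fun x h => absurd hne h
    · refine Eventually.mono (compl_mem_ae_iff.2 ?_) fun x hx _ => hx
      rw [Measure.restrict_apply (measurableSet_convexHull_triangle T')]
      exact volume_inter_triangles (hS.mem_tri.1 hT') hT hne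
  filter_upwards [h1, ae_restrict_mem (measurableSet_convexHull_triangle T)] with x hx hxT
  obtain ⟨T', hT', hxT', hy⟩ := hu x ⟨T, hS.mem_tri.2 hT, hxT⟩
  have : T' = T := by
    by_contra hne
    exact hx T' hT' hne hxT'
  rw [hy, this]

/-- Smooth fields `φ j` that converge to `v` in `H¹(K; ℝ²)` and, on all edges of the triangulation,
to the trace `g`. -/
structure TraceData (S : Geometry.SimplicialComplex ℝ Plane) (K : Set Plane) (v : Plane → Plane)
    (G : Plane → Plane →L[ℝ] Plane) (φ : ℕ → Plane → Plane) (g : Plane → Plane) : Prop where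
  memH1 : MemH1With K v G
  approx : SmoothApprox K v G φ
  memLp : ∀ T ∈ triangles S, ∀ a ∈ T, ∀ b ∈ T, a ≠ b → MemLp g 2 (segMeasure a b)
  tendsto : ∀ T ∈ triangles S, ∀ a ∈ T, ∀ b ∈ T, a ≠ b →
    Tendsto (fun j => eLpNorm (fun x => φ j x - g x) 2 (segMeasure a b)) atTop (𝓝 0)

/-- One sequence and one edge function serve the whole triangulation. In particular the trace on an
interior edge is the same seen from either side. -/
lemma exists_traceData (hK : IsPolygonalCell P K) (hS : IsSubtriangulation P K S)
    {v : Plane → Plane} {G : Plane → Plane →L[ℝ] Plane} (hv : MemH1With K v G) :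
    ∃ φ g, TraceData S K v G φ g := by
  obtain ⟨c, r, hr, hstar⟩ := hK.star
  obtain ⟨φ, h1, h2, h3⟩ := exists_smooth_approx hK.compact hr hstar hv
  have happ : SmoothApprox K v G φ := ⟨h1, h2, h3⟩
  obtain ⟨g, hg⟩ := exists_trace hv happ (hS.tri.biUnion fun T => T.offDiag) fun e he => by
    simp only [Finset.mem_biUnion, Finset.mem_offDiag, hS.mem_tri] at he
    obtain ⟨T, hT, ha, hb, hab⟩ := he
    obtain ⟨c, hTc, hc⟩ := exists_third_vertex hT ha hb hab
    refine ⟨c, hc, ?_⟩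
    have := hS.convexHull_subset hT
    rwa [hTc, coe_triple] at this
  have hmem : ∀ T ∈ triangles S, ∀ a ∈ T, ∀ b ∈ T, a ≠ b →
      (a, b) ∈ hS.tri.biUnion fun T => T.offDiag := fun T hT a ha b hb hab =>
    Finset.mem_biUnion.2 ⟨T, hS.mem_tri.2 hT, Finset.mem_offDiag.2 ⟨ha, hb, hab⟩⟩
  exact ⟨φ, g, hv, happ, fun T hT a ha b hb hab => (hg _ (hmem T hT a ha b hb hab)).1,
    fun T hT a ha b hb hab => (hg _ (hmem T hT a ha b hb hab)).2⟩

/-- `p` is the Raviart–Thomas interpolation on the triangle `T` of a field `v` with trace `g`. -/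
structure IsLocalInterpolation (m : ℕ) (T : Finset Plane) (v g : Plane → Plane)
    (p : Fin 2 → Poly2) : Prop where
  mem : p ∈ rtPoly m
  volume_moments : ∀ q ∈ vecPolyDeg ((m : ℤ) - 1),
    ∫ x in convexHull ℝ (T : Set Plane), inner ℝ (evalVec p x - v x) (evalVec q x) = 0
  edge_moments : ∀ a ∈ T, ∀ b ∈ T, a ≠ b → VanishingMoments m a b fun x => evalVec p x - g x

section

variable {v g : Plane → Plane} {G : Plane → Plane →L[ℝ] Plane} {φ : ℕ → Plane → Plane}

lemma TraceData.memH1_triangle (h : TraceData S K v G φ g) (hS : IsSubtriangulation P K S)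
    (hT : T ∈ triangles S) : MemH1With (convexHull ℝ (T : Set Plane)) v G :=
  h.memH1.mono (hS.convexHull_subset hT)

lemma TraceData.exists_localInterpolation (h : TraceData S K v G φ g)
    (hS : IsSubtriangulation P K S) (m : ℕ) (hT : T ∈ triangles S) :
    ∃ p, IsLocalInterpolation m T v g p := by
  have hv := (h.memH1_triangle hS hT).1
  have hg := h.memLp T hT
  obtain ⟨a, b, c, rfl, hc⟩ := exists_vertices hT
  obtain ⟨nab, nbc, nca⟩ := ne_of_cross_ne_zero hc
  rw [coe_triple] at hv
  obtain ⟨p, hp, h1, h2, h3, h4⟩ := exists_rt_interpolant (m := m) hc hv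
    (hg a (by simp) b (by simp) nab) (hg b (by simp) c (by simp) nbc)
    (hg c (by simp) a (by simp) nca)
  refine ⟨p, hp, by rwa [coe_triple], fun e he f hf hef => ?_⟩
  simp only [Finset.mem_insert, Finset.mem_singleton] at he hf
  rcases he with rfl | rfl | rfl <;> rcases hf with rfl | rfl | rfl
  exacts [absurd rfl hef, h2, h4.swap, h2.swap, absurd rfl hef, h3, h4, h3.swap, absurd rfl hef]

lemma vanishingMoments_evalVec_sub {m : ℕ} {a b : Plane} (hab : a ≠ b) {p p' : Fin 2 → Poly2}
    (hg : MemLp g 2 (segMeasure a b))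
    (h : VanishingMoments m a b fun x => evalVec p x - g x)
    (h' : VanishingMoments m a b fun x => evalVec p' x - g x) :
    VanishingMoments m a b (evalVec (p - p')) := fun q hq => by
  have mem : ∀ p, MemLp (evalVec p) 2 (segMeasure a b) := fun p =>
    memLp_segMeasure_of_continuous (continuous_evalVec p) a b 2
  have h1 := h q hq
  have h2 := h' q hq
  rw [edgeFlux_smul_sub hab (mem _) hg (continuous_evalPoly q)] at h1 h2
  simp only [evalVec_sub]
  rw [edgeFlux_smul_sub hab (mem _) (mem _) (continuous_evalPoly q)]
  linarith

lemma TraceData.localInterpolation_unique (h : TraceData S K v G φ g)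
    (hS : IsSubtriangulation P K S) {m : ℕ} (hT : T ∈ triangles S) {p p' : Fin 2 → Poly2}
    (hp : IsLocalInterpolation m T v g p) (hp' : IsLocalInterpolation m T v g p') : p = p' := by
  have hv := (h.memH1_triangle hS hT).1
  have hedge : ∀ a ∈ T, ∀ b ∈ T, a ≠ b → VanishingMoments m a b (evalVec (p - p')) :=
    fun a ha b hb hab => vanishingMoments_evalVec_sub hab (h.memLp T hT a ha b hb hab)
      (hp.edge_moments a ha b hb hab) (hp'.edge_moments a ha b hb hab)
  have hTc := isCompact_convexHull_triangle T
  have hvol : ∀ q ∈ vecPolyDeg ((m : ℤ) - 1), ∫ x in convexHull ℝ (T : Set Plane),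
      inner ℝ (evalVec (p - p') x) (evalVec q x) = 0 := fun q hq => by
    have mem : ∀ p, MemLp (evalVec p) 2 (volume.restrict (convexHull ℝ (T : Set Plane))) :=
      fun p => memLp_of_continuous_isCompact (continuous_evalVec p) hTc 2
    have hint : ∀ p, Integrable (fun x => inner ℝ (evalVec p x - v x) (evalVec q x))
        (volume.restrict (convexHull ℝ (T : Set Plane))) := fun p =>
      integrable_inner_of_memLp ((mem p).sub hv) (mem q)
    rw [← sub_self (0 : ℝ)]
    nth_rewrite 1 [← hp.volume_moments q hq]
    rw [← hp'.volume_moments q hq, ← integral_sub (hint p) (hint p')]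
    congr 1
    ext x
    rw [← inner_sub_left, evalVec_sub, sub_sub_sub_cancel_right]
  obtain ⟨a, b, c, rfl, hc⟩ := exists_vertices hT
  obtain ⟨nab, nbc, nca⟩ := ne_of_cross_ne_zero hc
  rw [coe_triple] at hvol
  exact sub_eq_zero.1 (rtPoly_eq_zero hc (Submodule.sub_mem _ hp.mem hp'.mem) hvol
    (hedge a (by simp) b (by simp) nab) (hedge b (by simp) c (by simp) nbc)
    (hedge c (by simp) a (by simp) nca))

/-- On the triangle, `p` minus the smooth approximations of `v` approximates `w - v`, so the trace
of `w - v` is `p - g`. -/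
lemma TraceData.normalMoments_iff (h : TraceData S K v G φ g) (hS : IsSubtriangulation P K S)
    (m : ℕ) (hT : T ∈ triangles S) {p : Fin 2 → Poly2} {w : Plane → Plane}
    (hw : ∀ᵐ x ∂(volume.restrict (convexHull ℝ (T : Set Plane))), w x = evalVec p x)
    {a b : Plane} (ha : a ∈ T) (hb : b ∈ T) (hab : a ≠ b) :
    NormalMomentsVanish m (convexHull ℝ (T : Set Plane)) a b (fun x => w x - v x) ↔
      VanishingMoments m a b fun x => evalVec p x - g x := by
  have hTc := isCompact_convexHull_triangle T
  have hv := h.memH1_triangle hS hT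
  have hp := memH1With_of_contDiff hTc (contDiff_evalVec p)
  have hH := (MemH1With.sub hTc hp hv).congr (u' := fun x => w x - v x)
    (hw.mono fun x hx => by rw [hx]) (Eventually.of_forall fun _ => rfl)
  have hA := ((smoothApprox_const (contDiff_evalVec p)).sub
    (h.approx.mono (hS.convexHull_subset hT)) hp hv).congr (u' := fun x => w x - v x)
    (hw.mono fun x hx => by rw [hx]) (Eventually.of_forall fun _ => rfl)
  have hg := h.memLp T hT a ha b hb hab
  have ht := h.tendsto T hT a ha b hb hab
  have mem : MemLp (evalVec p) 2 (segMeasure a b) :=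
    memLp_segMeasure_of_continuous (continuous_evalVec p) a b 2
  obtain ⟨c, rfl, hc⟩ := exists_third_vertex hT ha hb hab
  rw [coe_triple] at hH hA ⊢
  exact normalMomentsVanish_iff hc m hH hA (mem.sub hg)
    (tendsto_eLpNorm_sub_sub (fun _ => mem.1)
      (fun j => (h.approx.contDiff j).continuous.aestronglyMeasurable) mem.1 hg.1
      (by simp only [eLpNorm_sub_self]; exact tendsto_const_nhds) ht)

/-- The constraint set is written with `v - w`, the standard interpolation with `w - v`; both lead
to the same edge condition. -/
lemma TraceData.normalMoments_iff_swap (h : TraceData S K v G φ g)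
    (hS : IsSubtriangulation P K S) (m : ℕ) (hT : T ∈ triangles S) {p : Fin 2 → Poly2}
    {w : Plane → Plane}
    (hw : ∀ᵐ x ∂(volume.restrict (convexHull ℝ (T : Set Plane))), w x = evalVec p x)
    {a b : Plane} (ha : a ∈ T) (hb : b ∈ T) (hab : a ≠ b) :
    NormalMomentsVanish m (convexHull ℝ (T : Set Plane)) a b (fun x => v x - w x) ↔
      VanishingMoments m a b fun x => evalVec p x - g x := by
  have hTc := isCompact_convexHull_triangle T
  have hv := h.memH1_triangle hS hT
  have hp := memH1With_of_contDiff hTc (contDiff_evalVec p)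
  have hH := (MemH1With.sub hTc hv hp).congr (u' := fun x => v x - w x)
    (hw.mono fun x hx => by rw [hx]) (Eventually.of_forall fun _ => rfl)
  have hA := ((h.approx.mono (hS.convexHull_subset hT)).sub
    (smoothApprox_const (contDiff_evalVec p)) hv hp).congr (u' := fun x => v x - w x)
    (hw.mono fun x hx => by rw [hx]) (Eventually.of_forall fun _ => rfl)
  have hg := h.memLp T hT a ha b hb hab
  have ht := h.tendsto T hT a ha b hb hab
  have mem : MemLp (evalVec p) 2 (segMeasure a b) :=
    memLp_segMeasure_of_continuous (continuous_evalVec p) a b 2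
  obtain ⟨c, rfl, hc⟩ := exists_third_vertex hT ha hb hab
  rw [coe_triple] at hH hA ⊢
  rw [normalMomentsVanish_iff hc m hH hA (hg.sub mem)
    (tendsto_eLpNorm_sub_sub (fun j => (h.approx.contDiff j).continuous.aestronglyMeasurable)
      (fun _ => mem.1) hg.1 mem.1 ht
      (by simp only [eLpNorm_sub_self]; exact tendsto_const_nhds))]
  exact ⟨VanishingMoments.sub_comm, VanishingMoments.sub_comm⟩

end

end

section

variable {S : Geometry.SimplicialComplex ℝ Plane} {T T' : Finset Plane}
variable {n : ℕ} {P : Polygon Plane n} {K : Set Plane}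

/-! ### The standard interpolation -/

lemma mem_raviartThomas_iff {m : ℕ} {w : L2 K} : w ∈ raviartThomas K S m ↔
    (∃ d, MemHDivWith K w d) ∧ ∀ T ∈ triangles S, ∃ p ∈ rtPoly m,
      ∀ᵐ x ∂(volume.restrict (convexHull ℝ (T : Set Plane))), w x = evalVec p x := by
  refine and_congr_right fun _ => forall₂_congr fun T _ => ?_
  constructor
  · rintro ⟨a, ha, b, hb, h⟩
    exact ⟨_, ⟨a, ha, b, hb, rfl⟩, h.mono fun x hx => by rw [hx, evalVec_rt]⟩
  · rintro ⟨_, ⟨a, ha, b, hb, rfl⟩, h⟩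
    exact ⟨a, ha, b, hb, h.mono fun x hx => by rw [hx, evalVec_rt]⟩

variable {g : Plane → Plane} {G : Plane → Plane →L[ℝ] Plane} {φ : ℕ → Plane → Plane}

/-- `w` is the Raviart–Thomas interpolation with local polynomials `p` and divergence `d`. -/
structure IsGlobalInterpolation (S : Geometry.SimplicialComplex ℝ Plane) (K : Set Plane) (m : ℕ)
    (v g : Plane → Plane) (w : L2 K) (p : Finset Plane → Fin 2 → Poly2) (d : Plane → ℝ) :
    Prop where
  loc : ∀ T ∈ triangles S, IsLocalInterpolation m T v g (p T)
  eq : ∀ T ∈ triangles S, ∀ᵐ x ∂(volume.restrict (convexHull ℝ (T : Set Plane))),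
    w x = evalVec (p T) x
  div_eq : ∀ T ∈ triangles S, ∀ᵐ x ∂(volume.restrict (convexHull ℝ (T : Set Plane))),
    d x = evalPoly (divPoly (p T)) x
  memHDiv : MemHDivWith K w d

/-- Both interpolants at a common edge match the moments of the same `g`. Their difference is a
Raviart–Thomas polynomial with vanishing normal moments there, so its normal component vanishes
along the edge, which is the matching condition for gluing. -/
lemma TraceData.exists_globalInterpolation {v : Plane → Plane} (h : TraceData S K v G φ g)
    (hS : IsSubtriangulation P K S) (hKc : IsCompact K) (m : ℕ) :
    ∃ w p d, IsGlobalInterpolation S K m v g w p d := by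
  -- The value `0` for sets that are not triangles only makes `choose` produce a function on all
  -- finite sets.
  have h0 : ∀ T, ∃ p, T ∈ triangles S → IsLocalInterpolation m T v g p := fun T => by
    by_cases hT : T ∈ triangles S
    · exact (h.exists_localInterpolation hS m hT).imp fun _ hp _ => hp
    · exact ⟨0, fun h => absurd h hT⟩
  choose p hp using h0
  obtain ⟨u, hu⟩ := hS.exists_glue fun T => evalVec (p T)
  obtain ⟨d, hd⟩ := hS.exists_glue fun T => evalPoly (divPoly (p T))
  have hTc := isCompact_convexHull_triangle
  have hu2 : MemLp u 2 (volume.restrict K) := hS.memLp_two fun T hT => (memLp_congr_ae (hu T hT)).2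
    (memLp_of_continuous_isCompact (continuous_evalVec _) (hTc T) 2)
  have hd2 : MemLp d 2 (volume.restrict K) := hS.memLp_two fun T hT => (memLp_congr_ae (hd T hT)).2
    (memLp_of_continuous_isCompact (continuous_evalPoly _) (hTc T) 2)
  have hdiv : HasWeakDiv K u d := by
    refine hasWeakDiv_of_matching hS hu hd (fun T hT T' hT' e f he hf he' hf' t => ?_) hKc
    by_cases hef : e = f
    · subst hef
      simp [cross]
    have h1 := cross_evalVec_eq_zero_of_moments
      (Submodule.sub_mem _ (hp T hT).mem (hp T' hT').mem)
      (vanishingMoments_evalVec_sub hef (h.memLp T hT e he f hf hef)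
        ((hp T hT).edge_moments e he f hf hef) ((hp T' hT').edge_moments e he' f hf' hef)) t
    rwa [evalVec_sub, cross_sub_left, sub_eq_zero] at h1
  refine ⟨hu2.toLp u, p, d, hp, fun T hT => ?_, hd, ?_⟩
  · filter_upwards [hu T hT, (hS.ae_iff.1 hu2.coeFn_toLp) T hT] with x hx hx'
    rw [hx', hx]
  · exact MemHDivWith.congr ⟨hu2, hd2, hdiv⟩ hu2.coeFn_toLp (Eventually.of_forall fun _ => rfl)

variable {v : L2 K} {m : ℕ} {w : L2 K} {p : Finset Plane → Fin 2 → Poly2} {d : Plane → ℝ}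

lemma L2.ext_of_triangles (hS : IsSubtriangulation P K S) {w w' : L2 K}
    (h : ∀ T ∈ triangles S, ∀ᵐ x ∂(volume.restrict (convexHull ℝ (T : Set Plane))), w x = w' x) :
    w = w' := Lp.ext (hS.ae_iff.2 h)

lemma IsGlobalInterpolation.mem_raviartThomas (hw : IsGlobalInterpolation S K m v g w p d) :
    w ∈ raviartThomas K S m :=
  mem_raviartThomas_iff.2 ⟨⟨d, hw.memHDiv⟩, fun T hT => ⟨p T, (hw.loc T hT).mem, hw.eq T hT⟩⟩

/-- On each triangle the conditions say exactly that the local polynomial is the local interpolant,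
which is unique. -/
lemma TraceData.isStandardInterpolation_iff (h : TraceData S K v G φ g)
    (hS : IsSubtriangulation P K S) (hw : IsGlobalInterpolation S K m v g w p d) (w' : L2 K) :
    IsStandardInterpolation K S m v w' ↔ w' = w := by
  have hcongr : ∀ (T : Finset Plane) (w' : L2 K) (q r : Fin 2 → Poly2),
      (∀ᵐ x ∂(volume.restrict (convexHull ℝ (T : Set Plane))), w' x = evalVec q x) →
      ∫ x in convexHull ℝ (T : Set Plane), inner ℝ (w' x - v x) (evalVec r x) =
        ∫ x in convexHull ℝ (T : Set Plane), inner ℝ (evalVec q x - v x) (evalVec r x) :=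
    fun T w' q r h => integral_congr_ae (h.mono fun x hx => by simp only [hx])
  constructor
  · rintro ⟨hRT, hint⟩
    refine L2.ext_of_triangles hS fun T hT => ?_
    obtain ⟨q, hq, hwq⟩ := (mem_raviartThomas_iff.1 hRT).2 T hT
    have hloc : IsLocalInterpolation m T v g q :=
      ⟨hq, fun r hr => by rw [← hcongr T w' q r hwq, (hint T hT).1 r hr],
        fun a ha b hb hab => (h.normalMoments_iff hS m hT hwq ha hb hab).1
          ((hint T hT).2 a ha b hb hab)⟩
    have := h.localInterpolation_unique hS hT hloc (hw.loc T hT)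
    filter_upwards [hwq, hw.eq T hT] with x hx hx'
    rw [hx, hx', this]
  · rintro rfl
    refine ⟨hw.mem_raviartThomas, fun T hT => ⟨fun r hr => ?_, fun a ha b hb hab => ?_⟩⟩
    · rw [hcongr T w' (p T) r (hw.eq T hT), (hw.loc T hT).volume_moments r hr]
    · exact (h.normalMoments_iff hS m hT (hw.eq T hT) ha hb hab).2
        ((hw.loc T hT).edge_moments a ha b hb hab)

/-- Green's formula for `p - v` with the test function `q`: the fluxes are edge moments against
`P_m`, and the term with the gradient of `q` is an interior moment against `P_{m-1}`. -/
lemma TraceData.integral_div_sub_eq_zero {v : Plane → Plane} (h : TraceData S K v G φ g)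
    (hS : IsSubtriangulation P K S) (hT : T ∈ triangles S) {p : Fin 2 → Poly2}
    (hp : IsLocalInterpolation m T v g p) {q : Poly2} (hq : q ∈ polyDeg m) :
    ∫ x in convexHull ℝ (T : Set Plane),
      (jacTrace (G x) - evalPoly (divPoly p) x) * evalPoly q x = 0 := by
  have hTc := isCompact_convexHull_triangle T
  have hv := h.memH1_triangle hS hT
  have hP := memH1With_of_contDiff hTc (contDiff_evalVec p)
  have hH := MemH1With.sub hTc hP hv
  have hA := (smoothApprox_const (contDiff_evalVec p)).sub
    (h.approx.mono (hS.convexHull_subset hT)) hP hv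
  have mem : ∀ a b, MemLp (evalVec p) 2 (segMeasure a b) := fun a b =>
    memLp_segMeasure_of_continuous (continuous_evalVec p) a b 2
  have hg := fun a ha b hb hab => (mem a b).sub (h.memLp T hT a ha b hb hab)
  have ht := fun a ha b hb hab => tendsto_eLpNorm_sub_sub (fun _ => (mem a b).1)
    (fun j => (h.approx.contDiff j).continuous.aestronglyMeasurable) (mem a b).1
    (h.memLp T hT a ha b hb hab).1 (by simp only [eLpNorm_sub_self]; exact tendsto_const_nhds)
    (h.tendsto T hT a ha b hb hab)
  have hvol := hp.volume_moments (gradPoly q) (gradPoly_mem hq)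
  have hedge := hp.edge_moments
  obtain ⟨a, b, c, rfl, hc⟩ := exists_vertices hT
  obtain ⟨nab, nbc, nca⟩ := ne_of_cross_ne_zero hc
  rw [coe_triple] at hTc hv hP hH hA hvol ⊢
  have key := green_H1 hc hH hA (hg a (by simp) b (by simp) nab) (hg b (by simp) c (by simp) nbc)
    (hg c (by simp) a (by simp) nca) (ht a (by simp) b (by simp) nab)
    (ht b (by simp) c (by simp) nbc) (ht c (by simp) a (by simp) nca) (contDiff_evalPoly q)
  have e1 : edgeFlux a b (fun x => evalPoly q x • (evalVec p - g) x) = 0 :=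
    hedge a (by simp) b (by simp) nab q hq
  have e2 : edgeFlux b c (fun x => evalPoly q x • (evalVec p - g) x) = 0 :=
    hedge b (by simp) c (by simp) nbc q hq
  have e3 : edgeFlux c a (fun x => evalPoly q x • (evalVec p - g) x) = 0 :=
    hedge c (by simp) a (by simp) nca q hq
  have hsum : ∀ x, evalPoly q x * jacTrace (fderiv ℝ (evalVec p) x - G x) +
      fderiv ℝ (evalPoly q) x (evalVec p x - v x) =
      -((jacTrace (G x) - evalPoly (divPoly p) x) * evalPoly q x) +
        inner ℝ (evalVec p x - v x) (evalVec (gradPoly q) x) := fun x => by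
    rw [map_sub, jacTrace_fderiv_evalVec, fderiv_evalPoly, innerSL_apply_apply, real_inner_comm]
    ring
  simp only [hsum] at key
  have i1 : IntegrableOn (fun x => (jacTrace (G x) - evalPoly (divPoly p) x) * evalPoly q x)
      (convexHull ℝ {a, b, c}) := by
    have : IntegrableOn (fun x => jacTrace (G x) - evalPoly (divPoly p) x)
        (convexHull ℝ {a, b, c}) :=
      (jacTrace.integrable_comp (integrable_of_memLp_two hTc hv.2.1)).sub
        (integrableOn_evalPoly hTc _)
    refine (IntegrableOn.continuous_smul hTc this (continuous_evalPoly q)).congr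
      (Eventually.of_forall fun x => ?_)
    simp only [smul_eq_mul, mul_comm]
  rw [integral_add, hvol, integral_neg, e1, e2, e3, add_zero, add_zero, add_zero, mul_neg,
    neg_eq_zero] at key
  rotate_left
  · exact i1.neg
  · exact integrable_inner_of_memLp hH.1
      (memLp_of_continuous_isCompact (continuous_evalVec _) hTc 2)
  exact (mul_eq_zero.1 key).resolve_left (sign_ne_zero_of_ne hc)

/-- Each constraint is a sum of local conditions of the interpolation: the divergence by Green's
formula, the orthogonality because `𝒢_{m-1}^⊥` consists of polynomials of degree at most `m - 1`,
and the edges directly. -/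
lemma TraceData.mem_constraintSet (h : TraceData S K v G φ g) (hK : IsPolygonalCell P K)
    (hS : IsSubtriangulation P K S) (hw : IsGlobalInterpolation S K m v g w p d) :
    w ∈ constraintSet P K S v m := by
  have hKc := hK.compact
  refine ⟨hw.mem_raviartThomas, ⟨fun x => jacTrace (G x) - d x,
    MemHDivWith.sub hKc (h.memH1.memHDivWith hKc) hw.memHDiv, fun q hq => ?_⟩, fun q hq => ?_,
    fun i T hT hi hi' => ?_⟩
  · have hcongr : ∀ T ∈ triangles S, ∃ r ∈ polyDeg (m : ℤ), (fun x => (jacTrace (G x) - d x) * q x)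
        =ᵐ[volume.restrict (convexHull ℝ (T : Set Plane))]
        fun x => (jacTrace (G x) - evalPoly (divPoly (p T)) x) * evalPoly r x := fun T hT => by
      obtain ⟨r, hr, hqr⟩ := hq T hT
      refine ⟨r, hr, ?_⟩
      filter_upwards [hqr, hw.div_eq T hT] with x hx hx'
      rw [hx, hx']
    rw [hS.setIntegral_eq_sum fun T hT => ?_]
    · refine Finset.sum_eq_zero fun T hT => ?_
      rw [hS.mem_tri] at hT
      obtain ⟨r, hr, hqr⟩ := hcongr T hT
      rw [integral_congr_ae hqr, h.integral_div_sub_eq_zero hS hT (hw.loc T hT) hr]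
    · obtain ⟨r, hr, hqr⟩ := hcongr T hT
      have hTc := isCompact_convexHull_triangle T
      have : IntegrableOn (fun x => jacTrace (G x) - evalPoly (divPoly (p T)) x)
          (convexHull ℝ (T : Set Plane)) :=
        (jacTrace.integrable_comp (integrable_of_memLp_two hTc (h.memH1_triangle hS hT).2.1)).sub
          (integrableOn_evalPoly hTc _)
      refine Integrable.congr ?_ hqr.symm
      refine (IntegrableOn.continuous_smul hTc this (continuous_evalPoly r)).congr
        (Eventually.of_forall fun x => ?_)
      simp only [smul_eq_mul, mul_comm]
  · have hi : IntegrableOn (fun x => (inner ℝ (v x - w x) (evalVec q x) : ℝ)) K :=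
      integrable_inner_of_memLp ((Lp.memLp v).sub (Lp.memLp w))
        (memLp_of_continuous_isCompact (continuous_evalVec _) hKc 2)
    rw [hS.setIntegral_eq_sum fun T hT => hi.mono_set (hS.convexHull_subset hT)]
    refine Finset.sum_eq_zero fun T hT => ?_
    rw [hS.mem_tri] at hT
    rw [← neg_eq_zero, ← (hw.loc T hT).volume_moments q hq.1, ← integral_neg]
    refine integral_congr_ae ((hw.eq T hT).mono fun x hx => ?_)
    simp only
    rw [← inner_neg_left, neg_sub, hx]
  · have hne := hK.simple.2.1 i
    exact (h.normalMoments_iff_swap hS m hT (hw.eq T hT) hi hi' hne).2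
      ((hw.loc T hT).edge_moments _ hi _ hi' hne)

end

section

variable {S : Geometry.SimplicialComplex ℝ Plane} {T T' : Finset Plane}
variable {n : ℕ} {P : Polygon Plane n} {K : Set Plane}

/-! ### The homogeneous constraints -/

lemma MemHDivWith.const_smul {D : Set Plane} {u : Plane → Plane} {d : Plane → ℝ}
    (h : MemHDivWith D u d) (c : ℝ) :
    MemHDivWith D (fun x => c • u x) (fun x => c * d x) := by
  refine ⟨h.1.const_smul c, h.2.1.const_mul c, fun φ hφ => ?_⟩
  have h1 := h.2.2 φ hφ
  simp only [map_smul, smul_eq_mul, mul_left_comm _ c]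
  rw [integral_const_mul, integral_const_mul, h1, mul_neg]

lemma VanishingMoments.const_smul {m : ℕ} {a b : Plane} {p : Fin 2 → Poly2}
    (h : VanishingMoments m a b (evalVec p)) (c : ℝ) :
    VanishingMoments m a b (evalVec (c • p)) := fun q hq => by
  have h1 : edgeFlux a b (fun x => evalPoly q x • evalVec (c • p) x) =
      c * edgeFlux a b (fun x => evalPoly q x • evalVec p x) := by
    unfold edgeFlux
    rw [← intervalIntegral.integral_const_mul]
    congr 1
    ext t
    simp only [evalVec_smul, cross_smul_left]
    ring
  rw [h1, h q hq, mul_zero]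

lemma VanishingMoments.evalVec_sub {m : ℕ} {a b : Plane} (hab : a ≠ b) {p p' : Fin 2 → Poly2}
    (h : VanishingMoments m a b (evalVec p)) (h' : VanishingMoments m a b (evalVec p')) :
    VanishingMoments m a b (evalVec (p - p')) := by
  refine vanishingMoments_evalVec_sub (g := 0) hab MemLp.zero ?_ ?_
  · simpa only [Pi.zero_apply, sub_zero] using h
  · simpa only [Pi.zero_apply, sub_zero] using h'

lemma IsSubtriangulation.integrableOn_mul_piecewisePoly (hS : IsSubtriangulation P K S)
    {d q : Plane → ℝ} (hd : MemLp d 2 (volume.restrict K)) {m : ℕ} (hq : IsPiecewisePoly S m q) :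
    IntegrableOn (fun x => d x * q x) K := by
  refine hS.integrableOn fun T hT => ?_
  obtain ⟨r, -, hr⟩ := hq T hT
  have hTc := isCompact_convexHull_triangle T
  have hd' := integrable_of_memLp_two hTc
    (hd.mono_measure (Measure.restrict_mono (hS.convexHull_subset hT) le_rfl))
  refine (IntegrableOn.continuous_smul hTc hd' (continuous_evalPoly r)).congr ?_
  filter_upwards [hr] with x hx
  rw [hx, smul_eq_mul, mul_comm]

/-- The constraints on the difference of two elements of the constraint set. -/
structure IsHomogeneous (P : Polygon Plane n) (K : Set Plane)
    (S : Geometry.SimplicialComplex ℝ Plane) (m : ℕ) (u : L2 K) : Prop where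
  div : ∃ d, MemHDivWith K u d ∧ ∀ q, IsPiecewisePoly S m q → ∫ x in K, d x * q x = 0
  loc : ∀ T ∈ triangles S, ∃ p ∈ rtPoly m,
    (∀ᵐ x ∂(volume.restrict (convexHull ℝ (T : Set Plane))), u x = evalVec p x) ∧
    ∀ i, P i ∈ T → P (finRotate n i) ∈ T →
      VanishingMoments m (P i) (P (finRotate n i)) (evalVec p)
  ortho : ∀ q ∈ gradOrtho K ((m : ℤ) - 1), ∫ x in K, inner ℝ (u x) (evalVec q x) = 0

lemma integrableOn_inner_evalVec (hK : IsCompact K) (u : L2 K) (q : Fin 2 → Poly2) :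
    IntegrableOn (fun x => (inner ℝ (u x) (evalVec q x) : ℝ)) K :=
  integrable_inner_of_memLp (Lp.memLp u)
    (memLp_of_continuous_isCompact (continuous_evalVec _) hK 2)

lemma IsHomogeneous.const_smul (hS : IsSubtriangulation P K S) {m : ℕ} {u : L2 K}
    (h : IsHomogeneous P K S m u) (c : ℝ) : IsHomogeneous P K S m (c • u) := by
  have hcu := Lp.coeFn_smul c u
  constructor
  · obtain ⟨d, hd, hdq⟩ := h.div
    refine ⟨_, (hd.const_smul c).congr hcu (Eventually.of_forall fun _ => rfl), fun q hq => ?_⟩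
    simp only [mul_assoc]
    rw [integral_const_mul, hdq q hq, mul_zero]
  · intro T hT
    obtain ⟨p, hp, hup, hv⟩ := h.loc T hT
    refine ⟨c • p, Submodule.smul_mem _ c hp, ?_, fun i hi hi' => (hv i hi hi').const_smul c⟩
    filter_upwards [hS.ae_iff.1 hcu T hT, hup] with x hx hx'
    rw [hx, Pi.smul_apply, hx', evalVec_smul]
  · intro q hq
    rw [← mul_zero c, ← h.ortho q hq, ← integral_const_mul]
    refine integral_congr_ae (hcu.mono fun x hx => ?_)
    simp only
    rw [hx, Pi.smul_apply, real_inner_smul_left]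

lemma IsHomogeneous.sub (hKc : IsCompact K) (hP : P.HasNondegenerateEdges)
    (hS : IsSubtriangulation P K S) {m : ℕ} {u u' : L2 K}
    (h : IsHomogeneous P K S m u) (h' : IsHomogeneous P K S m u') :
    IsHomogeneous P K S m (u - u') := by
  have hcu := Lp.coeFn_sub u u'
  constructor
  · obtain ⟨d, hd, hdq⟩ := h.div
    obtain ⟨d', hd', hdq'⟩ := h'.div
    refine ⟨_, (MemHDivWith.sub hKc hd hd').congr hcu (Eventually.of_forall fun _ => rfl),
      fun q hq => ?_⟩
    simp only [sub_mul]
    rw [integral_sub (hS.integrableOn_mul_piecewisePoly hd.2.1 hq)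
      (hS.integrableOn_mul_piecewisePoly hd'.2.1 hq), hdq q hq, hdq' q hq, sub_zero]
  · intro T hT
    obtain ⟨p, hp, hup, hv⟩ := h.loc T hT
    obtain ⟨p', hp', hup', hv'⟩ := h'.loc T hT
    refine ⟨p - p', Submodule.sub_mem _ hp hp', ?_,
      fun i hi hi' => (hv i hi hi').evalVec_sub (hP i) (hv' i hi hi')⟩
    filter_upwards [hS.ae_iff.1 hcu T hT, hup, hup'] with x hx h1 h2
    rw [hx, Pi.sub_apply, h1, h2, PolyRT.evalVec_sub]
  · intro q hq
    rw [← sub_zero (0 : ℝ)]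
    nth_rewrite 1 [← h.ortho q hq]
    rw [← h'.ortho q hq, ← integral_sub (integrableOn_inner_evalVec hKc u q)
      (integrableOn_inner_evalVec hKc u' q)]
    refine integral_congr_ae (hcu.mono fun x hx => ?_)
    simp only
    rw [hx, Pi.sub_apply, inner_sub_left]

/-- The space of solutions of the homogeneous constraints. -/
def homogeneousSpace (hKc : IsCompact K) (hP : P.HasNondegenerateEdges)
    (hS : IsSubtriangulation P K S) (m : ℕ) (h0 : IsHomogeneous P K S m 0) :
    Submodule ℝ (L2 K) where
  carrier := {u | IsHomogeneous P K S m u}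
  zero_mem' := h0
  add_mem' {u u'} hu hu' := by
    have := IsHomogeneous.sub hKc hP hS hu (hu'.const_smul hS (-1))
    rwa [neg_one_smul, sub_neg_eq_add] at this
  smul_mem' c _ hu := hu.const_smul hS c

/-- The field that equals a polynomial on `D` and vanishes elsewhere. -/
def polyIndicator (K : Set Plane) {D : Set Plane} (hK : IsCompact K) (hD : MeasurableSet D) :
    (Fin 2 → Poly2) →ₗ[ℝ] L2 K where
  toFun p := ((memLp_of_continuous_isCompact (continuous_evalVec p) hK 2).indicator hD).toLp _
  map_add' p q := by
    rw [← MemLp.toLp_add]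
    congr 1
    ext1 x
    by_cases hx : x ∈ D <;> simp [hx, evalVec_add]
  map_smul' c p := by
    rw [RingHom.id_apply, ← MemLp.toLp_const_smul]
    congr 1
    ext1 x
    by_cases hx : x ∈ D <;> simp [hx, evalVec_smul]

lemma polyIndicator_ae {D : Set Plane} (hK : IsCompact K) (hD : MeasurableSet D)
    (p : Fin 2 → Poly2) :
    polyIndicator K hK hD p =ᵐ[volume.restrict K] D.indicator (evalVec p) :=
  ((memLp_of_continuous_isCompact (continuous_evalVec p) hK 2).indicator hD).coeFn_toLp

/-- Piecewise Raviart–Thomas fields, with no continuity imposed, lie in the sum over the finitely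
many triangles of the polynomials cut off outside the triangle. Finite dimension guarantees that
orthogonal projections exist. -/
lemma exists_finiteDimensional_piecewise (hKc : IsCompact K) (hS : IsSubtriangulation P K S)
    (m : ℕ) : ∃ R : Submodule ℝ (L2 K), FiniteDimensional ℝ R ∧ ∀ u : L2 K,
      (∀ T ∈ triangles S, ∃ p ∈ rtPoly m,
        ∀ᵐ x ∂(volume.restrict (convexHull ℝ (T : Set Plane))), u x = evalVec p x) → u ∈ R := by
  let L := fun T : Finset Plane => polyIndicator K hKc (measurableSet_convexHull_triangle T)
  refine ⟨⨆ T : hS.tri, (rtPoly m).map (L T), inferInstance, fun u hu => ?_⟩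
  choose! p hp hup using hu
  have h1 : u = ∑ T ∈ hS.tri, L T (p T) := by
    refine L2.ext_of_triangles hS fun T hT => ?_
    have h2 : ∀ᵐ x ∂(volume.restrict (convexHull ℝ (T : Set Plane))), ∀ T' ∈ hS.tri,
        L T' (p T') x = if T' = T then evalVec (p T) x else 0 := by
      rw [eventually_all_finset]
      intro T' hT'
      have h3 := hS.ae_iff.1 (polyIndicator_ae hKc (measurableSet_convexHull_triangle T') (p T')) T hT
      by_cases hne : T' = T
      · subst hne
        filter_upwards [h3, ae_restrict_mem (measurableSet_convexHull_triangle T')] with x hx hxT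
        rw [if_pos rfl]
        exact hx.trans (indicator_of_mem hxT _)
      · have h4 : ∀ᵐ x ∂(volume.restrict (convexHull ℝ (T : Set Plane))),
            x ∉ convexHull ℝ (T' : Set Plane) := by
          refine compl_mem_ae_iff.2 ?_
          rw [Measure.restrict_apply (measurableSet_convexHull_triangle T')]
          exact volume_inter_triangles (hS.mem_tri.1 hT') hT hne
        filter_upwards [h3, h4] with x hx hxT
        rw [if_neg hne]
        exact hx.trans (indicator_of_notMem hxT _)
    filter_upwards [h2, hup T hT, hS.ae_iff.1 (Lp.coeFn_finsetSum hS.tri fun T => L T (p T)) T hT]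
      with x h3 h4 h5
    rw [h4, h5, Finset.sum_apply, Finset.sum_congr rfl h3, Finset.sum_ite_eq',
      if_pos (hS.mem_tri.2 hT)]
  rw [h1]
  refine Submodule.sum_mem _ fun T hT => ?_
  exact Submodule.mem_iSup_of_mem (⟨T, hT⟩ : hS.tri)
    (Submodule.mem_map_of_mem (hp T (hS.mem_tri.1 hT)))

variable {g : Plane → Plane} {G : Plane → Plane →L[ℝ] Plane} {φ : ℕ → Plane → Plane}
variable {v : L2 K} {m : ℕ} {w : L2 K} {p : Finset Plane → Fin 2 → Poly2} {d : Plane → ℝ}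

/-- The difference of two elements of the constraint set satisfies the homogeneous constraints. -/
lemma TraceData.isHomogeneous_sub (h : TraceData S K v G φ g) (hKc : IsCompact K)
    (hP : P.HasNondegenerateEdges) (hS : IsSubtriangulation P K S) {w w' : L2 K}
    (hw : w ∈ constraintSet P K S v m) (hw' : w' ∈ constraintSet P K S v m) :
    IsHomogeneous P K S m (w' - w) := by
  have hcu := Lp.coeFn_sub w' w
  constructor
  · obtain ⟨d, hd, hdq⟩ := hw.2.1
    obtain ⟨d', hd', hdq'⟩ := hw'.2.1
    refine ⟨_, (MemHDivWith.sub hKc hd hd').congr ?_ (Eventually.of_forall fun _ => rfl),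
      fun q hq => ?_⟩
    · filter_upwards [hcu] with x hx
      rw [hx, Pi.sub_apply]
      abel
    · simp only [sub_mul]
      rw [integral_sub (hS.integrableOn_mul_piecewisePoly hd.2.1 hq)
        (hS.integrableOn_mul_piecewisePoly hd'.2.1 hq), hdq q hq, hdq' q hq, sub_zero]
  · intro T hT
    obtain ⟨p, hp, hwp⟩ := (mem_raviartThomas_iff.1 hw.1).2 T hT
    obtain ⟨p', hp', hwp'⟩ := (mem_raviartThomas_iff.1 hw'.1).2 T hT
    refine ⟨p' - p, Submodule.sub_mem _ hp' hp, ?_, fun i hi hi' => ?_⟩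
    · filter_upwards [hS.ae_iff.1 hcu T hT, hwp, hwp'] with x hx h1 h2
      rw [hx, Pi.sub_apply, h1, h2, PolyRT.evalVec_sub]
    · exact vanishingMoments_evalVec_sub (hP i) (h.memLp T hT _ hi _ hi' (hP i))
        ((h.normalMoments_iff_swap hS m hT hwp' hi hi' (hP i)).1 (hw'.2.2.2 i T hT hi hi'))
        ((h.normalMoments_iff_swap hS m hT hwp hi hi' (hP i)).1 (hw.2.2.2 i T hT hi hi'))
  · intro q hq
    have e := hw.2.2.1 q hq
    have e' := hw'.2.2.1 q hq
    have hi : ∀ w : L2 K, IntegrableOn (fun x => (inner ℝ (v x - w x) (evalVec q x) : ℝ)) K :=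
      fun w => integrable_inner_of_memLp ((Lp.memLp v).sub (Lp.memLp w))
        (memLp_of_continuous_isCompact (continuous_evalVec _) hKc 2)
    rw [← sub_zero (0 : ℝ)]
    nth_rewrite 1 [← e]
    rw [← e', ← integral_sub (hi w) (hi w')]
    refine integral_congr_ae (hcu.mono fun x hx => ?_)
    simp only
    rw [hx, Pi.sub_apply, ← inner_sub_left, sub_sub_sub_cancel_left]

lemma TraceData.add_mem_constraintSet (h : TraceData S K v G φ g) (hKc : IsCompact K)
    (hP : P.HasNondegenerateEdges) (hS : IsSubtriangulation P K S)
    (hw : w ∈ constraintSet P K S v m) {u : L2 K} (hu : IsHomogeneous P K S m u) :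
    w + u ∈ constraintSet P K S v m := by
  have hcu := Lp.coeFn_add w u
  obtain ⟨du, hdu, hduq⟩ := hu.div
  refine ⟨mem_raviartThomas_iff.2 ⟨?_, fun T hT => ?_⟩, ?_, fun q hq => ?_, fun i T hT hi hi' => ?_⟩
  · obtain ⟨dw, hdw⟩ := hw.1.1
    -- The sum is treated as the difference `w - (-1) u`.
    refine ⟨_, (MemHDivWith.sub hKc hdw (hdu.const_smul (-1))).congr ?_
      (Eventually.of_forall fun _ => rfl)⟩
    filter_upwards [hcu] with x hx
    rw [hx, Pi.add_apply, neg_one_smul, sub_neg_eq_add]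
  · obtain ⟨p, hp, hwp⟩ := (mem_raviartThomas_iff.1 hw.1).2 T hT
    obtain ⟨p', hp', hup, -⟩ := hu.loc T hT
    refine ⟨p + p', Submodule.add_mem _ hp hp', ?_⟩
    filter_upwards [hS.ae_iff.1 hcu T hT, hwp, hup] with x hx h1 h2
    rw [hx, Pi.add_apply, h1, h2, evalVec_add]
  · obtain ⟨dw, hdw, hdwq⟩ := hw.2.1
    refine ⟨_, (MemHDivWith.sub hKc hdw hdu).congr ?_ (Eventually.of_forall fun _ => rfl),
      fun q hq => ?_⟩
    · filter_upwards [hcu] with x hx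
      rw [hx, Pi.add_apply, sub_sub]
    · simp only [sub_mul]
      rw [integral_sub (hS.integrableOn_mul_piecewisePoly hdw.2.1 hq)
        (hS.integrableOn_mul_piecewisePoly hdu.2.1 hq), hdwq q hq, hduq q hq, sub_zero]
  · have hi : IntegrableOn (fun x => (inner ℝ (v x - w x) (evalVec q x) : ℝ)) K :=
      integrable_inner_of_memLp ((Lp.memLp v).sub (Lp.memLp w))
        (memLp_of_continuous_isCompact (continuous_evalVec _) hKc 2)
    rw [← sub_zero (0 : ℝ)]
    nth_rewrite 1 [← hw.2.2.1 q hq]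
    rw [← hu.ortho q hq, ← integral_sub hi (integrableOn_inner_evalVec hKc u q)]
    refine integral_congr_ae (hcu.mono fun x hx => ?_)
    simp only
    rw [hx, Pi.add_apply, ← inner_sub_left, sub_sub]
  · obtain ⟨p, hp, hwp⟩ := (mem_raviartThomas_iff.1 hw.1).2 T hT
    obtain ⟨p', hp', hup, hv⟩ := hu.loc T hT
    have hab := hP i
    have h1 : ∀ᵐ x ∂(volume.restrict (convexHull ℝ (T : Set Plane))),
        (w + u : L2 K) x = evalVec (p + p') x := by
      filter_upwards [hS.ae_iff.1 hcu T hT, hwp, hup] with x hx h1 h2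
      rw [hx, Pi.add_apply, h1, h2, evalVec_add]
    rw [h.normalMoments_iff_swap hS m hT h1 hi hi' hab]
    intro q hq
    have e1 := (h.normalMoments_iff_swap hS m hT hwp hi hi' hab).1 (hw.2.2.2 i T hT hi hi') q hq
    have e2 := (hv i hi hi').const_smul (-1) q hq
    have mem : ∀ p, MemLp (evalVec p) 2 (segMeasure (P i) (P (finRotate n i))) := fun p =>
      memLp_segMeasure_of_continuous (continuous_evalVec p) _ _ 2
    have e3 := edgeFlux_smul_sub hab ((mem p).sub (h.memLp T hT _ hi _ hi' hab))
      (mem ((-1 : ℝ) • p')) (continuous_evalPoly q)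
    simp only [Pi.sub_apply] at e3
    rw [e1, e2, sub_zero] at e3
    rw [← e3]
    congr 1
    ext1 x
    simp only [evalVec_add, evalVec_smul]
    rw [neg_one_smul]
    congr 1
    abel

/-- The constraint set is the affine space `w + U` with `U` finite-dimensional. The nearest point to
`z` is `w` plus the orthogonal projection of `z - w` to `U`, and Pythagoras shows that every other
point is strictly farther away. -/
lemma TraceData.existsUnique_minimizer (h : TraceData S K v G φ g) (hKc : IsCompact K)
    (hP : P.HasNondegenerateEdges) (hS : IsSubtriangulation P K S)
    (hw : w ∈ constraintSet P K S v m) (z : L2 K) :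
    ∃! w, w ∈ constraintSet P K S v m ∧ ∀ w' ∈ constraintSet P K S v m, ‖z - w‖ ≤ ‖z - w'‖ := by
  have h0 : IsHomogeneous P K S m 0 := sub_self w ▸ h.isHomogeneous_sub hKc hP hS hw hw
  set U := homogeneousSpace hKc hP hS m h0 with hU
  obtain ⟨R, hR, hRu⟩ := exists_finiteDimensional_piecewise hKc hS m
  have hUR : U ≤ R := fun u hu => hRu u fun T hT => by
    obtain ⟨p, hp, hup, -⟩ := IsHomogeneous.loc hu T hT
    exact ⟨p, hp, hup⟩
  have hfin : FiniteDimensional ℝ U := Submodule.finiteDimensional_of_le hUR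
  set w₀ : L2 K := w + U.starProjection (z - w) with hw₀
  have hmem : w₀ ∈ constraintSet P K S v m :=
    h.add_mem_constraintSet hKc hP hS hw (U.starProjection_apply_mem (z - w))
  have hpyth : ∀ w' ∈ constraintSet P K S v m,
      ‖z - w'‖ * ‖z - w'‖ = ‖z - w₀‖ * ‖z - w₀‖ + ‖w₀ - w'‖ * ‖w₀ - w'‖ := fun w' hw' => by
    have h1 : w₀ - w' ∈ U := h.isHomogeneous_sub hKc hP hS hw' hmem
    have h2 : z - w₀ ∈ Uᗮ := by
      rw [hw₀, ← sub_sub]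
      exact U.sub_starProjection_mem_orthogonal (z - w)
    rw [← norm_add_sq_eq_norm_sq_add_norm_sq_real ((Submodule.mem_orthogonal' U _).1 h2 _ h1),
      sub_add_sub_cancel]
  refine ⟨w₀, ⟨hmem, fun w' hw' => ?_⟩, fun w' ⟨hw', hmin⟩ => ?_⟩
  · refine nonneg_le_nonneg_of_sq_le_sq (norm_nonneg _) ?_
    rw [hpyth w' hw']
    exact le_add_of_nonneg_right (mul_self_nonneg _)
  · have h1 := hpyth w' hw'
    have h2 := mul_self_le_mul_self (norm_nonneg _) (hmin w₀ hmem)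
    have h3 : ‖w₀ - w'‖ = 0 := mul_self_eq_zero.1
      (le_antisymm (by linarith) (mul_self_nonneg _))
    exact (sub_eq_zero.1 (norm_eq_zero.1 h3)).symm

end

section

variable {S : Geometry.SimplicialComplex ℝ Plane} {T T' : Finset Plane}
variable {n : ℕ} {P : Polygon Plane n} {K : Set Plane}

/-! ### A single triangle -/

/-- The map from vector polynomials to `L²(K; ℝ²)`. -/
def polyToL2 (hK : IsCompact K) : (Fin 2 → Poly2) →ₗ[ℝ] L2 K where
  toFun p := (memLp_of_continuous_isCompact (continuous_evalVec p) hK 2).toLp _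
  map_add' p q := by
    rw [← MemLp.toLp_add]
    congr 1
    ext1 x
    exact evalVec_add p q x
  map_smul' c p := by
    rw [RingHom.id_apply, ← MemLp.toLp_const_smul]
    congr 1
    ext1 x
    exact evalVec_smul c p x

lemma inner_polyToL2 (hK : IsCompact K) (p q : Fin 2 → Poly2) :
    inner ℝ (polyToL2 hK p) (polyToL2 hK q) =
      ∫ x in K, (inner ℝ (evalVec p x) (evalVec q x) : ℝ) := by
  rw [L2.inner_def]
  refine integral_congr_ae ?_
  filter_upwards [(memLp_of_continuous_isCompact (continuous_evalVec p) hK 2).coeFn_toLp,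
    (memLp_of_continuous_isCompact (continuous_evalVec q) hK 2).coeFn_toLp] with x h1 h2
  exact congrArg₂ _ h1 h2

/-- The gradient of a polynomial, as a linear map. -/
def gradPolyLin : Poly2 →ₗ[ℝ] (Fin 2 → Poly2) where
  toFun := gradPoly
  map_add' p q := by ext1 i; simp [gradPoly]
  map_smul' c p := by ext1 i; simp [gradPoly]

/-- Vector polynomials of degree at most `m - 1` are sums of gradients of polynomials of degree at
most `m` and of elements of the orthogonal complement. -/
lemma exists_grad_add_gradOrtho (hK : IsCompact K) {m : ℕ} {q : Fin 2 → Poly2}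
    (hq : q ∈ vecPolyDeg ((m : ℤ) - 1)) :
    ∃ r ∈ polyDeg (m : ℤ), q - gradPoly r ∈ gradOrtho K ((m : ℤ) - 1) := by
  -- The projection of `q` to the space of gradients is again represented by the gradient of a
  -- polynomial, which is the required `r`.
  set W : Submodule ℝ (L2 K) := (polyDeg (m : ℤ)).map ((polyToL2 hK).comp gradPolyLin) with hW
  have hfin : FiniteDimensional ℝ W := by rw [hW]; infer_instance
  obtain ⟨r, hr, hrW⟩ := Submodule.mem_map.1 (W.starProjection_apply_mem (polyToL2 hK q))
  refine ⟨r, hr, fun i => Submodule.sub_mem _ (hq i) (gradPoly_mem hr i), fun s hs => ?_⟩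
  rw [sub_add_cancel] at hs
  rw [← inner_polyToL2 hK, map_sub]
  have h1 := W.sub_starProjection_mem_orthogonal (polyToL2 hK q)
  rw [← hrW] at h1
  exact (Submodule.mem_orthogonal' W _).1 h1 _ (Submodule.mem_map_of_mem hs)

/-- Consecutive vertices differ because edges are nondegenerate; for other pairs the edges starting
there are disjoint. -/
lemma simplePolygon_injective (hP : IsSimplePolygon P) : Function.Injective P := by
  intro i j hij
  by_contra hne
  obtain ⟨-, hnd, -, hdis⟩ := hP
  by_cases h1 : j = finRotate n i
  · exact hnd i (h1 ▸ hij)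
  by_cases h2 : i = finRotate n j
  · exact hnd j (h2 ▸ hij.symm)
  refine (Set.disjoint_left.1 (hdis i j hne h1 h2)) (a := P i) ?_ ?_
  · exact left_mem_affineSegment ℝ _ _
  · rw [hij]
    exact left_mem_affineSegment ℝ _ _

/-- The edges of the polygon are faces of the only triangle, so all its vertices, at least three and
distinct, belong to `T`. Hence the polygon has exactly three edges, namely the sides of `T`, and a
property assumed on polygon edges holds on every side. -/
lemma exists_vertices_of_single (hP : IsSimplePolygon P) (hS : IsSubtriangulation P K S)
    (hT : triangles S = {T}) : ∃ a b c, T = {a, b, c} ∧ cross (b - a) (c - a) ≠ 0 ∧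
      ∀ q : Plane → Plane → Prop, (∀ i, P i ∈ T → P (finRotate n i) ∈ T →
        q (P i) (P (finRotate n i))) → q a b ∧ q b c ∧ q c a := by
  have hTS : T ∈ triangles S := by rw [hT]; rfl
  have hmem : ∀ i, P i ∈ T := fun i => by
    obtain ⟨e, he, hei⟩ := hS.edges i
    obtain ⟨T', hT', heT⟩ := hS.pure e he
    rw [hT, mem_singleton_iff] at hT'
    rw [← hT']
    refine heT ?_
    rw [← Finset.mem_coe, hei]
    exact Or.inl rfl
  have hinj := simplePolygon_injective hP
  have hn : n ≤ 3 := by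
    rw [← hTS.2, ← Fintype.card_fin n, ← Finset.card_univ,
      ← Finset.card_image_of_injective _ hinj]
    refine Finset.card_le_card fun x hx => ?_
    obtain ⟨i, -, rfl⟩ := Finset.mem_image.1 hx
    exact hmem i
  obtain rfl : n = 3 := le_antisymm hn hP.1
  obtain ⟨c, hc, hcr⟩ := exists_third_vertex hTS (hmem 0) (hmem 1) (hinj.ne (by decide))
  have h2 : P 2 = c := by
    have h3 := hmem 2
    rw [hc] at h3
    simp only [Finset.mem_insert, Finset.mem_singleton] at h3
    exact (h3.resolve_left (hinj.ne (by decide))).resolve_left (hinj.ne (by decide))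
  refine ⟨P 0, P 1, P 2, by rw [h2]; exact hc, by rwa [h2], fun q hq => ?_⟩
  have := fun i => hq i (hmem _) (hmem _)
  exact ⟨this 0, this 1, this 2⟩

/-- The divergence has degree at most `m`, so it can be tested against itself and vanishes. Green's
formula with the vanishing normal moments then gives orthogonality to gradients of `P_m`. Combined
with orthogonality to `𝒢_{m-1}^⊥`, all interior moments vanish and unisolvence applies. -/
lemma isHomogeneous_eq_zero (hP : IsSimplePolygon P) (hS : IsSubtriangulation P K S)
    (hKT : K = convexHull ℝ (T : Set Plane)) (hT : triangles S = {T}) {m : ℕ} {u : L2 K}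
    (hu : IsHomogeneous P K S m u) : u = 0 := by
  have hTS : T ∈ triangles S := by rw [hT]; rfl
  have hKc : IsCompact K := hKT ▸ isCompact_convexHull_triangle T
  obtain ⟨p, hp, hup, hv⟩ := hu.loc T hTS
  obtain ⟨a, b, c, hTe, hc, hq⟩ := exists_vertices_of_single hP hS hT
  obtain ⟨vab, vbc, vca⟩ := hq (fun a b => VanishingMoments m a b (evalVec p)) hv
  have hKe : K = convexHull ℝ {a, b, c} := by rw [hKT, hTe, coe_triple]
  rw [← hKT] at hup
  obtain ⟨d, hd, hdq⟩ := hu.div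
  have hpd := ((memH1With_of_contDiff hKc (contDiff_evalVec p)).memHDivWith hKc).congr hup
    (Eventually.of_forall fun _ => rfl)
  -- The divergence in the constraint is only known abstractly; uniqueness of weak divergences
  -- identifies it with that of the polynomial.
  have hdp : ∀ᵐ x ∂(volume.restrict K), d x = evalPoly (divPoly p) x :=
    (weakDiv_unique hS.volume_diff_interior hKc hd hpd).mono fun x hx => by
      rw [hx, jacTrace_fderiv_evalVec]
  have hne : (interior K).Nonempty := hKe ▸ interior_triangle_nonempty hc
  have hdiv : divPoly p = 0 := by
    have h1 := hdq (evalPoly (divPoly p)) fun T' hT' =>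
      ⟨_, divPoly_mem_of_rt hp, Eventually.of_forall fun _ => rfl⟩
    have h2 : ∫ x in K, evalPoly (divPoly p * divPoly p) x = 0 := by
      rw [← h1]
      refine integral_congr_ae (hdp.mono fun x hx => ?_)
      simp only
      rw [hx, evalPoly_mul]
    have h3 := poly_eq_zero_of_integral_eq_zero hKc hne
      (fun x _ => by rw [evalPoly_mul]; exact mul_self_nonneg _) h2
    exact mul_self_eq_zero.1 h3
  have hvol : ∀ q ∈ vecPolyDeg ((m : ℤ) - 1), ∫ x in convexHull ℝ {a, b, c},
      inner ℝ (evalVec p x) (evalVec q x) = 0 := fun q hq => by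
    rw [← hKe]
    obtain ⟨r, hr, hqr⟩ := exists_grad_add_gradOrtho hKc hq
    have hi : ∀ q, IntegrableOn (fun x => (inner ℝ (evalVec p x) (evalVec q x) : ℝ)) K := fun q =>
      ((continuous_evalVec _).inner (continuous_evalVec _)).continuousOn.integrableOn_compact hKc
    have h1 : ∫ x in K, inner ℝ (evalVec p x) (evalVec (q - gradPoly r) x) = 0 := by
      rw [← hu.ortho _ hqr]
      exact integral_congr_ae (hup.mono fun x hx => by simp only [hx])
    have h2 : ∫ x in K, inner ℝ (evalVec p x) (evalVec (gradPoly r) x) = 0 := by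
      have h3 := green_poly hc p r
      rw [vab r hr, vbc r hr, vca r hr, hdiv, ← hKe] at h3
      simp only [mul_zero, evalPoly_zero, integral_zero, zero_add, add_zero] at h3
      exact (mul_eq_zero.1 h3).resolve_left (sign_ne_zero_of_ne hc)
    simp only [evalVec_sub, inner_sub_right] at h1
    rw [integral_sub (hi _) (hi _), h2, sub_zero] at h1
    exact h1
  have hp0 := rtPoly_eq_zero hc hp hvol vab vbc vca
  refine Lp.ext ?_
  filter_upwards [hup, Lp.coeFn_zero Plane 2 (volume.restrict K)] with x hx hx'
  rw [hx, hx', hp0, evalVec_zero, Pi.zero_apply]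

/-- `K` contains a vertex of the polygon and is the closure of its interior. -/
lemma IsPolygonalCell.interior_nonempty (hK : IsPolygonalCell P K) : (interior K).Nonempty := by
  rw [← closure_nonempty_iff, hK.regular]
  have h0 : 0 < n := by have := hK.simple.1; omega
  have h1 : P ⟨0, h0⟩ ∈ frontier K := by
    rw [hK.frontier_eq]
    exact mem_iUnion.2 ⟨⟨0, h0⟩, left_mem_affineSegment ℝ _ _⟩
  exact ⟨_, hK.compact.isClosed.frontier_subset h1⟩

end

end PolyRT

end

/-! ### The main theorem -/

theorem mainTheorem4 {n : ℕ} (P : Polygon PolyRT.Plane n) (K : Set PolyRT.Plane)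
    (hK : PolyRT.IsPolygonalCell P K)
    (S : Geometry.SimplicialComplex ℝ PolyRT.Plane) (hS : PolyRT.IsSubtriangulation P K S)
    (ν : ℝ) (hν : 0 < ν) (k m : ℕ)
    (v : PolyRT.L2 K) (hv : v ∈ PolyRT.virtualSpace P K ν k) :
    ∃ vRT z : PolyRT.L2 K,
      -- the standard interpolation and the energy projection exist and are unique
      (∀ w, PolyRT.IsStandardInterpolation K S m v w ↔ w = vRT) ∧
      (∀ w, PolyRT.IsEnergyProjection K ν k v w ↔ w = z) ∧
      -- the standard interpolation satisfies the constraints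
      vRT ∈ PolyRT.constraintSet P K S v m ∧
      -- the local minimisation problem has exactly one solution
      (∃! w, w ∈ PolyRT.constraintSet P K S v m ∧
        ∀ w' ∈ PolyRT.constraintSet P K S v m, ‖z - w‖ ≤ ‖z - w'‖) ∧
      -- the case of a single triangle
      (∀ T : Finset PolyRT.Plane, K = convexHull ℝ (T : Set PolyRT.Plane) →
        PolyRT.triangles S = {T} → PolyRT.constraintSet P K S v m = {vRT}) := by
  obtain ⟨G, hG, -⟩ := hv
  have hKc := hK.compact
  have hP := hK.simple.2.1
  obtain ⟨φ, g, h⟩ := PolyRT.exists_traceData hK hS hG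
  obtain ⟨w, p, d, hw⟩ := h.exists_globalInterpolation hS hKc m
  obtain ⟨z, hz⟩ := PolyRT.exists_energyProjection hKc hK.interior_nonempty
    hS.volume_diff_interior hν k v hG
  have hwC := h.mem_constraintSet hK hS hw
  refine ⟨w, z, h.isStandardInterpolation_iff hS hw, hz, hwC,
    h.existsUnique_minimizer hKc hP hS hwC z, fun T hKT hT => ?_⟩
  refine Set.eq_singleton_iff_unique_mem.2 ⟨hwC, fun w' hw' => sub_eq_zero.1 ?_⟩
  exact PolyRT.isHomogeneous_eq_zero hK.simple hS hKT hT
    (h.isHomogeneous_sub hKc hP hS hwC hw')
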